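/- **Setting.** Let $G_2=\{[x,A]:x\in\mathbb R^2,\ A\in \mathrm{GL}_2(\mathbb R)\}$ be the group of affine transformations $z\mapsto x+Az$ of the plane, so $[x,A][y,B]=[x+Ay,AB]$, with left Haar measure $$\int_{G_2} f\,d\mu=\int_{\mathrm{GL}_2(\mathbb R)}\int_{\mathbb R^2} f[x,A]\,\frac{dx\,dA}{|\det A|^{3}},$$ where $dA$ is Lebesgue measure on the matrix entries. Let $\lambda_{G_2}$ be the left regular representation on $L^2(G_2)$, $\lambda_{G_2}(g)f(h)=f(g^{-1}h)$. Let $\mathcal O$ be the set of nonzero row vectors $\omega=(\omega_1,\omega_2)$ and $\mathcal O_1=\mathbb R\setminus\{0\}$, both with Lebesgue measure, and let $\mathbb R^*=\mathbb R\setminus\{0\}$ be the multiplicative group with Haar measure $dt/|t|$. For $\omega\in\mathcal O$ put $$\gamma(\omega)=\frac1{\|\omega\|^2}\begin{pmatrix}\omega_1&-\omega_2\\ \omega_2&\omega_1\end{pmatrix},$$ and let $K=\{[0,\gamma(\omega)]:\omega\in\mathcal O\}$, a subgroup of $G_2$ with Haar measure $d\omega/\|\omega\|^2$ in the coordinate $\omega$.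 For $\omega\in\mathcal O$ and $A\in\mathrm{GL}_2(\mathbb R)$ one has $$\gamma(\omega)^{-1}A\,\gamma(\omega A)=\begin{pmatrix}1&0\\ u_{\omega,A}&v_{\omega,A}\end{pmatrix}$$ with real numbers $u_{\omega,A}$ and $v_{\omega,A}\neq0$. Let $\sigma$ be the unitary representation of $G_2$ on $L^2(K,L^2(\mathbb R^*))$ given by $$\big(\sigma[x,A]F[0,\gamma(\omega)]\big)(t)=\frac{|\det A|^{1/2}\|\omega\|}{\|\omega A\|}\,e^{2\pi i(\omega x+t^{-1}u_{\omega,A})}\,\big(F[0,\gamma(\omega A)]\big)(v_{\omega,A}^{-1}t)$$ for a.e. $\omega\in\mathcal O$ and a.e. $t\in\mathbb R^*$. **Theorem.** Let $\{\eta_i:i\in I\}$ be an orthonormal basis of $L^2(\mathcal O)$ with $\int_{\mathcal O}\|\omega\|^2|\eta_i(\omega)|^2\,d\omega<\infty$ for every $i$, and let $\{g_j:j\in J\}$ be an orthonormal basis of $L^2(\mathcal O_1)$ with $g_j\in L^2(\mathbb R^*)$ for every $j$. For $(i,j)\in I\times J$ let $$E_{i,j}[0,L](\nu)=\frac{\overline{\eta_i}((1,0)L^{-1})}{|\det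 L|}\,g_j(\nu),\qquad [0,L]\in K,\ \nu\in\mathbb R^*,$$ which is an element of $L^2(K,L^2(\mathbb R^*))$. For $F\in L^2(K,L^2(\mathbb R^*))$ define the function $V_{E_{i,j}}F$ on $G_2$ by $$V_{E_{i,j}}F[x,A]=\langle F,\sigma[x,A]E_{i,j}\rangle_{L^2(K,L^2(\mathbb R^*))},$$ and let $\mathcal M_{i,j}=V_{E_{i,j}}L^2(K,L^2(\mathbb R^*))$. Then each $\mathcal M_{i,j}$ is a closed $\lambda_{G_2}$-invariant subspace of $L^2(G_2)$, and $V_{E_{i,j}}$ is a linear isometry of $L^2(K,L^2(\mathbb R^*))$ onto $\mathcal M_{i,j}$ that intertwines $\sigma$ with the restriction of $\lambda_{G_2}$ to $\mathcal M_{i,j}$. Moreover $L^2(G_2)=\bigoplus_{(i,j)\in I\times J}\mathcal M_{i,j}$ as a Hilbert space orthogonal direct sum. -/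

import Mathlib

open MeasureTheory Matrix
open scoped ENNReal ComplexConjugate

noncomputable section
namespace AffineTwo

/-- Lebesgue measure (and the Borel sets) on the space of real two by two matrices. -/
instance matrixMeasureSpace : MeasureSpace (Matrix (Fin 2) (Fin 2) ℝ) :=
  inferInstanceAs (MeasureSpace (Fin 2 → Fin 2 → ℝ))

/-- The affine group of the plane: `⟨x, A⟩` is the transformation `z ↦ x + A z`. -/
@[ext] structure G2 where
  trans : Fin 2 → ℝ
  lin : GL (Fin 2) ℝ

namespace G2

/-- Composition: `[x, A] [y, B] = [x + A y, A B]`. -/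
instance : Mul G2 := ⟨fun g h => ⟨g.trans + (g.lin : Matrix (Fin 2) (Fin 2) ℝ) *ᵥ h.trans, g.lin * h.lin⟩⟩
instance : One G2 := ⟨⟨0, 1⟩⟩
instance : Inv G2 :=
  ⟨fun g => ⟨-((g.lin⁻¹ : GL (Fin 2) ℝ) : Matrix (Fin 2) (Fin 2) ℝ) *ᵥ g.trans, g.lin⁻¹⟩⟩

@[simp] theorem mul_trans (g h : G2) :
    (g * h).trans = g.trans + (g.lin : Matrix (Fin 2) (Fin 2) ℝ) *ᵥ h.trans := rfl
@[simp] theorem mul_lin (g h : G2) : (g * h).lin = g.lin * h.lin := rfl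
@[simp] theorem one_trans : (1 : G2).trans = 0 := rfl
@[simp] theorem one_lin : (1 : G2).lin = 1 := rfl
@[simp] theorem inv_trans (g : G2) :
    (g⁻¹).trans = -((g.lin⁻¹ : GL (Fin 2) ℝ) : Matrix (Fin 2) (Fin 2) ℝ) *ᵥ g.trans := rfl
@[simp] theorem inv_lin (g : G2) : (g⁻¹).lin = g.lin⁻¹ := rfl

instance : Group G2 :=
  Group.ofLeftAxioms
    (fun a b c => by
      ext1
      · rw [mul_trans, mul_trans, mul_trans, mul_trans, mul_lin, Units.val_mul,
          Matrix.mulVec_add, Matrix.mulVec_mulVec, add_assoc]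
      · simp [mul_assoc])
    (fun a => by ext1 <;> simp)
    (fun a => by ext1 <;> simp [Matrix.neg_mulVec])

def equivProd : G2 ≃ (Fin 2 → ℝ) × GL (Fin 2) ℝ where
  toFun g := (g.trans, g.lin)
  invFun p := ⟨p.1, p.2⟩
  left_inv _ := rfl
  right_inv _ := rfl

/-- The Borel sets of `G2`, a copy of `ℝ² × GL₂(ℝ)`. -/
instance : MeasurableSpace G2 := MeasurableSpace.comap equivProd inferInstance

theorem measurable_equivProd : Measurable equivProd := comap_measurable _

theorem measurable_equivProd_symm : Measurable equivProd.symm := by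
  rw [measurable_comap_iff]
  exact measurable_id

end G2

/-- Haar measure of `GL₂(ℝ)`: `dA / |det A|²`. -/
def haarGL2 : Measure (GL (Fin 2) ℝ) :=
  ((volume : Measure (Matrix (Fin 2) (Fin 2) ℝ)).comap Units.val).withDensity
    fun A => ENNReal.ofReal (|(A : Matrix (Fin 2) (Fin 2) ℝ).det| ^ 2)⁻¹

/-- Left Haar measure of `G2`: `dx dμ(A) / |det A|`, with `μ` the Haar measure of `GL₂(ℝ)`. -/
def haarG2 : Measure G2 :=
  ((volume : Measure (Fin 2 → ℝ)).prod
    (haarGL2.withDensity fun A => ENNReal.ofReal (|(A : Matrix (Fin 2) (Fin 2) ℝ).det|)⁻¹)).map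
      G2.equivProd.symm

theorem measurable_det : Measurable (fun A : Matrix (Fin 2) (Fin 2) ℝ => A.det) := by
  have h : (fun A : Matrix (Fin 2) (Fin 2) ℝ => A.det) =
      fun A : Fin 2 → Fin 2 → ℝ => A 0 0 * A 1 1 - A 0 1 * A 1 0 := by
    funext A; exact Matrix.det_fin_two A
  rw [h]
  exact Measurable.sub (by fun_prop) (by fun_prop) (α := Fin 2 → Fin 2 → ℝ)

theorem measurableEmbedding_units : MeasurableEmbedding
    (Units.val : GL (Fin 2) ℝ → Matrix (Fin 2) (Fin 2) ℝ) := by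
  refine ⟨Units.val_injective, comap_measurable _, ?_⟩
  intro s hs
  obtain ⟨t, ht, rfl⟩ := hs
  rw [Set.image_preimage_eq_inter_range]
  refine ht.inter ?_
  have : Set.range (Units.val : GL (Fin 2) ℝ → Matrix (Fin 2) (Fin 2) ℝ)
      = (fun A : Matrix (Fin 2) (Fin 2) ℝ => A.det) ⁻¹' {0}ᶜ := by
    ext A
    simp only [Set.mem_range, Set.mem_preimage, Set.mem_compl_iff, Set.mem_singleton_iff]
    rw [← ne_eq, ← isUnit_iff_ne_zero, ← Matrix.isUnit_iff_isUnit_det]; rfl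
  rw [this]
  exact measurable_det (measurableSet_singleton 0).compl

theorem map_mul_left_volume (A : GL (Fin 2) ℝ) :
    (volume : Measure (Matrix (Fin 2) (Fin 2) ℝ)).map (fun M => A.val * M)
      = ENNReal.ofReal (|A.val.det| ^ 2)⁻¹ • volume := by
  have hA : A.val.det ≠ 0 := ((Matrix.isUnit_iff_isUnit_det _).1 A.isUnit).ne_zero
  let e : (Fin 2 → Fin 2 → ℝ) ≃ₗ[ℝ] (Fin 2 → Fin 2 → ℝ) :=
    Matrix.transposeLinearEquiv (Fin 2) (Fin 2) ℝ ℝ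
  let f : (Fin 2 → Fin 2 → ℝ) →ₗ[ℝ] (Fin 2 → Fin 2 → ℝ) :=
    mulLeftLinearMap (Fin 2) ℝ A.val
  have hf : LinearMap.det f = A.val.det ^ 2 := by
    rw [← LinearMap.det_conj f e]
    have : (e : (Fin 2 → Fin 2 → ℝ) →ₗ[ℝ] (Fin 2 → Fin 2 → ℝ)) ∘ₗ f ∘ₗ e.symm =
        LinearMap.pi (fun i => (Matrix.toLin' A.val) ∘ₗ LinearMap.proj i) := by
      refine LinearMap.ext fun M => ?_
      funext i j
      change (A.val * Matrix.transpose M) j i = (A.val *ᵥ M i) j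
      rfl
    rw [this, LinearMap.det_pi]
    simp
  have := Measure.map_linearMap_addHaar_eq_smul_addHaar
    (volume : Measure (Fin 2 → Fin 2 → ℝ)) (f := f) (by rw [hf]; positivity)
  rw [hf] at this
  rw [← abs_pow, ← abs_inv]
  exact this

theorem map_withDensity_of_map_eq {α : Type*} [MeasurableSpace α] {μ : Measure α} {T : α → α}
    (hT : Measurable T) {c : ℝ≥0∞} (hmap : μ.map T = c • μ) {h : α → ℝ≥0∞} (hh : Measurable h)
    {d : ℝ≥0∞} (hd : ∀ x, h x = d * h (T x)) :
    (μ.withDensity h).map T = (d * c) • μ.withDensity h := by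
  ext s hs
  rw [Measure.map_apply hT hs, withDensity_apply _ (hT hs), Measure.smul_apply,
    withDensity_apply _ hs]
  have : ∫⁻ x in T ⁻¹' s, h x ∂μ = ∫⁻ x in T ⁻¹' s, (d * h (T x)) ∂μ :=
    lintegral_congr fun x => hd x
  rw [this, lintegral_const_mul _ (f := fun x => h (T x)) (hh.comp hT), ← setLIntegral_map hs hh hT, hmap,
    Measure.restrict_smul, lintegral_smul_measure, smul_eq_mul, smul_eq_mul, mul_assoc]

theorem measurable_matrix_mul_left (A : Matrix (Fin 2) (Fin 2) ℝ) :
    Measurable (fun M : Matrix (Fin 2) (Fin 2) ℝ => A * M) := by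
  have h : Measurable (fun M : Fin 2 → Fin 2 → ℝ =>
      fun i j => A i 0 * M 0 j + A i 1 * M 1 j) := by
    fun_prop
  have e : (fun M : Matrix (Fin 2) (Fin 2) ℝ => A * M) =
      fun M => Matrix.of (fun i j => A i 0 * M 0 j + A i 1 * M 1 j) := by
    funext M
    ext i j
    simp [Matrix.mul_apply, Fin.sum_univ_two]
  rw [e]
  exact h

theorem measurable_mul_left_GL2 (A : GL (Fin 2) ℝ) :
    Measurable (fun B : GL (Fin 2) ℝ => A * B) := by
  rw [measurable_comap_iff]
  exact (measurable_matrix_mul_left A.val).comp (comap_measurable _)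

theorem map_mul_left_comap (A : GL (Fin 2) ℝ) :
    ((volume : Measure (Matrix (Fin 2) (Fin 2) ℝ)).comap Units.val).map (fun B => A * B)
      = ENNReal.ofReal (|A.val.det| ^ 2)⁻¹ •
        (volume : Measure (Matrix (Fin 2) (Fin 2) ℝ)).comap Units.val := by
  ext s hs
  have hm := measurable_matrix_mul_left A.val
  have himg : Units.val '' ((fun B => A * B) ⁻¹' s)
      = (fun M : Matrix (Fin 2) (Fin 2) ℝ => A.val * M) ⁻¹' (Units.val '' s) := by
    ext M
    constructor
    · rintro ⟨B, hB, rfl⟩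
      exact ⟨A * B, hB, rfl⟩
    · rintro ⟨B, hB, hBM⟩
      refine ⟨A⁻¹ * B, by simpa using hB, ?_⟩
      rw [Units.val_mul, hBM, ← mul_assoc, ← Units.val_mul]
      simp
  rw [Measure.map_apply (measurable_mul_left_GL2 A) hs,
    measurableEmbedding_units.comap_apply, himg, Measure.smul_apply,
    measurableEmbedding_units.comap_apply, ← Measure.smul_apply, ← map_mul_left_volume A,
    Measure.map_apply hm (measurableEmbedding_units.measurableSet_image.2 hs)]

theorem det_ne_zero_GL2 (A : GL (Fin 2) ℝ) : A.val.det ≠ 0 :=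
  ((Matrix.isUnit_iff_isUnit_det _).1 A.isUnit).ne_zero

theorem measurable_det_GL2 : Measurable (fun A : GL (Fin 2) ℝ => A.val.det) :=
  measurable_det.comp (comap_measurable _)

theorem measurePreserving_mul_left_GL2 (A : GL (Fin 2) ℝ) :
    MeasurePreserving (fun B : GL (Fin 2) ℝ => A * B) haarGL2 haarGL2 := by
  refine ⟨measurable_mul_left_GL2 A, ?_⟩
  have hA := det_ne_zero_GL2 A
  have h := map_withDensity_of_map_eq (measurable_mul_left_GL2 A) (map_mul_left_comap A)
    (h := fun A => ENNReal.ofReal (|(A : Matrix (Fin 2) (Fin 2) ℝ).det| ^ 2)⁻¹)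
    (((measurable_det_GL2.abs).pow_const 2).inv.ennreal_ofReal)
    (d := ENNReal.ofReal (|A.val.det| ^ 2)) (fun B => by
      rw [← ENNReal.ofReal_mul (by positivity)]
      congr 1
      have hB := det_ne_zero_GL2 B
      simp only [Units.val_mul, Matrix.det_mul, abs_mul]
      field_simp)
  rw [haarGL2, h, ← ENNReal.ofReal_mul (by positivity), mul_inv_cancel₀ (by positivity)]
  simp

theorem map_translate_volume (x : Fin 2 → ℝ) (A : GL (Fin 2) ℝ) :
    (volume : Measure (Fin 2 → ℝ)).map (fun y => x + A.val *ᵥ y)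
      = ENNReal.ofReal (|A.val.det|)⁻¹ • volume := by
  have h1 := Real.map_matrix_volume_pi_eq_smul_volume_pi (det_ne_zero_GL2 A)
  have hm : Measurable (Matrix.toLin' A.val) := 
    (LinearMap.continuous_of_finiteDimensional _).measurable
  have : (fun y => x + A.val *ᵥ y) = (fun y => x + y) ∘ (Matrix.toLin' A.val) := by
    funext y; simp
  rw [this, ← Measure.map_map (measurable_const_add x) hm, h1, Measure.map_smul,
    map_add_left_eq_self, abs_inv]

instance : SigmaFinite haarGL2 := by
  have : SigmaFinite ((volume : Measure (Matrix (Fin 2) (Fin 2) ℝ)).comap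
    (Units.val : GL (Fin 2) ℝ → _)) := by
    have : SigmaFinite (volume : Measure (Matrix (Fin 2) (Fin 2) ℝ)) :=
      inferInstanceAs (SigmaFinite (volume : Measure (Fin 2 → Fin 2 → ℝ)))
    refine SigmaFinite.of_map _ (f := (Units.val : GL (Fin 2) ℝ → Matrix (Fin 2) (Fin 2) ℝ))
      measurableEmbedding_units.measurable.aemeasurable ?_
    rw [measurableEmbedding_units.map_comap]
    infer_instance
  unfold haarGL2
  exact SigmaFinite.withDensity_ofReal _

/-- `haarG2` is left invariant. -/
theorem measurePreserving_mul_left_G2 (g : G2) :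
    MeasurePreserving (fun h : G2 => g * h) haarG2 haarG2 := by
  have hA := det_ne_zero_GL2 g.lin
  have h2 : (haarGL2.withDensity
      fun A => ENNReal.ofReal (|(A : Matrix (Fin 2) (Fin 2) ℝ).det|)⁻¹).map (fun B => g.lin * B)
      = ENNReal.ofReal (|g.lin.val.det|) • haarGL2.withDensity
      fun A => ENNReal.ofReal (|(A : Matrix (Fin 2) (Fin 2) ℝ).det|)⁻¹ := by
    have h := map_withDensity_of_map_eq (measurable_mul_left_GL2 g.lin) (c := 1)
      (by rw [(measurePreserving_mul_left_GL2 g.lin).map_eq, one_smul])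
      (h := fun A => ENNReal.ofReal (|(A : Matrix (Fin 2) (Fin 2) ℝ).det|)⁻¹)
      ((measurable_det_GL2.abs).inv.ennreal_ofReal)
      (d := ENNReal.ofReal (|g.lin.val.det|)) (fun B => by
        rw [← ENNReal.ofReal_mul (by positivity)]
        congr 1
        have hB := det_ne_zero_GL2 B
        simp only [Units.val_mul, Matrix.det_mul, abs_mul]
        field_simp)
    rw [h, mul_one]
  have hm1 : Measurable (fun y : Fin 2 → ℝ => g.trans + g.lin.val *ᵥ y) := by
    have := (LinearMap.continuous_of_finiteDimensional (Matrix.toLin' g.lin.val)).measurable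
    exact this.const_add _
  have hm2 := measurable_mul_left_GL2 g.lin
  have hcomp : (fun h : G2 => g * h) ∘ G2.equivProd.symm = G2.equivProd.symm ∘
    Prod.map (fun y => g.trans + g.lin.val *ᵥ y) (fun B => g.lin * B) := rfl
  have hm : Measurable (fun h : G2 => g * h) := by
    have : (fun h : G2 => g * h) = (G2.equivProd.symm ∘
      Prod.map (fun y => g.trans + g.lin.val *ᵥ y) (fun B => g.lin * B)) ∘ G2.equivProd := rfl
    rw [this]
    exact (G2.measurable_equivProd_symm.comp (hm1.prodMap hm2)).comp G2.measurable_equivProd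
  refine ⟨hm, ?_⟩
  rw [haarG2, Measure.map_map hm G2.measurable_equivProd_symm, hcomp,
    ← Measure.map_map G2.measurable_equivProd_symm (hm1.prodMap hm2),
    ← Measure.map_prod_map _ _ hm1 hm2, map_translate_volume, h2,
    Measure.prod_smul_left, Measure.prod_smul_right, smul_smul,
    ← ENNReal.ofReal_mul (by positivity), inv_mul_cancel₀ (by positivity)]
  simp

/-- A multiplicative family of linear isometries of a Hilbert space, as a homomorphism into
its unitary group. -/
def homOfIsometries {G E : Type*} [Group G] [NormedAddCommGroup E] [NormedSpace ℂ E]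
    (T : G → E →ₗᵢ[ℂ] E) (h1 : ∀ f, T 1 f = f) (hmul : ∀ g h f, T (g * h) f = T g (T h f)) :
    G →* (E ≃ₗᵢ[ℂ] E) where
  toFun g :=
    { toLinearEquiv := LinearEquiv.ofLinearMap (T g).toLinearMap (T g⁻¹).toLinearMap
        (by ext f; simp [← hmul, h1]) (by ext f; simp [← hmul, h1])
      norm_map' := fun f => (T g).norm_map f }
  map_one' := by ext f; exact h1 f
  map_mul' g h := by ext f; exact hmul g h f

@[simp] theorem homOfIsometries_apply {G E : Type*} [Group G] [NormedAddCommGroup E]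
    [NormedSpace ℂ E] (T : G → E →ₗᵢ[ℂ] E) (h1 : ∀ f, T 1 f = f)
    (hmul : ∀ g h f, T (g * h) f = T g (T h f)) (g : G) (f : E) :
    homOfIsometries T h1 hmul g f = T g f := rfl

/-- The Hilbert space `L²(G2)` for left Haar measure. -/
abbrev L2G2 : Type := Lp ℂ 2 haarG2

/-- The left regular representation: `(leftReg g f)(h) = f (g⁻¹ h)`. -/
def leftReg : G2 →* (L2G2 ≃ₗᵢ[ℂ] L2G2) :=
  homOfIsometries
    (fun g => Lp.compMeasurePreservingₗᵢ ℂ (fun h : G2 => g⁻¹ * h)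
      (measurePreserving_mul_left_G2 g⁻¹))
    (fun f => by
      have : (fun h : G2 => (1 : G2)⁻¹ * h) = id := by funext h; simp
      apply Lp.ext
      refine (Lp.coeFn_compMeasurePreserving f (measurePreserving_mul_left_G2 (1 : G2)⁻¹)).trans ?_
      rw [this]; rfl)
    (fun g h f => by
      apply Lp.ext
      refine (Lp.coeFn_compMeasurePreserving f
        (measurePreserving_mul_left_G2 (g * h)⁻¹)).trans ?_
      refine Filter.EventuallyEq.symm ((Lp.coeFn_compMeasurePreserving _
        (measurePreserving_mul_left_G2 g⁻¹)).trans ?_)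
      have h2 := Lp.coeFn_compMeasurePreserving f (measurePreserving_mul_left_G2 h⁻¹)
      refine ((measurePreserving_mul_left_G2 g⁻¹).quasiMeasurePreserving.ae_eq_comp h2).trans ?_
      refine Filter.Eventually.of_forall fun x => ?_
      simp [Function.comp, mul_assoc])

theorem leftReg_apply (g : G2) (f : L2G2) :
    leftReg g f =ᵐ[haarG2] fun h => f (g⁻¹ * h) :=
  Lp.coeFn_compMeasurePreserving f (measurePreserving_mul_left_G2 g⁻¹)

/-- Lebesgue measure on the nonzero reals (the nontrivial orbit in dimension one, identified
with `ℝˣ`). -/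
def lebO1 : Measure ℝˣ := (volume : Measure ℝ).comap Units.val

/-- Haar measure `dt / |t|` of the multiplicative group of nonzero reals. -/
def haarRStar : Measure ℝˣ := lebO1.withDensity fun t => ENNReal.ofReal |(t : ℝ)|⁻¹

instance : BorelSpace ℝˣ := by
  constructor
  change MeasurableSpace.comap Units.val inferInstance = borel ℝˣ
  have h := borel_comap (f := (Units.val : ℝˣ → ℝ)) (t := inferInstance)
  rw [BorelSpace.measurable_eq (α := ℝ), (Units.isEmbedding_val₀ (G₀ := ℝ)).eq_induced]
  exact h.symm

instance : SecondCountableTopology ℝˣ :=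
  (Units.isEmbedding_val₀ (G₀ := ℝ)).secondCountableTopology

instance : TopologicalSpace.PseudoMetrizableSpace ℝˣ :=
  (Units.isEmbedding_val₀ (G₀ := ℝ)).isInducing.pseudoMetrizableSpace

instance : IsLocallyFiniteMeasure haarRStar := by
  have : IsLocallyFiniteMeasure lebO1 := by
    have := Measure.Regular.comap' (volume : Measure ℝ) (Units.isOpenEmbedding_val (R := ℝ))
    unfold lebO1
    infer_instance
  refine IsLocallyFiniteMeasure.withDensity_ofReal ?_
  have h : Continuous fun t : ℝˣ => (t : ℝ) := Units.continuous_val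
  exact h.abs.inv₀ fun t => abs_ne_zero.2 t.ne_zero

instance : haarRStar.InnerRegularCompactLTTop := by infer_instance

theorem map_mul_left_lebO1 (a : ℝˣ) :
    lebO1.map (fun b => a * b) = ENNReal.ofReal |(a : ℝ)|⁻¹ • lebO1 := by
  have hemb := (Units.isOpenEmbedding_val (R := ℝ)).measurableEmbedding
  ext s hs
  have himg : Units.val '' ((fun b => a * b) ⁻¹' s)
      = (fun x : ℝ => (a : ℝ) * x) ⁻¹' (Units.val '' s) := by
    ext x
    constructor
    · rintro ⟨b, hb, rfl⟩
      exact ⟨a * b, hb, rfl⟩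
    · rintro ⟨b, hb, hbx⟩
      refine ⟨a⁻¹ * b, by simpa using hb, ?_⟩
      rw [Units.val_mul, hbx]
      simp
  rw [Measure.map_apply (measurable_const_mul a) hs, lebO1, hemb.comap_apply, himg,
    Measure.smul_apply, hemb.comap_apply, ← Measure.smul_apply, ← abs_inv,
    ← Real.map_volume_mul_left a.ne_zero,
    Measure.map_apply (measurable_const_mul _) (hemb.measurableSet_image.2 hs)]

theorem measurePreserving_mul_left_RStar (a : ℝˣ) :
    MeasurePreserving (fun b : ℝˣ => a * b) haarRStar haarRStar := by
  refine ⟨measurable_const_mul a, ?_⟩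
  have ha := a.ne_zero
  have h := map_withDensity_of_map_eq (measurable_const_mul a) (map_mul_left_lebO1 a)
    (h := fun t => ENNReal.ofReal |(t : ℝ)|⁻¹)
    ((measurable_norm.comp (comap_measurable Units.val)).inv.ennreal_ofReal)
    (d := ENNReal.ofReal |(a : ℝ)|) (fun b => by
      rw [← ENNReal.ofReal_mul (by positivity)]
      congr 1
      have hb := b.ne_zero
      simp only [Units.val_mul, abs_mul]
      field_simp)
  rw [haarRStar, h, ← ENNReal.ofReal_mul (by positivity), mul_inv_cancel₀ (by positivity)]
  simp

instance : SMulInvariantMeasure ℝˣ ℝˣ haarRStar :=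
  ⟨fun a _ hs => (measurePreserving_mul_left_RStar a).measure_preimage hs.nullMeasurableSet⟩

abbrev L2O1 : Type := Lp ℂ 2 lebO1
abbrev L2RStar : Type := Lp ℂ 2 haarRStar

/-- `phase s = exp(2π i s)`. -/
def phase (s : ℝ) : ℂ := Complex.exp (2 * Real.pi * Complex.I * s)

theorem norm_phase (s : ℝ) : ‖phase s‖ = 1 := by
  rw [phase, show 2 * (Real.pi : ℂ) * Complex.I * s = ((2 * Real.pi * s : ℝ) : ℂ) * Complex.I by
    push_cast; ring]
  exact Complex.norm_exp_ofReal_mul_I _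

theorem phase_add (s t : ℝ) : phase (s + t) = phase s * phase t := by
  rw [phase, phase, phase, ← Complex.exp_add]; push_cast; ring_nf

theorem phase_zero : phase 0 = 1 := by simp [phase]

theorem continuous_phase : Continuous phase := by unfold phase; fun_prop

theorem memLp_modulation (x : ℝ) (f : L2RStar) :
    MemLp (fun b : ℝˣ => phase ((b : ℝ)⁻¹ * x) * f b) 2 haarRStar := by
  refine (Lp.memLp f).of_le (f := fun b : ℝˣ => phase ((b : ℝ)⁻¹ * x) * f b) ?_ ?_
  · refine AEStronglyMeasurable.mul ?_ (Lp.aestronglyMeasurable f)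
    refine (continuous_phase.measurable.comp ?_).aestronglyMeasurable
    exact ((comap_measurable Units.val).inv).mul_const x
  · exact Filter.Eventually.of_forall fun b => by rw [norm_mul, norm_phase, one_mul]

/-- Multiplication by `b ↦ exp(2π i b⁻¹ x)` on `L²(ℝˣ)`. -/
def modulation (x : ℝ) : L2RStar →ₗᵢ[ℂ] L2RStar where
  toFun f := (memLp_modulation x f).toLp _
  map_add' f g := by
    apply Lp.ext
    filter_upwards [(memLp_modulation x (f + g)).coeFn_toLp, (memLp_modulation x f).coeFn_toLp,
      (memLp_modulation x g).coeFn_toLp, Lp.coeFn_add f g,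
      Lp.coeFn_add ((memLp_modulation x f).toLp _) ((memLp_modulation x g).toLp _)]
      with b h1 h2 h3 h4 h5
    rw [h1, h5, Pi.add_apply, h2, h3, h4, Pi.add_apply, mul_add]
  map_smul' c f := by
    apply Lp.ext
    filter_upwards [(memLp_modulation x (c • f)).coeFn_toLp, (memLp_modulation x f).coeFn_toLp,
      Lp.coeFn_smul c f, Lp.coeFn_smul c ((memLp_modulation x f).toLp _)] with b h1 h2 h3 h4
    rw [h1, RingHom.id_apply, h4, Pi.smul_apply, h2, h3, Pi.smul_apply, smul_eq_mul, smul_eq_mul]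
    ring
  norm_map' f := by
    change ‖(memLp_modulation x f).toLp _‖ = ‖f‖
    rw [Lp.norm_toLp, Lp.norm_def]
    congr 1
    exact eLpNorm_congr_norm_ae (Filter.Eventually.of_forall fun b => by
      rw [norm_mul, norm_phase, one_mul])

theorem modulation_apply (x : ℝ) (f : L2RStar) :
    modulation x f =ᵐ[haarRStar] fun b => phase ((b : ℝ)⁻¹ * x) * f b :=
  (memLp_modulation x f).coeFn_toLp

/-- Left translation `f ↦ f (a⁻¹ ·)` on `L²(ℝˣ)`. -/
def dilation (a : ℝˣ) : L2RStar →ₗᵢ[ℂ] L2RStar :=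
  Lp.compMeasurePreservingₗᵢ ℂ (fun b : ℝˣ => a⁻¹ * b) (measurePreserving_mul_left_RStar a⁻¹)

theorem dilation_apply (a : ℝˣ) (f : L2RStar) :
    dilation a f =ᵐ[haarRStar] fun b => f (a⁻¹ * b) :=
  Lp.coeFn_compMeasurePreserving f (measurePreserving_mul_left_RStar a⁻¹)

/-- The operator `(piOne x a f)(b) = exp(2π i b⁻¹ x) f (a⁻¹ b)` on `L²(ℝˣ)`; these operators
form a representation of the affine group of the line. -/
def piOne (x : ℝ) (a : ℝˣ) : L2RStar →ₗᵢ[ℂ] L2RStar := (modulation x).comp (dilation a)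

theorem piOne_apply (x : ℝ) (a : ℝˣ) (f : L2RStar) :
    piOne x a f =ᵐ[haarRStar] fun b => phase ((b : ℝ)⁻¹ * x) * f (a⁻¹ * b) := by
  refine (modulation_apply x (dilation a f)).trans ?_
  filter_upwards [dilation_apply a f] with b hb
  rw [hb]

theorem piOne_one (f : L2RStar) : piOne 0 1 f = f := by
  apply Lp.ext
  filter_upwards [piOne_apply 0 1 f] with b hb
  rw [hb]; simp [phase_zero]

theorem piOne_mul (x y : ℝ) (a b : ℝˣ) (f : L2RStar) :
    piOne (x + a * y) (a * b) f = piOne x a (piOne y b f) := by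
  apply Lp.ext
  have h := (measurePreserving_mul_left_RStar a⁻¹).quasiMeasurePreserving.ae_eq_comp
    (piOne_apply y b f)
  filter_upwards [piOne_apply (x + a * y) (a * b) f, piOne_apply x a (piOne y b f), h]
    with t h1 h2 h3
  simp only [Function.comp] at h3
  rw [h1, h2, h3, ← mul_assoc, ← phase_add]
  congr 2
  · have := a.ne_zero
    have := t.ne_zero
    rw [Units.val_mul, Units.val_inv_eq_inv_val]
    field_simp
  · rw [_root_.mul_inv_rev, mul_assoc]

theorem continuous_dilation : Continuous fun p : ℝˣ × L2RStar => dilation p.1 p.2 := by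
  have : Fact ((2 : ℝ≥0∞) ≠ ∞) := ⟨by simp⟩
  have h : Continuous fun p : ℝˣ × L2RStar => DomMulAct.mk (p.1⁻¹) • p.2 := by
    have h1 : Continuous fun p : ℝˣ × L2RStar => DomMulAct.mk (p.1⁻¹) :=
      DomMulAct.continuous_mk.comp continuous_fst.inv
    exact h1.smul continuous_snd
  exact h

theorem continuous_modulation : Continuous fun p : ℝ × L2RStar => modulation p.1 p.2 := by
  refine continuous_prod_of_continuous_lipschitzWith' _ 1 (fun x => (modulation x).lipschitz) ?_
  intro f
  rw [continuous_iff_continuousAt]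
  intro x
  refine (Lp.tendsto_Lp_iff_tendsto_eLpNorm'' _ (fun y => memLp_modulation y f) _
    (memLp_modulation x f)).2 ?_
  have hmeas : ∀ y : ℝ, AEStronglyMeasurable (fun b : ℝˣ => phase ((b : ℝ)⁻¹ * y) * f b)
      haarRStar := fun y => (memLp_modulation y f).1
  have hfin : ∫⁻ b, (2 * ‖f b‖ₑ) ^ (2 : ℝ) ∂haarRStar ≠ ∞ := by
    have h := lintegral_rpow_enorm_lt_top_of_eLpNorm_lt_top (p := 2) (by simp) (by simp)
      (Lp.memLp f).2
    simp only [ENNReal.toReal_ofNat] at h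
    simp_rw [ENNReal.mul_rpow_of_nonneg _ _ (zero_le_two (α := ℝ))]
    rw [lintegral_const_mul' _ _ (by simp)]
    exact ENNReal.mul_ne_top (by simp) h.ne
  have key : Filter.Tendsto (fun y : ℝ => ∫⁻ b : ℝˣ,
      ‖phase ((b : ℝ)⁻¹ * y) * f b - phase ((b : ℝ)⁻¹ * x) * f b‖ₑ ^ (2 : ℝ) ∂haarRStar)
      (nhds x) (nhds 0) := by
    have h0 : (0 : ℝ≥0∞) = ∫⁻ _b : ℝˣ, 0 ∂haarRStar := by simp
    rw [h0]
    refine Filter.tendsto_of_seq_tendsto fun u hu => ?_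
    refine tendsto_lintegral_of_dominated_convergence'
      (fun b => (2 * ‖f b‖ₑ) ^ (2 : ℝ)) ?_ ?_ hfin ?_
    · exact fun n => ((hmeas (u n)).sub (hmeas x)).enorm.pow_const _
    · refine fun n => Filter.Eventually.of_forall fun b => ?_
      refine ENNReal.rpow_le_rpow ?_ zero_le_two
      refine (enorm_sub_le).trans ?_
      have hp : ∀ s, ‖phase s‖ₑ = 1 := fun s => by
        rw [← ofReal_norm, norm_phase, ENNReal.ofReal_one]
      rw [enorm_mul, enorm_mul, hp, hp, one_mul, two_mul]
    · refine Filter.Eventually.of_forall fun b => ?_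
      have hc : Continuous fun y : ℝ =>
          ‖phase ((b : ℝ)⁻¹ * y) * f b - phase ((b : ℝ)⁻¹ * x) * f b‖ₑ ^ (2 : ℝ) := by
        have h1 : Continuous fun y : ℝ =>
            phase ((b : ℝ)⁻¹ * y) * f b - phase ((b : ℝ)⁻¹ * x) * f b :=
          ((continuous_phase.comp (continuous_const.mul continuous_id)).mul
            continuous_const).sub continuous_const
        exact (ENNReal.continuous_rpow_const).comp h1.enorm
      have := (hc.tendsto x).comp hu
      simpa [Function.comp_def] using this
  have h2 : Filter.Tendsto (fun y : ℝ => (∫⁻ b : ℝˣ, ‖phase ((b : ℝ)⁻¹ * y) * f b -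
      phase ((b : ℝ)⁻¹ * x) * f b‖ₑ ^ (2 : ℝ) ∂haarRStar) ^ (1 / 2 : ℝ)) (nhds x) (nhds 0) := by
    have h3 := ((ENNReal.continuous_rpow_const (y := (1 / 2 : ℝ))).tendsto 0).comp key
    rw [ENNReal.zero_rpow_of_pos (by norm_num)] at h3
    exact h3
  refine Filter.Tendsto.congr (fun y => ?_) h2
  rw [eLpNorm_eq_lintegral_rpow_enorm_toReal (by simp) (by simp), ENNReal.toReal_ofNat]
  rfl

theorem continuous_piOne :
    Continuous fun p : (ℝ × ℝˣ) × L2RStar => piOne p.1.1 p.1.2 p.2 := by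
  refine continuous_prod_of_continuous_lipschitzWith' _ 1
    (fun q => (piOne q.1 q.2).lipschitz) fun f => ?_
  have h1 : Continuous fun a : ℝˣ => dilation a f :=
    (continuous_dilation.comp (continuous_id.prodMk continuous_const) :)
  have h2 : Continuous fun q : ℝ × ℝˣ => (q.1, dilation q.2 f) :=
    continuous_fst.prodMk (h1.comp continuous_snd)
  exact (continuous_modulation.comp h2 :)

/-- The nontrivial orbit: nonzero row vectors of length two. -/
abbrev Orbit : Type := {ω : Fin 2 → ℝ // ω ≠ 0}

/-- Lebesgue measure on the orbit. -/
def lebO : Measure Orbit := (volume : Measure (Fin 2 → ℝ)).comap Subtype.val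

abbrev L2O : Type := Lp ℂ 2 lebO

/-- The Euclidean norm of a row vector. -/
def rowNorm (ω : Fin 2 → ℝ) : ℝ := √(ω 0 ^ 2 + ω 1 ^ 2)

theorem rowNorm_sq (ω : Fin 2 → ℝ) : rowNorm ω ^ 2 = ω 0 ^ 2 + ω 1 ^ 2 :=
  Real.sq_sqrt (by positivity)

theorem sq_add_sq_pos (ω : Orbit) : 0 < ω.1 0 ^ 2 + ω.1 1 ^ 2 := by
  rcases lt_or_eq_of_le (show 0 ≤ ω.1 0 ^ 2 + ω.1 1 ^ 2 by positivity) with h | h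
  · exact h
  · exfalso
    apply ω.2
    have h0 : ω.1 0 = 0 := by nlinarith [sq_nonneg (ω.1 0), sq_nonneg (ω.1 1)]
    have h1 : ω.1 1 = 0 := by nlinarith [sq_nonneg (ω.1 0), sq_nonneg (ω.1 1)]
    funext i
    fin_cases i
    · exact h0
    · exact h1

theorem rowNorm_pos (ω : Orbit) : 0 < rowNorm ω.1 := Real.sqrt_pos.2 (sq_add_sq_pos ω)

/-- The matrix `γ(ω) = ‖ω‖⁻² (ω₁, -ω₂; ω₂, ω₁)`. -/
def gamma (ω : Orbit) : GL (Fin 2) ℝ :=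
  Matrix.GeneralLinearGroup.mkOfDetNeZero
    ((rowNorm ω.1 ^ 2)⁻¹ • !![ω.1 0, -ω.1 1; ω.1 1, ω.1 0]) (by
      have h := sq_add_sq_pos ω
      rw [Matrix.det_smul, Matrix.det_fin_two_of, rowNorm_sq, Fintype.card_fin]
      have : ω.1 0 * ω.1 0 - -ω.1 1 * ω.1 1 = ω.1 0 ^ 2 + ω.1 1 ^ 2 := by ring
      rw [this]
      positivity)

theorem gamma_val (ω : Orbit) :
    (gamma ω).val = (rowNorm ω.1 ^ 2)⁻¹ • !![ω.1 0, -ω.1 1; ω.1 1, ω.1 0] := rfl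

theorem gamma_inv_val (ω : Orbit) :
    (gamma ω)⁻¹.val = !![ω.1 0, ω.1 1; -ω.1 1, ω.1 0] := by
  have h := (sq_add_sq_pos ω).ne'
  refine Units.inv_eq_of_mul_eq_one_right ?_
  rw [gamma_val, rowNorm_sq]
  ext i j
  fin_cases i <;> fin_cases j <;>
    simp [Matrix.mul_apply, Fin.sum_univ_two] <;> field_simp <;> ring

/-- The group of invertible matrices `(s, -t; t, s)`. -/
def K₀ : Subgroup (GL (Fin 2) ℝ) where
  carrier := {M | ∃ s t : ℝ, M.val = !![s, -t; t, s]}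
  one_mem' := ⟨1, 0, by ext i j; fin_cases i <;> fin_cases j <;> simp⟩
  mul_mem' := by
    rintro A B ⟨s, t, hA⟩ ⟨s', t', hB⟩
    refine ⟨s * s' - t * t', s * t' + t * s', ?_⟩
    rw [Units.val_mul, hA, hB]
    ext i j
    fin_cases i <;> fin_cases j <;> simp [Matrix.mul_apply, Fin.sum_univ_two] <;> ring
  inv_mem' := by
    rintro A ⟨s, t, hA⟩
    refine ⟨A.val.det⁻¹ * s, -(A.val.det⁻¹ * t), ?_⟩
    rw [Matrix.coe_units_inv, Matrix.inv_def, Ring.inverse_eq_inv', hA, Matrix.adjugate_fin_two_of]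
    ext i j
    fin_cases i <;> fin_cases j <;> simp

/-- The subgroup `{[0, M] : M ∈ K₀}` of `G2`. -/
def K : Subgroup G2 where
  carrier := {g | g.trans = 0 ∧ g.lin ∈ K₀}
  one_mem' := ⟨rfl, K₀.one_mem⟩
  mul_mem' := by
    rintro g h ⟨hg, hg'⟩ ⟨hh, hh'⟩
    exact ⟨by rw [G2.mul_trans, hg, hh]; simp, K₀.mul_mem hg' hh'⟩
  inv_mem' := by
    rintro g ⟨hg, hg'⟩
    exact ⟨by rw [G2.inv_trans, hg]; simp, K₀.inv_mem hg'⟩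

/-- The right action `ω ↦ ω A` on the orbit. -/
def orbAct (ω : Orbit) (A : GL (Fin 2) ℝ) : Orbit :=
  ⟨ω.1 ᵥ* A.val, fun h => ω.2 (by
    have h2 := congrArg (fun y => y ᵥ* A⁻¹.val) h
    simpa [Matrix.vecMul_vecMul, ← Units.val_mul] using h2)⟩

theorem orbAct_mul (ω : Orbit) (A B : GL (Fin 2) ℝ) :
    orbAct ω (A * B) = orbAct (orbAct ω A) B :=
  Subtype.ext (by simp [orbAct, Matrix.vecMul_vecMul])

theorem orbAct_one (ω : Orbit) : orbAct ω 1 = ω := Subtype.ext (by simp [orbAct])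

/-- The base point `(1, 0)`. -/
def baseRow : Orbit := ⟨![1, 0], fun h => one_ne_zero (congrFun h 0)⟩

theorem orbAct_gamma_inv (ω : Orbit) : orbAct baseRow (gamma ω)⁻¹ = ω := by
  apply Subtype.ext
  change ![1, 0] ᵥ* (gamma ω)⁻¹.val = ω.1
  rw [gamma_inv_val]
  ext i
  fin_cases i <;> simp [Matrix.vecMul, dotProduct, Fin.sum_univ_two]

theorem gamma_mem (ω : Orbit) : gamma ω ∈ K₀ :=
  ⟨(rowNorm ω.1 ^ 2)⁻¹ * ω.1 0, (rowNorm ω.1 ^ 2)⁻¹ * ω.1 1, by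
    rw [gamma_val]; ext i j; fin_cases i <;> fin_cases j <;> simp⟩

theorem gamma_orbAct_inv {L : GL (Fin 2) ℝ} (hL : L ∈ K₀) : gamma (orbAct baseRow L⁻¹) = L := by
  rw [← _root_.inv_inj]
  apply Units.ext
  rw [gamma_inv_val]
  obtain ⟨s, t, h⟩ := K₀.inv_mem hL
  change !![(![1, 0] ᵥ* L⁻¹.val) 0, (![1, 0] ᵥ* L⁻¹.val) 1;
    -(![1, 0] ᵥ* L⁻¹.val) 1, (![1, 0] ᵥ* L⁻¹.val) 0] = L⁻¹.val
  rw [h]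
  ext i j
  fin_cases i <;> fin_cases j <;> simp [Matrix.vecMul, dotProduct, Fin.sum_univ_two]

theorem measurable_coord (i : Fin 2) : Measurable fun ω : Orbit => ω.1 i :=
  (measurable_pi_apply i).comp measurable_subtype_coe

theorem measurable_gamma : Measurable gamma := by
  rw [measurable_comap_iff]
  have h : Measurable fun ω : Orbit => fun i j : Fin 2 =>
      (rowNorm ω.1 ^ 2)⁻¹ * (!![ω.1 0, -ω.1 1; ω.1 1, ω.1 0] : Matrix _ _ ℝ) i j := by
    refine measurable_pi_iff.2 fun i => measurable_pi_iff.2 fun j => ?_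
    have h0 := measurable_coord 0
    have h1 := measurable_coord 1
    have hn : Measurable fun ω : Orbit => (rowNorm ω.1 ^ 2)⁻¹ := by
      simp_rw [rowNorm_sq]
      exact ((h0.pow_const 2).add (h1.pow_const 2)).inv
    refine hn.mul ?_
    fin_cases i <;> fin_cases j
    · exact h0
    · exact h1.neg
    · exact h1
    · exact h0
  exact h

theorem measurable_matrix_entry (i j : Fin 2) :
    Measurable fun A : GL (Fin 2) ℝ => A.val i j := by
  have h : Measurable fun M : Fin 2 → Fin 2 → ℝ => M i j := by fun_prop
  exact Measurable.comp (g := fun M : Matrix (Fin 2) (Fin 2) ℝ => M i j) h (comap_measurable _)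

theorem measurable_inv_GL2 : Measurable fun A : GL (Fin 2) ℝ => A⁻¹ := by
  rw [measurable_comap_iff]
  have h : Measurable fun A : GL (Fin 2) ℝ => fun i j : Fin 2 =>
      A.val.det⁻¹ * (!![A.val 1 1, -A.val 0 1; -A.val 1 0, A.val 0 0] : Matrix _ _ ℝ) i j := by
    refine measurable_pi_iff.2 fun i => measurable_pi_iff.2 fun j => ?_
    refine measurable_det_GL2.inv.mul ?_
    fin_cases i <;> fin_cases j
    · exact measurable_matrix_entry 1 1
    · exact (measurable_matrix_entry 0 1).neg
    · exact (measurable_matrix_entry 1 0).neg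
    · exact measurable_matrix_entry 0 0
  have e : (Units.val ∘ fun A : GL (Fin 2) ℝ => A⁻¹) = fun A : GL (Fin 2) ℝ =>
      Matrix.of fun i j : Fin 2 =>
      A.val.det⁻¹ * (!![A.val 1 1, -A.val 0 1; -A.val 1 0, A.val 0 0] : Matrix _ _ ℝ) i j := by
    funext A
    rw [Function.comp, Matrix.coe_units_inv, Matrix.inv_def, Ring.inverse_eq_inv',
      Matrix.adjugate_fin_two]
    rfl
  rw [e]
  exact h

theorem measurable_lin : Measurable fun g : G2 => g.lin :=
  measurable_snd.comp G2.measurable_equivProd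

/-- The parametrization `ω ↦ [0, γ(ω)]` of `K`, with inverse `[0, L] ↦ (1, 0) L⁻¹`. -/
def kEquiv : Orbit ≃ᵐ K where
  toFun ω := ⟨⟨0, gamma ω⟩, rfl, gamma_mem ω⟩
  invFun k := orbAct baseRow (k.1.lin)⁻¹
  left_inv ω := orbAct_gamma_inv ω
  right_inv k := Subtype.ext (G2.ext k.2.1.symm (gamma_orbAct_inv k.2.2))
  measurable_toFun := by
    refine Measurable.subtype_mk ?_
    exact G2.measurable_equivProd_symm.comp (measurable_const.prodMk measurable_gamma)
  measurable_invFun := by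
    refine Measurable.subtype_mk ?_
    have h : ∀ i j, Measurable fun k : K => (k.1.lin)⁻¹.val i j := fun i j =>
      ((measurable_matrix_entry i j).comp measurable_inv_GL2).comp
        (measurable_lin.comp measurable_subtype_coe)
    refine measurable_pi_iff.2 fun j => ?_
    have e : (fun k : K => (baseRow.1 ᵥ* (k.1.lin)⁻¹.val) j) =
        fun k : K => (k.1.lin)⁻¹.val 0 j := by
      funext k
      simp [baseRow, Matrix.vecMul, dotProduct, Fin.sum_univ_two]
    rw [e]
    exact h 0 j

/-- Haar measure of `K`: in the coordinate `ω ↦ [0, γ(ω)]` it is `dω / ‖ω‖²`. -/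
def haarK : Measure K :=
  (lebO.withDensity fun ω => ENNReal.ofReal (rowNorm ω.1 ^ 2)⁻¹).map kEquiv

/-- The Hilbert space `L²(K, L²(ℝˣ))`. -/
abbrev HSigma : Type := Lp L2RStar 2 haarK

/-- The function `u_{ω,A}`, the lower left entry of `γ(ω)⁻¹ A γ(ω A)`. -/
def uCoef (ω : Orbit) (A : GL (Fin 2) ℝ) : ℝ :=
  ((A.val 0 0 * A.val 1 0 + A.val 0 1 * A.val 1 1) * (ω.1 0 ^ 2 - ω.1 1 ^ 2)
    - (A.val 0 0 ^ 2 + A.val 0 1 ^ 2 - A.val 1 0 ^ 2 - A.val 1 1 ^ 2) * ω.1 0 * ω.1 1)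
  / ((A.val 0 0 * ω.1 0 + A.val 1 0 * ω.1 1) ^ 2 + (A.val 0 1 * ω.1 0 + A.val 1 1 * ω.1 1) ^ 2)

theorem orbAct_zero (ω : Orbit) (A : GL (Fin 2) ℝ) :
    (orbAct ω A).1 0 = A.val 0 0 * ω.1 0 + A.val 1 0 * ω.1 1 := by
  simp [orbAct, Matrix.vecMul, dotProduct, Fin.sum_univ_two, mul_comm]

theorem orbAct_one_coord (ω : Orbit) (A : GL (Fin 2) ℝ) :
    (orbAct ω A).1 1 = A.val 0 1 * ω.1 0 + A.val 1 1 * ω.1 1 := by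
  simp [orbAct, Matrix.vecMul, dotProduct, Fin.sum_univ_two, mul_comm]

theorem orbAct_sq_pos (ω : Orbit) (A : GL (Fin 2) ℝ) :
    0 < (A.val 0 0 * ω.1 0 + A.val 1 0 * ω.1 1) ^ 2
      + (A.val 0 1 * ω.1 0 + A.val 1 1 * ω.1 1) ^ 2 := by
  have h := sq_add_sq_pos (orbAct ω A)
  rwa [orbAct_zero, orbAct_one_coord] at h

/-- The function `v_{ω,A}`, the lower right entry of `γ(ω)⁻¹ A γ(ω A)`. -/
def vCoef (ω : Orbit) (A : GL (Fin 2) ℝ) : ℝˣ :=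
  Units.mk0
    (((A.val 0 0 * A.val 1 1 - A.val 0 1 * A.val 1 0) * (ω.1 0 ^ 2 + ω.1 1 ^ 2))
      / ((A.val 0 0 * ω.1 0 + A.val 1 0 * ω.1 1) ^ 2
        + (A.val 0 1 * ω.1 0 + A.val 1 1 * ω.1 1) ^ 2))
    (by
      have h1 := det_ne_zero_GL2 A
      rw [Matrix.det_fin_two] at h1
      exact div_ne_zero (mul_ne_zero h1 (sq_add_sq_pos ω).ne') (orbAct_sq_pos ω A).ne')

theorem cocycle_aux (a b c d x y : ℝ) (h : (a * x + c * y) ^ 2 + (b * x + d * y) ^ 2 ≠ 0) :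
    !![x, y; -y, x] * !![a, b; c, d] * (((a * x + c * y) ^ 2 + (b * x + d * y) ^ 2)⁻¹ •
      !![a * x + c * y, -(b * x + d * y); b * x + d * y, a * x + c * y]) =
    !![1, 0; ((a * c + b * d) * (x ^ 2 - y ^ 2) - (a ^ 2 + b ^ 2 - c ^ 2 - d ^ 2) * x * y) /
        ((a * x + c * y) ^ 2 + (b * x + d * y) ^ 2),
      ((a * d - b * c) * (x ^ 2 + y ^ 2)) / ((a * x + c * y) ^ 2 + (b * x + d * y) ^ 2)] := by
  rw [Matrix.mul_smul, Matrix.mul_fin_two, Matrix.mul_fin_two, inv_smul_eq_iff₀ h]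
  generalize hN : (a * x + c * y) ^ 2 + (b * x + d * y) ^ 2 = N at h
  have e : ∀ z, N * (z / N) = z := fun z => by field_simp
  ext i j
  fin_cases i <;> fin_cases j <;> simp [e] <;> try subst hN
  all_goals ring

theorem gamma_cocycle (ω : Orbit) (A : GL (Fin 2) ℝ) :
    ((gamma ω)⁻¹ * A * gamma (orbAct ω A)).val = !![1, 0; uCoef ω A, (vCoef ω A : ℝ)] := by
  rw [Units.val_mul, Units.val_mul, gamma_inv_val, gamma_val, rowNorm_sq, orbAct_zero,
    orbAct_one_coord]
  refine Eq.trans ?_ (cocycle_aux _ _ _ _ _ _ (orbAct_sq_pos ω A).ne')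
  rw [← Matrix.eta_fin_two A.val]

theorem coef_mul (ω : Orbit) (A B : GL (Fin 2) ℝ) :
    uCoef ω (A * B) = uCoef ω A + vCoef ω A * uCoef (orbAct ω A) B ∧
      vCoef ω (A * B) = vCoef ω A * vCoef (orbAct ω A) B := by
  have h : ((gamma ω)⁻¹ * (A * B) * gamma (orbAct ω (A * B))).val =
      ((gamma ω)⁻¹ * A * gamma (orbAct ω A)).val *
        ((gamma (orbAct ω A))⁻¹ * B * gamma (orbAct (orbAct ω A) B)).val := by
    rw [← Units.val_mul, orbAct_mul]
    congr 1
    group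
  rw [gamma_cocycle, gamma_cocycle, gamma_cocycle] at h
  have h0 := congrFun (congrFun h 1) 0
  have h1 := congrFun (congrFun h 1) 1
  simp [Matrix.mul_apply, Fin.sum_univ_two] at h0 h1
  exact ⟨h0, Units.ext (by simpa using h1)⟩

theorem coef_one (ω : Orbit) : uCoef ω 1 = 0 ∧ vCoef ω 1 = 1 := by
  have h : ((gamma ω)⁻¹ * 1 * gamma (orbAct ω 1)).val = 1 := by
    rw [orbAct_one]; simp
  rw [gamma_cocycle] at h
  have h0 := congrFun (congrFun h 1) 0
  have h1 := congrFun (congrFun h 1) 1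
  simp at h0 h1
  exact ⟨h0, h1⟩

/-- The factor `|det A|^{1/2} ‖ω‖ / ‖ω A‖`. -/
def sigmaFactor (ω : Orbit) (A : GL (Fin 2) ℝ) : ℝ :=
  √|A.val.det| * rowNorm ω.1 / rowNorm (orbAct ω A).1

/-- The function `σ[x,A]F : K → L²(ℝˣ)`; at `k = [0, γ(ω)]` it is the factor times
`exp(2π i ω x)` times `piOne u_{ω,A} v_{ω,A}` applied to `F [0, γ(ω A)]`. -/
def sigmaFun (g : G2) (F : K → L2RStar) (k : K) : L2RStar :=
  ((sigmaFactor (kEquiv.symm k) g.lin : ℂ) * phase ((kEquiv.symm k).1 ⬝ᵥ g.trans)) •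
    piOne (uCoef (kEquiv.symm k) g.lin) (vCoef (kEquiv.symm k) g.lin)
      (F (kEquiv (orbAct (kEquiv.symm k) g.lin)))

theorem measurable_orbAct (A : GL (Fin 2) ℝ) : Measurable fun ω : Orbit => orbAct ω A := by
  refine Measurable.subtype_mk ?_
  have := (LinearMap.continuous_of_finiteDimensional (Matrix.toLin' A.valᵀ)).measurable
  have h := this.comp (measurable_subtype_coe (p := fun ω : Fin 2 → ℝ => ω ≠ 0))
  have e : (fun ω : Orbit => ω.1 ᵥ* A.val) = Matrix.toLin' A.valᵀ ∘ Subtype.val :=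
    funext fun ω => by simp [Matrix.mulVec_transpose]
  rw [e]
  exact h

def orbActEquiv (A : GL (Fin 2) ℝ) : Orbit ≃ᵐ Orbit where
  toFun ω := orbAct ω A
  invFun ω := orbAct ω A⁻¹
  left_inv ω := by beta_reduce; rw [← orbAct_mul, mul_inv_cancel, orbAct_one]
  right_inv ω := by beta_reduce; rw [← orbAct_mul, inv_mul_cancel, orbAct_one]
  measurable_toFun := measurable_orbAct A
  measurable_invFun := measurable_orbAct A⁻¹

theorem measurableEmbedding_orbit : MeasurableEmbedding (Subtype.val : Orbit → Fin 2 → ℝ) :=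
  MeasurableEmbedding.subtype_coe (measurableSet_singleton 0).compl

theorem map_orbAct (A : GL (Fin 2) ℝ) :
    lebO.map (fun ω => orbAct ω A) = ENNReal.ofReal (|A.val.det|)⁻¹ • lebO := by
  have h1 := Real.map_matrix_volume_pi_eq_smul_volume_pi
    (M := A.valᵀ) (by rw [Matrix.det_transpose]; exact det_ne_zero_GL2 A)
  have hm : Measurable (Matrix.toLin' A.valᵀ) :=
    (LinearMap.continuous_of_finiteDimensional _).measurable
  ext s hs
  have himg : Subtype.val '' ((fun ω => orbAct ω A) ⁻¹' s)
      = (Matrix.toLin' A.valᵀ) ⁻¹' (Subtype.val '' s) := by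
    ext x
    constructor
    · rintro ⟨ω, hω, rfl⟩
      refine ⟨orbAct ω A, hω, ?_⟩
      simp [orbAct, Matrix.mulVec_transpose]
    · rintro ⟨ω, hω, hx⟩
      refine ⟨orbAct ω A⁻¹, ?_, ?_⟩
      · simpa [← orbAct_mul, orbAct_one] using hω
      · simp only [Matrix.toLin'_apply, Matrix.mulVec_transpose] at hx
        simp only [orbAct, hx, Matrix.vecMul_vecMul, ← Units.val_mul]
        simp
  rw [Measure.map_apply (measurable_orbAct A) hs, lebO, measurableEmbedding_orbit.comap_apply,
    himg, Measure.smul_apply, measurableEmbedding_orbit.comap_apply, ← Measure.smul_apply,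
    ← abs_inv, ← Matrix.det_transpose, ← h1,
    Measure.map_apply hm (measurableEmbedding_orbit.measurableSet_image.2 hs)]

theorem lintegral_orbAct (A : GL (Fin 2) ℝ) (h : Orbit → ℝ≥0∞) :
    ∫⁻ ω, h (orbAct ω A) ∂lebO = ENNReal.ofReal (|A.val.det|)⁻¹ * ∫⁻ ω, h ω ∂lebO := by
  have := lintegral_map_equiv (μ := lebO) h (orbActEquiv A)
  change ∫⁻ ω, h ω ∂(lebO.map (fun ω => orbAct ω A)) = ∫⁻ ω, h (orbAct ω A) ∂lebO at this
  rw [← this, map_orbAct, lintegral_smul_measure, smul_eq_mul]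

theorem measurable_density :
    Measurable fun ω : Orbit => ENNReal.ofReal (rowNorm ω.1 ^ 2)⁻¹ := by
  simp_rw [rowNorm_sq]
  exact (((measurable_coord 0).pow_const 2).add
    ((measurable_coord 1).pow_const 2)).inv.ennreal_ofReal

theorem lintegral_haarK (h : K → ℝ≥0∞) :
    ∫⁻ k, h k ∂haarK =
      ∫⁻ ω, ENNReal.ofReal (rowNorm ω.1 ^ 2)⁻¹ * h (kEquiv ω) ∂lebO := by
  rw [haarK, lintegral_map_equiv,
    lintegral_withDensity_eq_lintegral_mul_non_measurable _ measurable_density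
      (Filter.Eventually.of_forall fun _ => ENNReal.ofReal_lt_top)]
  rfl

theorem qmp_kEquiv : Measure.QuasiMeasurePreserving kEquiv lebO haarK := by
  refine ⟨kEquiv.measurable, ?_⟩
  refine Measure.AbsolutelyContinuous.map (withDensity_absolutelyContinuous'
    measurable_density.aemeasurable (Filter.Eventually.of_forall fun ω => ?_)) kEquiv.measurable
  have := rowNorm_pos ω
  exact (ENNReal.ofReal_pos.2 (by positivity)).ne'

theorem qmp_kEquiv_symm : Measure.QuasiMeasurePreserving kEquiv.symm haarK lebO := by
  refine ⟨kEquiv.symm.measurable, ?_⟩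
  rw [haarK, Measure.map_map kEquiv.symm.measurable kEquiv.measurable]
  simp only [MeasurableEquiv.symm_comp_self, Measure.map_id]
  exact withDensity_absolutelyContinuous _ _

theorem qmp_orbAct (A : GL (Fin 2) ℝ) :
    Measure.QuasiMeasurePreserving (fun ω => orbAct ω A) lebO lebO :=
  ⟨measurable_orbAct A, by
    rw [map_orbAct]; exact Measure.smul_absolutelyContinuous⟩

/-- The action `[0, γ(ω)] ↦ [0, γ(ω A)]` transported to `K`. -/
def kAct (A : GL (Fin 2) ℝ) (k : K) : K := kEquiv (orbAct (kEquiv.symm k) A)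

theorem qmp_kAct (A : GL (Fin 2) ℝ) :
    Measure.QuasiMeasurePreserving (kAct A) haarK haarK :=
  qmp_kEquiv.comp ((qmp_orbAct A).comp qmp_kEquiv_symm)

theorem sigmaFactor_nonneg (ω : Orbit) (A : GL (Fin 2) ℝ) : 0 ≤ sigmaFactor ω A :=
  div_nonneg (mul_nonneg (Real.sqrt_nonneg _) (rowNorm_pos ω).le) (rowNorm_pos _).le

theorem enorm_sigmaFun (g : G2) (F : K → L2RStar) (k : K) :
    ‖sigmaFun g F k‖ₑ = ENNReal.ofReal (sigmaFactor (kEquiv.symm k) g.lin) *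
      ‖F (kAct g.lin k)‖ₑ := by
  have hn : ‖sigmaFun g F k‖ = sigmaFactor (kEquiv.symm k) g.lin * ‖F (kAct g.lin k)‖ := by
    rw [sigmaFun, norm_smul, norm_mul, norm_phase, mul_one, LinearIsometry.norm_map,
      Complex.norm_real, Real.norm_of_nonneg (sigmaFactor_nonneg _ _)]
    rfl
  rw [← ofReal_norm, hn, ENNReal.ofReal_mul (sigmaFactor_nonneg _ _), ofReal_norm]

theorem eLpNorm_sigmaFun (g : G2) (F : K → L2RStar) :
    eLpNorm (sigmaFun g F) 2 haarK = eLpNorm F 2 haarK := by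
  rw [eLpNorm_eq_lintegral_rpow_enorm_toReal (by simp) (by simp),
    eLpNorm_eq_lintegral_rpow_enorm_toReal (by simp) (by simp)]
  congr 1
  rw [lintegral_haarK, lintegral_haarK]
  have hA : 0 < |g.lin.val.det| := abs_pos.2 (det_ne_zero_GL2 _)
  have h : ∀ ω : Orbit, ENNReal.ofReal (rowNorm ω.1 ^ 2)⁻¹ *
      ‖sigmaFun g F (kEquiv ω)‖ₑ ^ (2 : ℝ≥0∞).toReal =
      ENNReal.ofReal (|g.lin.val.det|) * ((fun ω : Orbit => ENNReal.ofReal (rowNorm ω.1 ^ 2)⁻¹ *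
        ‖F (kEquiv ω)‖ₑ ^ (2 : ℝ≥0∞).toReal) (orbAct ω g.lin)) := by
    intro ω
    have h1 := rowNorm_pos ω
    have h2 := rowNorm_pos (orbAct ω g.lin)
    rw [enorm_sigmaFun, ENNReal.mul_rpow_of_nonneg _ _ (by simp), ENNReal.toReal_ofNat,
      ENNReal.ofReal_rpow_of_nonneg (sigmaFactor_nonneg _ _) zero_le_two, ← mul_assoc, ← mul_assoc,
      ← ENNReal.ofReal_mul (by positivity), ← ENNReal.ofReal_mul hA.le, kAct,
      MeasurableEquiv.symm_apply_apply]
    congr 2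
    rw [Real.rpow_two, sigmaFactor, div_pow, mul_pow, Real.sq_sqrt hA.le]
    field_simp
  rw [lintegral_congr h, lintegral_const_mul' _ _ ENNReal.ofReal_ne_top,
    lintegral_orbAct g.lin (fun ω : Orbit => ENNReal.ofReal (rowNorm ω.1 ^ 2)⁻¹ *
        ‖F (kEquiv ω)‖ₑ ^ (2 : ℝ≥0∞).toReal), ← mul_assoc, ← ENNReal.ofReal_mul hA.le, mul_inv_cancel₀ hA.ne', ENNReal.ofReal_one, one_mul]

theorem continuous_orbCoord (i : Fin 2) : Continuous fun ω : Orbit => ω.1 i :=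
  (continuous_apply i).comp continuous_subtype_val

theorem continuous_quad (a b c d : ℝ) :
    Continuous fun ω : Orbit => (a * ω.1 0 + b * ω.1 1) ^ 2 + (c * ω.1 0 + d * ω.1 1) ^ 2 := by
  have h0 := continuous_orbCoord 0
  have h1 := continuous_orbCoord 1
  exact (((continuous_const.mul h0).add (continuous_const.mul h1)).pow 2).add
    (((continuous_const.mul h0).add (continuous_const.mul h1)).pow 2)

theorem continuous_uCoef (A : GL (Fin 2) ℝ) : Continuous fun ω : Orbit => uCoef ω A := by
  have h0 := continuous_orbCoord 0
  have h1 := continuous_orbCoord 1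
  unfold uCoef
  refine Continuous.div ?_ (continuous_quad _ _ _ _) fun ω => (orbAct_sq_pos ω A).ne'
  exact (continuous_const.mul ((h0.pow 2).sub (h1.pow 2))).sub ((continuous_const.mul h0).mul h1)

theorem continuous_vCoef (A : GL (Fin 2) ℝ) : Continuous fun ω : Orbit => vCoef ω A := by
  have h0 := continuous_orbCoord 0
  have h1 := continuous_orbCoord 1
  refine (Units.isEmbedding_val₀ (G₀ := ℝ)).continuous_iff.2 ?_
  simp only [Function.comp_def, vCoef, Units.val_mk0]
  exact Continuous.div (continuous_const.mul ((h0.pow 2).add (h1.pow 2)))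
    (continuous_quad _ _ _ _) fun ω => (orbAct_sq_pos ω A).ne'

theorem continuous_sigmaFactor (A : GL (Fin 2) ℝ) :
    Continuous fun ω : Orbit => sigmaFactor ω A := by
  have h0 := continuous_orbCoord 0
  have h1 := continuous_orbCoord 1
  unfold sigmaFactor
  refine Continuous.div ?_ ?_ fun ω => (rowNorm_pos (orbAct ω A)).ne'
  · exact continuous_const.mul ((h0.pow 2).add (h1.pow 2)).sqrt
  · simp only [rowNorm, orbAct_zero, orbAct_one_coord]
    exact (continuous_quad _ _ _ _).sqrt

theorem aestronglyMeasurable_sigmaFun (g : G2) {F : K → L2RStar}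
    (hF : AEStronglyMeasurable F haarK) : AEStronglyMeasurable (sigmaFun g F) haarK := by
  have hid : AEStronglyMeasurable (fun ω : Orbit => ω) lebO :=
    measurable_id.aestronglyMeasurable
  have hF' : AEStronglyMeasurable (fun ω : Orbit => F (kEquiv (orbAct ω g.lin))) lebO :=
    hF.comp_quasiMeasurePreserving (qmp_kEquiv.comp (qmp_orbAct g.lin))
  have hc : Continuous fun p : Orbit × L2RStar => piOne (uCoef p.1 g.lin) (vCoef p.1 g.lin) p.2 := by
    refine continuous_prod_of_continuous_lipschitzWith' _ 1
      (fun ω => (piOne (uCoef ω g.lin) (vCoef ω g.lin)).lipschitz) fun f => ?_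
    exact (continuous_piOne.comp
      (((continuous_uCoef g.lin).prodMk (continuous_vCoef g.lin)).prodMk continuous_const) :)
  have hs : Continuous fun ω : Orbit => (sigmaFactor ω g.lin : ℂ) * phase (ω.1 ⬝ᵥ g.trans) := by
    refine (Complex.continuous_ofReal.comp (continuous_sigmaFactor g.lin)).mul
      (continuous_phase.comp ?_)
    have h0 := continuous_orbCoord 0
    have h1 := continuous_orbCoord 1
    simp only [dotProduct, Fin.sum_univ_two]
    exact (h0.mul continuous_const).add (h1.mul continuous_const)
  have h := (hs.comp_aestronglyMeasurable hid).smul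
    (hc.comp_aestronglyMeasurable (hid.prodMk hF'))
  exact h.comp_quasiMeasurePreserving qmp_kEquiv_symm

theorem memLp_sigmaFun (g : G2) (F : HSigma) : MemLp (sigmaFun g F) 2 haarK :=
  ⟨aestronglyMeasurable_sigmaFun g (Lp.aestronglyMeasurable F), by
    rw [eLpNorm_sigmaFun]; exact (Lp.memLp F).2⟩

theorem sigmaFun_congr (g : G2) {F F' : K → L2RStar} (h : F =ᵐ[haarK] F') :
    sigmaFun g F =ᵐ[haarK] sigmaFun g F' := by
  filter_upwards [(qmp_kAct g.lin).ae_eq_comp h] with k hk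
  simp only [Function.comp, kAct] at hk
  rw [sigmaFun, sigmaFun, hk]

def sigmaIso (g : G2) : HSigma →ₗᵢ[ℂ] HSigma where
  toFun F := (memLp_sigmaFun g F).toLp _
  map_add' F F' := by
    apply Lp.ext
    filter_upwards [(memLp_sigmaFun g (F + F')).coeFn_toLp, (memLp_sigmaFun g F).coeFn_toLp,
      (memLp_sigmaFun g F').coeFn_toLp, sigmaFun_congr g (Lp.coeFn_add F F'),
      Lp.coeFn_add ((memLp_sigmaFun g F).toLp _) ((memLp_sigmaFun g F').toLp _)]
      with k h1 h2 h3 h4 h5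
    rw [h1, h5, Pi.add_apply, h2, h3, h4]
    simp only [sigmaFun, Pi.add_apply, map_add, smul_add]
  map_smul' c F := by
    apply Lp.ext
    filter_upwards [(memLp_sigmaFun g (c • F)).coeFn_toLp, (memLp_sigmaFun g F).coeFn_toLp,
      sigmaFun_congr g (Lp.coeFn_smul c F), Lp.coeFn_smul c ((memLp_sigmaFun g F).toLp _)]
      with k h1 h2 h3 h4
    rw [h1, RingHom.id_apply, h4, Pi.smul_apply, h2, h3]
    simp only [sigmaFun, Pi.smul_apply, map_smul]
    rw [smul_comm]
  norm_map' F := by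
    change ‖(memLp_sigmaFun g F).toLp _‖ = ‖F‖
    rw [Lp.norm_toLp, Lp.norm_def, eLpNorm_sigmaFun]

theorem sigmaIso_apply (g : G2) (F : HSigma) : sigmaIso g F =ᵐ[haarK] sigmaFun g F :=
  (memLp_sigmaFun g F).coeFn_toLp

theorem sigmaFactor_mul (ω : Orbit) (A B : GL (Fin 2) ℝ) :
    sigmaFactor ω (A * B) = sigmaFactor ω A * sigmaFactor (orbAct ω A) B := by
  have h1 := (rowNorm_pos (orbAct ω A)).ne'
  have h2 := (rowNorm_pos (orbAct (orbAct ω A) B)).ne'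
  simp only [sigmaFactor, orbAct_mul, Units.val_mul, Matrix.det_mul, abs_mul,
    Real.sqrt_mul (abs_nonneg _)]
  field_simp

theorem sigmaFun_mul (g h : G2) (F : K → L2RStar) (k : K) :
    sigmaFun (g * h) F k = sigmaFun g (sigmaFun h F) k := by
  simp only [sigmaFun, MeasurableEquiv.symm_apply_apply, G2.mul_lin, G2.mul_trans, orbAct_mul,
    sigmaFactor_mul, (coef_mul _ _ _).1, (coef_mul _ _ _).2, piOne_mul, map_smul, smul_smul]
  congr 1
  rw [dotProduct_add, phase_add, Matrix.dotProduct_mulVec, Complex.ofReal_mul]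
  simp only [orbAct]
  ring

theorem sigmaFun_one (F : K → L2RStar) (k : K) : sigmaFun 1 F k = F k := by
  have h := (rowNorm_pos (kEquiv.symm k)).ne'
  simp [sigmaFun, sigmaFactor, orbAct_one, (coef_one _).1, (coef_one _).2, piOne_one, phase_zero, h]

/-- The unitary representation `σ` of `G2` on `L²(K, L²(ℝˣ))`. -/
def sigma : G2 →* (HSigma ≃ₗᵢ[ℂ] HSigma) :=
  homOfIsometries sigmaIso
    (fun F => by
      apply Lp.ext
      filter_upwards [sigmaIso_apply 1 F] with k hk
      rw [hk, sigmaFun_one])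
    (fun g h F => by
      apply Lp.ext
      filter_upwards [sigmaIso_apply (g * h) F, sigmaIso_apply g (sigmaIso h F),
        sigmaFun_congr g (sigmaIso_apply h F)] with k h1 h2 h3
      rw [h1, h2, h3, sigmaFun_mul])

theorem sigma_apply (g : G2) (F : HSigma) : sigma g F =ᵐ[haarK] sigmaFun g F :=
  sigmaIso_apply g F

/-- The pointwise formula that defines `σ`. -/
theorem sigma_formula (g : G2) (F : HSigma) :
    ∀ᵐ ω ∂lebO, ∀ᵐ t ∂haarRStar,
      (sigma g F (kEquiv ω)) t =
        (sigmaFactor ω g.lin : ℂ) * phase (ω.1 ⬝ᵥ g.trans + (t : ℝ)⁻¹ * uCoef ω g.lin) *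
          (F (kEquiv (orbAct ω g.lin))) ((vCoef ω g.lin)⁻¹ * t) := by
  filter_upwards [qmp_kEquiv.ae (sigma_apply g F)] with ω hω
  rw [hω]
  simp only [sigmaFun, MeasurableEquiv.symm_apply_apply]
  filter_upwards [Lp.coeFn_smul ((sigmaFactor ω g.lin : ℂ) * phase (ω.1 ⬝ᵥ g.trans))
    (piOne (uCoef ω g.lin) (vCoef ω g.lin) (F (kEquiv (orbAct ω g.lin)))),
    piOne_apply (uCoef ω g.lin) (vCoef ω g.lin) (F (kEquiv (orbAct ω g.lin)))] with t h1 h2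
  rw [h1, Pi.smul_apply, h2, smul_eq_mul, phase_add]
  ring

/-- The function `[0, L] ↦ (conj η((1, 0) L⁻¹) / |det L|) g` from `K` to `L²(ℝˣ)`. -/
def eFun (η : L2O) {g : L2O1} (hg : MemLp g 2 haarRStar) (k : K) : L2RStar :=
  (conj (η (orbAct baseRow (k.1.lin)⁻¹)) / ((|k.1.lin.val.det| : ℝ) : ℂ)) • hg.toLp g

theorem memLp_eFun (η : L2O) (hη : MemLp (fun ω : Orbit => (rowNorm ω.1 : ℂ) * η ω) 2 lebO)
    {g : L2O1} (hg : MemLp g 2 haarRStar) : MemLp (eFun η hg) 2 haarK := by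
  have hη' : AEStronglyMeasurable (fun k : K => η (kEquiv.symm k)) haarK :=
    (Lp.aestronglyMeasurable η).comp_quasiMeasurePreserving qmp_kEquiv_symm
  have hdet : Measurable fun k : K => |k.1.lin.val.det| :=
    (measurable_det_GL2.comp (measurable_lin.comp measurable_subtype_coe)).abs
  have hs : AEStronglyMeasurable (eFun η hg) haarK := by
    have h := ((Complex.continuous_conj.comp_aestronglyMeasurable hη').mul
      (Complex.measurable_ofReal.comp hdet).inv.aestronglyMeasurable).smul_const (hg.toLp g)
    exact h
  refine ⟨hs, ?_⟩
  have hn : ∀ ω : Orbit, ‖eFun η hg (kEquiv ω)‖ = rowNorm ω.1 ^ 2 * ‖η ω‖ * ‖hg.toLp g‖ := by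
    intro ω
    have hdet : (kEquiv ω).1.lin.val.det = (rowNorm ω.1 ^ 2)⁻¹ := by
      have h := (rowNorm_pos ω).ne'
      change (gamma ω).val.det = _
      rw [gamma_val, Matrix.det_smul, Matrix.det_fin_two_of, Fintype.card_fin]
      have : ω.1 0 * ω.1 0 - -ω.1 1 * ω.1 1 = rowNorm ω.1 ^ 2 := by rw [rowNorm_sq]; ring
      rw [this]
      field_simp
    have hω : orbAct baseRow ((kEquiv ω).1.lin)⁻¹ = ω := kEquiv.symm_apply_apply ω
    rw [eFun, norm_smul, norm_div, hω, hdet, Complex.norm_real, Real.norm_eq_abs, abs_abs,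
      RCLike.norm_conj, abs_of_nonneg (by positivity)]
    field_simp
  have hfin := lintegral_rpow_enorm_lt_top_of_eLpNorm_lt_top (p := 2) (by simp) (by simp) hη.2
  refine (eLpNorm_lt_top_iff_lintegral_rpow_enorm_lt_top (by simp) (by simp)).2 ?_
  rw [lintegral_haarK]
  have h : ∀ ω : Orbit, ENNReal.ofReal (rowNorm ω.1 ^ 2)⁻¹ *
      ‖eFun η hg (kEquiv ω)‖ₑ ^ (2 : ℝ≥0∞).toReal =
      ‖(rowNorm ω.1 : ℂ) * η ω‖ₑ ^ (2 : ℝ≥0∞).toReal * ENNReal.ofReal (‖hg.toLp g‖ ^ 2) := by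
    intro ω
    have h1 := rowNorm_pos ω
    rw [← ofReal_norm, ← ofReal_norm, hn, norm_mul, Complex.norm_real,
      Real.norm_of_nonneg h1.le, ENNReal.toReal_ofNat,
      ENNReal.ofReal_rpow_of_nonneg (by positivity) zero_le_two,
      ENNReal.ofReal_rpow_of_nonneg (by positivity) zero_le_two,
      ← ENNReal.ofReal_mul (by positivity), ← ENNReal.ofReal_mul (by positivity)]
    congr 1
    rw [Real.rpow_two, Real.rpow_two]
    field_simp
  rw [lintegral_congr h, lintegral_mul_const' _ _ ENNReal.ofReal_ne_top]
  exact ENNReal.mul_lt_top hfin ENNReal.ofReal_lt_top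

/-- The vector `E` of `L²(K, L²(ℝˣ))` built from `η` and `g`. -/
def eVec (η : L2O) (hη : MemLp (fun ω : Orbit => (rowNorm ω.1 : ℂ) * η ω) 2 lebO)
    {g : L2O1} (hg : MemLp g 2 haarRStar) : HSigma :=
  (memLp_eFun η hη hg).toLp _

/-- The coefficient function `V_E F (g) = ⟨F, σ(g) E⟩`, the pairing being linear in `F`
(Mathlib's inner product is linear in its second argument). -/
def coeffFun (E F : HSigma) (g : G2) : ℂ := inner ℂ (sigma g E) F

/-- The space `V_E L²(K, L²(ℝˣ))` of classes in `L²(G2)` of coefficient functions. -/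
def coeffSpace (E : HSigma) : Submodule ℂ L2G2 where
  carrier := {f | ∃ F : HSigma, f =ᵐ[haarG2] coeffFun E F}
  zero_mem' := ⟨0, by
    filter_upwards [Lp.coeFn_zero ℂ 2 haarG2] with x hx
    rw [hx]; simp [coeffFun]⟩
  add_mem' := by
    rintro f f' ⟨F, hF⟩ ⟨F', hF'⟩
    refine ⟨F + F', ?_⟩
    filter_upwards [Lp.coeFn_add f f', hF, hF'] with x h1 h2 h3
    rw [h1, Pi.add_apply, h2, h3]
    simp [coeffFun, inner_add_right]
  smul_mem' := by
    rintro c f ⟨F, hF⟩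
    refine ⟨c • F, ?_⟩
    filter_upwards [Lp.coeFn_smul c f, hF] with x h1 h2
    rw [h1, Pi.smul_apply, h2]
    simp [coeffFun, inner_smul_right]

end AffineTwo

end

open AffineTwo

/-! All the coefficient maps are pieces of one unitary operator. For $F=\alpha\otimes\varphi$ with
$\alpha\in L^2(K)$, $\varphi\in L^2(\mathbb R^*)$, and $E$ built from $\eta$ and $g$, unwinding
$\sigma$ gives $$V_EF[x,A]=\int_{\mathcal O}e^{-2\pi i\omega x}\,\tfrac{|\det A|^{1/2}\|\omega
A\|}{\|\omega\|}\,\alpha(\omega)\,\eta(\omega A)\,c(u_{\omega,A},v_{\omega,A})\,d\omega,$$ where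
$$c(u,v)=\int_{\mathbb R^*}e^{-2\pi iu/t}\,\varphi(t)\,\overline{g(t/v)}\,\frac{dt}{|t|}$$
(`coeffFun_smulVec`, `lineCoeff_eq`). Each ingredient is unitary.

On the line, $(t,v)\mapsto(t,t/v)$ matches the measures $dt\,dv/v^2$ and $(dt/|t|)\,dw$
(`map_divSnd`), and the integral is a Fourier transform in the variable $1/t$. Hence
$\varphi\otimes\bar g\mapsto c$ extends to a unitary $Q$ (`exists_line_unitary`).

In the plane, $(\omega,A)\mapsto(\omega,\omega A,u_{\omega,A},v_{\omega,A})$ has the square of the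
displayed weight as its Jacobian density (`map_fullCoords`), and the integral over $\omega$ is a
plane Fourier transform. Hence $\alpha\otimes\eta\otimes c\mapsto V_EF$ extends to a unitary $Z$
(`exists_plane_unitary`).

Therefore $V_EF=Z(\alpha\otimes\eta\otimes Q(\varphi\otimes\bar g))$. For unit $\eta$ and $g$ this
preserves inner products in $(\alpha,\varphi)$, so $V_E$ is an isometry with closed range.
Orthonormality of the $\eta_i$ and of the $g_j$ makes the ranges orthogonal, and totality of both
bases makes the ranges span a dense subspace. The intertwining relation is formal:
$\langle\sigma(x)F,\sigma(h)E\rangle=\langle F,\sigma(x^{-1}h)E\rangle$.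

The analytic care goes into showing that operators defined by density are given a.e. by the stated
integrals. The conditions $\|\omega\|\eta_i\in L^2$ and $g_j\in L^2(\mathbb R^*)$ make these
integrals converge absolutely. -/

noncomputable section
namespace AffineTwo

/-! ### Total families and isometries determined by Gram matrices -/

section Total

variable {E E' ι : Type*} [NormedAddCommGroup E] [InnerProductSpace ℂ E]
  [NormedAddCommGroup E'] [InnerProductSpace ℂ E']

/-- A family of vectors is total if its linear span is dense. -/
def TotalFamily (e : ι → E) : Prop := Dense (Submodule.span ℂ (Set.range e) : Set E)

theorem TotalFamily.eq_zero {e : ι → E} (he : TotalFamily e) {x : E} (h : ∀ i, inner ℂ (e i) x = 0) :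
    x = 0 := by
  refine he.eq_zero_of_inner_right (𝕜 := ℂ) fun v hv => ?_
  induction hv using Submodule.span_induction with
  | mem v hv => obtain ⟨i, rfl⟩ := hv; exact h i
  | zero => exact inner_zero_left x
  | add v w _ _ hv hw => rw [inner_add_left, hv, hw, add_zero]
  | smul c v _ hv => rw [inner_smul_left, hv, mul_zero]

/-- In a Hilbert space a subspace is dense exactly when its orthogonal complement vanishes.
Completeness matters only for the reverse implication. -/
theorem total_iff [CompleteSpace E] {e : ι → E} :
    TotalFamily e ↔ ∀ x, (∀ i, inner ℂ (e i) x = 0) → x = 0 := by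
  refine ⟨fun he x h => he.eq_zero h, fun h => ?_⟩
  rw [TotalFamily, Submodule.dense_iff_topologicalClosure_eq_top, Submodule.topologicalClosure_eq_top_iff,
    Submodule.eq_bot_iff]
  intro x hx
  exact h x fun i => (Submodule.mem_orthogonal _ _).1 hx _ (Submodule.subset_span ⟨i, rfl⟩)

theorem total_id : TotalFamily (fun x : E => x) := by
  simp [TotalFamily]

theorem TotalFamily.map [CompleteSpace E] [CompleteSpace E'] {e : ι → E} (he : TotalFamily e)
    (U : E ≃ₗᵢ[ℂ] E') : TotalFamily fun i => U (e i) := by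
  rw [total_iff]
  intro x hx
  have h : U.symm x = 0 := he.eq_zero fun i => by
    rw [← U.inner_map_map, U.apply_symm_apply, hx]
  simpa using h

theorem TotalFamily.ext {e : ι → E} (he : TotalFamily e) {f g : E →L[ℂ] E'} (h : ∀ i, f (e i) = g (e i)) :
    f = g := by
  refine ContinuousLinearMap.ext_on he ?_
  rintro _ ⟨i, rfl⟩
  exact h i

theorem TotalFamily.inner_eq {e : ι → E} (he : TotalFamily e) {x y : E}
    (h : ∀ i, inner ℂ (e i) x = inner ℂ (e i) y) : x = y :=
  sub_eq_zero.1 (he.eq_zero fun i => by rw [inner_sub_right, h, sub_self])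

/-- The norm of a finite linear combination depends only on its coefficients and the Gram matrix. So
$\sum c_ie_i\mapsto\sum c_ie_i'$ is well defined and isometric on the span even when the $e_i$ are
linearly dependent, and it extends by density. -/
theorem exists_linearIsometry_of_inner_eq [CompleteSpace E'] {e : ι → E} {e' : ι → E'}
    (he : TotalFamily e) (h : ∀ i j, inner ℂ (e' i) (e' j) = inner ℂ (e i) (e j)) :
    ∃ T : E →ₗᵢ[ℂ] E', ∀ i, T (e i) = e' i := by
  let L := Finsupp.linearCombination ℂ e
  let L' := Finsupp.linearCombination ℂ e'
  have hn : ∀ c, ‖L' c‖ = ‖L c‖ := by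
    intro c
    have hi : inner ℂ (L' c) (L' c) = inner ℂ (L c) (L c) := by
      simp only [L, L', Finsupp.linearCombination_apply, Finsupp.sum, sum_inner, inner_sum,
        inner_smul_left, inner_smul_right, h]
    rw [inner_self_eq_norm_sq_to_K, inner_self_eq_norm_sq_to_K] at hi
    have h2 : ‖L' c‖ ^ 2 = ‖L c‖ ^ 2 := by exact_mod_cast hi
    exact (sq_eq_sq₀ (norm_nonneg _) (norm_nonneg _)).1 h2
  have hd : DenseRange L := by
    have := he
    rw [TotalFamily, ← Finsupp.range_linearCombination] at this
    exact this
  have hb : ∃ C, ∀ x, ‖L' x‖ ≤ C * ‖L x‖ := ⟨1, fun x => by rw [hn, one_mul]⟩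
  have hT : ∀ c, L'.extendOfNorm L (L c) = L' c := LinearMap.extendOfNorm_eq hd hb
  refine ⟨⟨(L'.extendOfNorm L).toLinearMap, fun x => ?_⟩, fun i => ?_⟩
  · refine hd.induction_on (p := fun x => ‖L'.extendOfNorm L x‖ = ‖x‖) x
      (isClosed_eq (by fun_prop) (by fun_prop)) fun c => ?_
    rw [hT, hn]
  · have := hT (Finsupp.single i 1)
    simpa [L, L'] using this

/-- An isometry from a complete space has closed range; here the range is also dense, since it
contains the total family `e'`. -/
theorem exists_linearIsometryEquiv_of_inner_eq [CompleteSpace E] [CompleteSpace E'] {e : ι → E}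
    {e' : ι → E'} (he : TotalFamily e) (he' : TotalFamily e')
    (h : ∀ i j, inner ℂ (e' i) (e' j) = inner ℂ (e i) (e j)) :
    ∃ T : E ≃ₗᵢ[ℂ] E', ∀ i, T (e i) = e' i := by
  obtain ⟨T, hT⟩ := exists_linearIsometry_of_inner_eq he h
  have hs : Function.Surjective T := by
    rw [← Set.range_eq_univ, ← T.isometry.isClosedEmbedding.isClosed_range.closure_eq]
    refine Dense.closure_eq (he'.mono ?_)
    change (Submodule.span ℂ (Set.range e') : Set E') ⊆ (LinearMap.range T.toLinearMap : Set E')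
    rw [SetLike.coe_subset_coe, Submodule.span_le]
    rintro _ ⟨i, rfl⟩
    exact ⟨e i, hT i⟩
  exact ⟨LinearIsometryEquiv.ofSurjective T hs, hT⟩

end Total

/-! ### Elementary tensors in $L^2$ of a product measure -/

section Tensor

variable {X X' Y : Type*} [MeasurableSpace X] [MeasurableSpace X'] [MeasurableSpace Y]
  {μ : Measure X} {μ' : Measure X'} {ν : Measure Y} [SigmaFinite ν]

theorem memLp_two_iff_lintegral {Z H : Type*} [MeasurableSpace Z] [NormedAddCommGroup H]
    {ξ : Measure Z} {f : Z → H} :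
    MemLp f 2 ξ ↔ AEStronglyMeasurable f ξ ∧ ∫⁻ z, ‖f z‖ₑ ^ 2 ∂ξ < ∞ := by
  rw [MemLp, eLpNorm_lt_top_iff_lintegral_rpow_enorm_lt_top (by simp) (by simp)]
  simp

theorem memLp_tensor (a : Lp ℂ 2 μ) (b : Lp ℂ 2 ν) :
    MemLp (fun p : X × Y => a p.1 * b p.2) 2 (μ.prod ν) := by
  rw [memLp_two_iff_lintegral]
  refine ⟨(Lp.aestronglyMeasurable a).comp_fst.mul (Lp.aestronglyMeasurable b).comp_snd, ?_⟩
  have ha := (memLp_two_iff_lintegral.1 (Lp.memLp a)).2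
  have hb := (memLp_two_iff_lintegral.1 (Lp.memLp b)).2
  simp_rw [enorm_mul, mul_pow]
  rw [lintegral_prod_mul (f := fun x => ‖a x‖ₑ ^ 2) (g := fun y => ‖b y‖ₑ ^ 2)
    ((Lp.aestronglyMeasurable a).enorm.pow_const _)
    ((Lp.aestronglyMeasurable b).enorm.pow_const _)]
  exact ENNReal.mul_lt_top ha hb

/-- The function `(x, y) ↦ a x * b y` in `L²` of a product. -/
def tensor (a : Lp ℂ 2 μ) (b : Lp ℂ 2 ν) : Lp ℂ 2 (μ.prod ν) := (memLp_tensor a b).toLp _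

theorem tensor_apply (a : Lp ℂ 2 μ) (b : Lp ℂ 2 ν) :
    tensor a b =ᵐ[μ.prod ν] fun p => a p.1 * b p.2 := (memLp_tensor a b).coeFn_toLp

variable [SigmaFinite μ] [SigmaFinite μ']

theorem integrable_tensor_mul (a : Lp ℂ 2 μ) (b : Lp ℂ 2 ν) {F : X × Y → ℂ}
    (hF : MemLp F 2 (μ.prod ν)) :
    Integrable (fun p => conj (a p.1 * b p.2) * F p) (μ.prod ν) :=
  ((memLp_tensor a b).star).integrable_mul hF

/-- Fubini, with the integral over the first factor inside: this order lets an operator on the first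
factor be applied slice by slice for fixed `y`. -/
theorem inner_tensor_toLp (a : Lp ℂ 2 μ) (b : Lp ℂ 2 ν) {F : X × Y → ℂ}
    (hF : MemLp F 2 (μ.prod ν)) :
    inner ℂ (tensor a b) (hF.toLp F) =
      ∫ y, conj (b y) * ∫ x, conj (a x) * F (x, y) ∂μ ∂ν := by
  have h : inner ℂ (tensor a b) (hF.toLp F) =
      ∫ p, conj (a p.1 * b p.2) * F p ∂(μ.prod ν) := by
    rw [L2.inner_def]
    refine integral_congr_ae ?_
    filter_upwards [tensor_apply a b, hF.coeFn_toLp] with p h1 h2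
    rw [h1, h2, RCLike.inner_apply, mul_comm]
  rw [h, integral_prod_symm _ (integrable_tensor_mul a b hF)]
  refine integral_congr_ae (Filter.Eventually.of_forall fun y => ?_)
  simp only
  rw [← integral_const_mul]
  refine integral_congr_ae (Filter.Eventually.of_forall fun x => ?_)
  simp only [map_mul]
  ring

theorem inner_tensor (a a' : Lp ℂ 2 μ) (b b' : Lp ℂ 2 ν) :
    inner ℂ (tensor a b) (tensor a' b') = inner ℂ a a' * inner ℂ b b' := by
  have h1 : ∀ y, ∫ x, conj (a x) * (a' x * b' y) ∂μ = inner ℂ a a' * b' y := by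
    intro y
    rw [L2.inner_def, ← integral_mul_const]
    refine integral_congr_ae (Filter.Eventually.of_forall fun x => ?_)
    simp only [RCLike.inner_apply]
    ring
  conv_lhs => rw [tensor.eq_def a' b', inner_tensor_toLp]
  simp only [h1]
  rw [L2.inner_def b, ← integral_const_mul]
  refine integral_congr_ae (Filter.Eventually.of_forall fun x => ?_)
  simp only [RCLike.inner_apply]
  ring

theorem tensor_add_left (a a' : Lp ℂ 2 μ) (b : Lp ℂ 2 ν) :
    tensor (a + a') b = tensor a b + tensor a' b := by
  apply Lp.ext
  have h : ∀ᵐ p ∂(μ.prod ν), (a + a' : Lp ℂ 2 μ) p.1 = a p.1 + a' p.1 :=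
    Measure.quasiMeasurePreserving_fst.ae (Lp.coeFn_add a a')
  filter_upwards [tensor_apply (a + a') b, tensor_apply a b, tensor_apply a' b,
    Lp.coeFn_add (tensor a b) (tensor a' b), h] with p h1 h2 h3 h4 h5
  rw [h1, h4, Pi.add_apply, h2, h3, h5, add_mul]

theorem tensor_add_right (a : Lp ℂ 2 μ) (b b' : Lp ℂ 2 ν) :
    tensor a (b + b') = tensor a b + tensor a b' := by
  apply Lp.ext
  have h : ∀ᵐ p ∂(μ.prod ν), (b + b' : Lp ℂ 2 ν) p.2 = b p.2 + b' p.2 :=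
    Measure.quasiMeasurePreserving_snd.ae (Lp.coeFn_add b b')
  filter_upwards [tensor_apply a (b + b'), tensor_apply a b, tensor_apply a b',
    Lp.coeFn_add (tensor a b) (tensor a b'), h] with p h1 h2 h3 h4 h5
  rw [h1, h4, Pi.add_apply, h2, h3, h5, mul_add]

theorem tensor_smul_left (c : ℂ) (a : Lp ℂ 2 μ) (b : Lp ℂ 2 ν) :
    tensor (c • a) b = c • tensor a b := by
  apply Lp.ext
  have h : ∀ᵐ p ∂(μ.prod ν), (c • a : Lp ℂ 2 μ) p.1 = c • a p.1 :=
    Measure.quasiMeasurePreserving_fst.ae (Lp.coeFn_smul c a)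
  filter_upwards [tensor_apply (c • a) b, tensor_apply a b,
    Lp.coeFn_smul c (tensor a b), h] with p h1 h2 h4 h5
  rw [h1, h4, Pi.smul_apply, h2, h5, smul_eq_mul, smul_eq_mul, mul_assoc]

theorem tensor_smul_right (c : ℂ) (a : Lp ℂ 2 μ) (b : Lp ℂ 2 ν) :
    tensor a (c • b) = c • tensor a b := by
  apply Lp.ext
  have h : ∀ᵐ p ∂(μ.prod ν), (c • b : Lp ℂ 2 ν) p.2 = c • b p.2 :=
    Measure.quasiMeasurePreserving_snd.ae (Lp.coeFn_smul c b)
  filter_upwards [tensor_apply a (c • b), tensor_apply a b,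
    Lp.coeFn_smul c (tensor a b), h] with p h1 h2 h4 h5
  rw [h1, h4, Pi.smul_apply, h2, h5, smul_eq_mul, smul_eq_mul, mul_left_comm]

theorem norm_tensor (a : Lp ℂ 2 μ) (b : Lp ℂ 2 ν) : ‖tensor a b‖ = ‖a‖ * ‖b‖ := by
  have h := inner_tensor a a b b
  rw [inner_self_eq_norm_sq_to_K, inner_self_eq_norm_sq_to_K, inner_self_eq_norm_sq_to_K] at h
  have h2 : ‖tensor a b‖ ^ 2 = (‖a‖ * ‖b‖) ^ 2 := by rw [mul_pow]; exact_mod_cast h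
  exact (sq_eq_sq₀ (norm_nonneg _) (by positivity)).1 h2

/-- `tensor` as a continuous bilinear map. -/
def tensorL : Lp ℂ 2 μ →L[ℂ] Lp ℂ 2 ν →L[ℂ] Lp ℂ 2 (μ.prod ν) :=
  LinearMap.mkContinuous₂
    (LinearMap.mk₂ ℂ tensor tensor_add_left tensor_smul_left tensor_add_right tensor_smul_right)
    1 fun a b => by simp [norm_tensor]

theorem tensorL_apply (a : Lp ℂ 2 μ) (b : Lp ℂ 2 ν) : tensorL a b = tensor a b := rfl

/-- Rectangles form a π-system generating the product σ-algebra. Cutting down to rectangles of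
finite measure makes `F` integrable, which the complement and countable union steps of the π-λ
argument require. -/
theorem ae_eq_zero_of_setIntegral_prod {F : X × Y → ℂ} (hF : MemLp F 2 (μ.prod ν))
    (h : ∀ (s : Set X) (t : Set Y), MeasurableSet s → MeasurableSet t → μ s < ∞ → ν t < ∞ →
      ∫ p in s ×ˢ t, F p ∂(μ.prod ν) = 0) : F =ᵐ[μ.prod ν] 0 := by
  have hR : ∀ n, (F =ᵐ[(μ.prod ν).restrict (spanningSets μ n ×ˢ spanningSets ν n)] 0) := by
    intro n
    set S := spanningSets μ n
    set T := spanningSets ν n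
    have hS := measurableSet_spanningSets μ n
    have hT := measurableSet_spanningSets ν n
    have hSf := measure_spanningSets_lt_top μ n
    have hTf := measure_spanningSets_lt_top ν n
    have hfin : IsFiniteMeasure ((μ.prod ν).restrict (S ×ˢ T)) := ⟨by
      rw [Measure.restrict_apply_univ, Measure.prod_prod]
      exact ENNReal.mul_lt_top hSf hTf⟩
    have hint : Integrable F ((μ.prod ν).restrict (S ×ˢ T)) :=
      (hF.restrict _).integrable (by norm_num)
    refine hint.ae_eq_zero_of_forall_setIntegral_eq_zero fun E hE _ => ?_
    induction E, hE using MeasurableSpace.induction_on_inter generateFrom_prod.symm isPiSystem_prod with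
    | empty => simp
    | basic E hE =>
      obtain ⟨s, hs, t, ht, rfl⟩ := hE
      rw [Measure.restrict_restrict (hs.prod ht), Set.prod_inter_prod]
      exact h _ _ (hs.inter hS) (ht.inter hT) ((measure_mono Set.inter_subset_right).trans_lt hSf)
        ((measure_mono Set.inter_subset_right).trans_lt hTf)
    | compl E hE ih =>
      have h1 := integral_add_compl hE hint
      rw [ih (measure_lt_top _ _), zero_add] at h1
      rw [h1]
      exact h _ _ hS hT hSf hTf
    | iUnion f hd hm ih =>
      rw [integral_iUnion hm hd hint.integrableOn]
      simp [ih]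
  have hU : (⋃ n, spanningSets μ n ×ˢ spanningSets ν n) = Set.univ := by
    rw [Set.eq_univ_iff_forall]
    rintro ⟨x, y⟩
    refine Set.mem_iUnion.2 ⟨max (spanningSetsIndex μ x) (spanningSetsIndex ν y), ?_, ?_⟩
    · exact monotone_spanningSets μ (le_max_left _ _) (mem_spanningSetsIndex μ x)
    · exact monotone_spanningSets ν (le_max_right _ _) (mem_spanningSetsIndex ν y)
  have := (ae_restrict_iUnion_iff (fun n => spanningSets μ n ×ˢ spanningSets ν n)
    (fun p => F p = 0)).2 hR
  rwa [hU, Measure.restrict_univ] at this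

/-- Orthogonality to every $a_i\otimes b_j$ passes by continuity to all $a'\otimes b_j$, then to all
$a'\otimes b'$. Taking indicators for $a'$ and $b'$ shows that the integrals over finite rectangles
vanish. -/
theorem TotalFamily.tensor {ι κ : Type*} {a : ι → Lp ℂ 2 μ} {b : κ → Lp ℂ 2 ν} (ha : TotalFamily a)
    (hb : TotalFamily b) : TotalFamily fun p : ι × κ => tensor (a p.1) (b p.2) := by
  rw [total_iff]
  intro f hf
  have h1 : ∀ a' b', inner ℂ (AffineTwo.tensor a' b') f = 0 := by
    have h2 : ∀ a' j, inner ℂ (AffineTwo.tensor a' (b j)) f = 0 := by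
      intro a' j
      have h3 : (innerSL ℂ f).comp (tensorL.flip (b j)) = 0 := ha.ext fun i => by
        have := hf (i, j)
        rw [← inner_conj_symm, map_eq_zero] at this
        simpa [tensorL_apply] using this
      have h4 := congrArg (fun L => L a') h3
      rw [← inner_conj_symm, map_eq_zero]
      simpa [tensorL_apply] using h4
    intro a' b'
    have h3 : (innerSL ℂ f).comp (tensorL a') = 0 := hb.ext fun i => by
      have := h2 a' i
      rw [← inner_conj_symm, map_eq_zero] at this
      simpa [tensorL_apply] using this
    have h4 := congrArg (fun L => L b') h3
    rw [← inner_conj_symm, map_eq_zero]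
    simpa [tensorL_apply] using h4
  have h0 : f =ᵐ[μ.prod ν] 0 := by
    refine ae_eq_zero_of_setIntegral_prod (Lp.memLp f) fun s t hs ht hsf htf => ?_
    rw [← h1 (indicatorConstLp 2 hs hsf.ne 1) (indicatorConstLp 2 ht htf.ne 1), L2.inner_def,
      ← integral_indicator (hs.prod ht)]
    refine integral_congr_ae ?_
    filter_upwards [tensor_apply (indicatorConstLp 2 hs hsf.ne (1 : ℂ))
        (indicatorConstLp 2 ht htf.ne (1 : ℂ)),
      Measure.quasiMeasurePreserving_fst.ae (indicatorConstLp_coeFn (p := 2) (hs := hs)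
        (hμs := hsf.ne) (c := (1 : ℂ))),
      Measure.quasiMeasurePreserving_snd.ae (indicatorConstLp_coeFn (p := 2) (hs := ht)
        (hμs := htf.ne) (c := (1 : ℂ)))] with p h1 h2 h3
    rw [h1, h2, h3, RCLike.inner_apply]
    by_cases hp1 : p.1 ∈ s <;> by_cases hp2 : p.2 ∈ t <;> simp [hp1, hp2, Set.indicator]
  exact Lp.ext (h0.trans (Lp.coeFn_zero ℂ 2 _).symm)

/-- A unitary operator acting on the first factor of `L²` of a product. -/
theorem exists_tensor_unitary (U : Lp ℂ 2 μ ≃ₗᵢ[ℂ] Lp ℂ 2 μ') (ν : Measure Y) [SigmaFinite ν] :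
    ∃ P : Lp ℂ 2 (μ.prod ν) ≃ₗᵢ[ℂ] Lp ℂ 2 (μ'.prod ν),
      ∀ a b, P (tensor a b) = tensor (U a) b := by
  have h1 : TotalFamily fun p : Lp ℂ 2 μ × Lp ℂ 2 ν => tensor p.1 p.2 :=
    TotalFamily.tensor (a := fun x => x) (b := fun x => x) total_id total_id
  have h2 : TotalFamily fun p : Lp ℂ 2 μ × Lp ℂ 2 ν => tensor (U p.1) p.2 :=
    TotalFamily.tensor (a := fun x => U x) (b := fun x => x) (total_id.map U) total_id
  obtain ⟨P, hP⟩ := exists_linearIsometryEquiv_of_inner_eq h1 h2 fun i j => by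
    rw [inner_tensor, inner_tensor, U.inner_map_map]
  exact ⟨P, fun a b => hP (a, b)⟩

end Tensor

/-! ### Integral operators acting on one factor -/

section Partial

variable {X X' Y : Type*} [MeasurableSpace X] [MeasurableSpace X'] [MeasurableSpace Y]
  {μ : Measure X} {μ' : Measure X'} {ν : Measure Y} [SigmaFinite μ] [SigmaFinite μ'] [SigmaFinite ν]

/-- A unitary operator that is an integral operator on the functions satisfying `good` acts
on the first factor of a product by the same integral. -/
theorem partial_unitary_apply {U : Lp ℂ 2 μ ≃ₗᵢ[ℂ] Lp ℂ 2 μ'}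
    {P : Lp ℂ 2 (μ.prod ν) ≃ₗᵢ[ℂ] Lp ℂ 2 (μ'.prod ν)}
    (hP : ∀ a b, P (tensor a b) = tensor (U a) b)
    {κ : X' → X → ℂ} (hκ : Measurable fun p : X' × X => κ p.1 p.2) {good : (X → ℂ) → Prop}
    (hU : ∀ (f : X → ℂ) (hf : MemLp f 2 μ), good f →
      U (hf.toLp f) =ᵐ[μ'] fun x' => ∫ x, κ x' x * f x ∂μ)
    {k : X × Y → ℂ} (hkm : Measurable k) (hk : MemLp k 2 (μ.prod ν))
    (hgood : ∀ᵐ y ∂ν, good fun x => k (x, y)) :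
    P (hk.toLp k) =ᵐ[μ'.prod ν] fun p => ∫ x, κ p.1 x * k (x, p.2) ∂μ := by
  set G : X' × Y → ℂ := fun p => ∫ x, κ p.1 x * k (x, p.2) ∂μ with hG
  have hGm : StronglyMeasurable G := by
    refine StronglyMeasurable.integral_prod_right (ν := μ)
      (f := fun (p : X' × Y) x => κ p.1 x * k (x, p.2)) (Measurable.stronglyMeasurable ?_)
    exact (hκ.comp (measurable_fst.fst.prodMk measurable_snd)).mul
      (hkm.comp (measurable_snd.prodMk measurable_fst.snd))
  have hk2 := (memLp_two_iff_lintegral.1 hk).2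
  rw [lintegral_prod_symm _ (hkm.enorm.pow_const 2).aemeasurable] at hk2
  have hsec : ∀ᵐ y ∂ν, MemLp (fun x => k (x, y)) 2 μ := by
    filter_upwards [ae_lt_top ((hkm.enorm.pow_const 2).lintegral_prod_left' (μ := μ)) hk2.ne]
      with y hy
    exact memLp_two_iff_lintegral.2
      ⟨(hkm.comp (measurable_id.prodMk measurable_const)).aestronglyMeasurable, hy⟩
  have hslice : ∀ᵐ y ∂ν, ∃ hf : MemLp (fun x => k (x, y)) 2 μ,
      U (hf.toLp _) =ᵐ[μ'] fun x' => G (x', y) := by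
    filter_upwards [hsec, hgood] with y h1 h2
    exact ⟨h1, hU _ h1 h2⟩
  -- Square integrability of `G` comes from Tonelli: on almost every slice `G` represents the image
  -- under `U` of the slice of `k`, so the two slices have equal norms.
  have hGL : MemLp G 2 (μ'.prod ν) := by
    refine memLp_two_iff_lintegral.2 ⟨hGm.aestronglyMeasurable, ?_⟩
    rw [lintegral_prod_symm _ (hGm.measurable.enorm.pow_const 2).aemeasurable]
    refine (lintegral_congr_ae ?_).trans_lt hk2
    filter_upwards [hslice] with y ⟨hf, hy⟩
    have h1 : eLpNorm (fun x' => G (x', y)) 2 μ' = eLpNorm (fun x => k (x, y)) 2 μ := by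
      rw [← eLpNorm_congr_ae hy, ← Lp.enorm_def, ← ofReal_norm, U.norm_map, ofReal_norm,
        Lp.enorm_def, eLpNorm_congr_ae hf.coeFn_toLp]
    have h2 := congrArg (fun z : ℝ≥0∞ => z ^ 2) h1
    rw [eLpNorm_eq_lintegral_rpow_enorm_toReal (by simp) (by simp),
      eLpNorm_eq_lintegral_rpow_enorm_toReal (by simp) (by simp)] at h2
    simp only [ENNReal.toReal_ofNat, ← ENNReal.rpow_natCast, ← ENNReal.rpow_mul] at h2
    simpa using h2
  have heq : P (hk.toLp k) = hGL.toLp G := by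
    have htot : TotalFamily fun p : Lp ℂ 2 μ × Lp ℂ 2 ν => tensor (U p.1) p.2 :=
      TotalFamily.tensor (a := fun x => U x) (b := fun x => x) (total_id.map U) total_id
    -- Both sides are tested against $Ua\otimes b$. Unitarity of `P` turns the left side into a
    -- pairing of $a\otimes b$ with `k`; after Fubini, the two inner integrals agree on each slice
    -- because `U` preserves inner products.
    refine htot.inner_eq fun p => ?_
    rw [← hP, P.inner_map_map, hP, inner_tensor_toLp, inner_tensor_toLp]
    refine integral_congr_ae ?_
    filter_upwards [hslice] with y ⟨hf, hy⟩
    congr 1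
    have h1 := U.inner_map_map p.1 (hf.toLp _)
    rw [L2.inner_def, L2.inner_def] at h1
    refine Eq.trans ?_ (h1.symm.trans ?_)
    · refine integral_congr_ae ?_
      filter_upwards [hf.coeFn_toLp] with x hx
      rw [hx, RCLike.inner_apply, mul_comm]
    · refine integral_congr_ae ?_
      filter_upwards [hy] with x hx
      rw [hx, RCLike.inner_apply, mul_comm]
  rw [heq]
  exact hGL.coeFn_toLp

end Partial

/-! ### Weighted changes of variables as unitary operators -/

section Pullback

variable {X Y : Type*} [MeasurableSpace X] [MeasurableSpace Y] {μ : Measure X} {ν : Measure Y}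

theorem lintegral_weighted_map {n : X → Y} (hn : Measurable n) {ρ : X → ℝ} (hρ : Measurable ρ)
    (hmap : (μ.withDensity fun x => ENNReal.ofReal (ρ x ^ 2)).map n = ν) {h : Y → ℝ≥0∞}
    (hh : AEMeasurable h ν) :
    ∫⁻ y, h y ∂ν = ∫⁻ x, ENNReal.ofReal (ρ x ^ 2) * h (n x) ∂μ := by
  have hd : Measurable fun x => ENNReal.ofReal (ρ x ^ 2) := (hρ.pow_const 2).ennreal_ofReal
  rw [← hmap, lintegral_map' (by rwa [hmap]) hn.aemeasurable,
    lintegral_withDensity_eq_lintegral_mul_non_measurable _ hd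
      (Filter.Eventually.of_forall fun _ => ENNReal.ofReal_lt_top)]
  rfl

theorem integral_weighted_map {n : X → Y} (hn : Measurable n) {ρ : X → ℝ} (hρ : Measurable ρ)
    (hmap : (μ.withDensity fun x => ENNReal.ofReal (ρ x ^ 2)).map n = ν) {h : Y → ℂ}
    (hh : AEStronglyMeasurable h ν) :
    ∫ y, h y ∂ν = ∫ x, ((ρ x ^ 2 : ℝ) : ℂ) * h (n x) ∂μ := by
  have hd : Measurable fun x => ENNReal.ofReal (ρ x ^ 2) := (hρ.pow_const 2).ennreal_ofReal
  rw [← hmap, integral_map hn.aemeasurable (by rwa [hmap]),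
    integral_withDensity_eq_integral_toReal_smul hd
      (Filter.Eventually.of_forall fun _ => ENNReal.ofReal_lt_top)]
  refine integral_congr_ae (Filter.Eventually.of_forall fun x => ?_)
  simp only
  rw [ENNReal.toReal_ofReal (sq_nonneg _), Complex.real_smul]

theorem integrable_weighted_map {n : X → Y} (hn : Measurable n) {ρ : X → ℝ} (hρ : Measurable ρ)
    (hmap : (μ.withDensity fun x => ENNReal.ofReal (ρ x ^ 2)).map n = ν) {h : Y → ℂ}
    (hh : AEStronglyMeasurable h ν) (hi : Integrable (fun x => ((ρ x ^ 2 : ℝ) : ℂ) * h (n x)) μ) :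
    Integrable h ν := by
  have hd : Measurable fun x => ENNReal.ofReal (ρ x ^ 2) := (hρ.pow_const 2).ennreal_ofReal
  rw [← hmap, integrable_map_measure (by rwa [hmap]) hn.aemeasurable,
    integrable_withDensity_iff_integrable_smul' hd
      (Filter.Eventually.of_forall fun _ => ENNReal.ofReal_lt_top)]
  refine hi.congr (Filter.Eventually.of_forall fun x => ?_)
  simp only [Function.comp]
  rw [ENNReal.toReal_ofReal (sq_nonneg _), Complex.real_smul]

theorem enorm_ofReal_mul_sq (r : ℝ) (z : ℂ) :
    ‖(r : ℂ) * z‖ₑ ^ 2 = ENNReal.ofReal (r ^ 2) * ‖z‖ₑ ^ 2 := by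
  rw [enorm_mul, mul_pow, ← ofReal_norm, ← ENNReal.ofReal_pow (norm_nonneg _), Complex.norm_real,
    Real.norm_eq_abs, sq_abs]

/-- The unitary operator `f ↦ ρ · (f ∘ n)` attached to an essentially invertible map `n` and a
positive weight `ρ` with `n_* (ρ² μ) = ν`. -/
theorem exists_weighted_pullback {n : X → Y} (hn : Measurable n) {r : Y → X} (hr : Measurable r)
    (hrn : ∀ x, r (n x) = x) {ρ : X → ℝ} (hρ : Measurable ρ) (hpos : ∀ x, 0 < ρ x)
    (hmap : (μ.withDensity fun x => ENNReal.ofReal (ρ x ^ 2)).map n = ν) :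
    ∃ M : Lp ℂ 2 ν ≃ₗᵢ[ℂ] Lp ℂ 2 μ,
      (∀ (f : Y → ℂ) (hf : MemLp f 2 ν),
        M (hf.toLp f) =ᵐ[μ] fun x => (ρ x : ℂ) * f (n x)) ∧
      ∀ (f : X → ℂ) (hf : MemLp f 2 μ),
        M.symm (hf.toLp f) =ᵐ[ν] fun y => f (r y) / (ρ (r y) : ℂ) := by
  have hd : Measurable fun x => ENNReal.ofReal (ρ x ^ 2) := (hρ.pow_const 2).ennreal_ofReal
  have hq : Measure.QuasiMeasurePreserving n μ ν := by
    refine ⟨hn, ?_⟩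
    rw [← hmap]
    refine Measure.AbsolutelyContinuous.map (withDensity_absolutelyContinuous' hd.aemeasurable
      (Filter.Eventually.of_forall fun x => ?_)) hn
    exact (ENNReal.ofReal_pos.2 (pow_pos (hpos x) 2)).ne'
  -- The weight enters as `ρ` in the function and as `ρ ^ 2` in the measure, so this change of
  -- variables is the isometry property.
  have hL : ∀ f : Y → ℂ, AEStronglyMeasurable f ν →
      ∫⁻ x, ‖(ρ x : ℂ) * f (n x)‖ₑ ^ 2 ∂μ = ∫⁻ y, ‖f y‖ₑ ^ 2 ∂ν := by
    intro f hf
    rw [lintegral_weighted_map hn hρ hmap (hf.enorm.pow_const 2)]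
    exact lintegral_congr fun x => enorm_ofReal_mul_sq _ _
  have hmem : ∀ f : Y → ℂ, MemLp f 2 ν → MemLp (fun x => (ρ x : ℂ) * f (n x)) 2 μ := by
    intro f hf
    refine memLp_two_iff_lintegral.2 ⟨?_, ?_⟩
    · exact (Complex.measurable_ofReal.comp hρ).aestronglyMeasurable.mul
        (hf.1.comp_quasiMeasurePreserving hq)
    · rw [hL f hf.1]; exact (memLp_two_iff_lintegral.1 hf).2
  let M₀ : Lp ℂ 2 ν →ₗᵢ[ℂ] Lp ℂ 2 μ :=
    { toFun := fun f => (hmem f (Lp.memLp f)).toLp _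
      map_add' := fun f g => by
        apply Lp.ext
        filter_upwards [(hmem _ (Lp.memLp (f + g))).coeFn_toLp, (hmem _ (Lp.memLp f)).coeFn_toLp,
          (hmem _ (Lp.memLp g)).coeFn_toLp, hq.ae (Lp.coeFn_add f g),
          Lp.coeFn_add ((hmem _ (Lp.memLp f)).toLp _) ((hmem _ (Lp.memLp g)).toLp _)]
          with x h1 h2 h3 h4 h5
        rw [h1, h5, Pi.add_apply, h2, h3, h4, Pi.add_apply, mul_add]
      map_smul' := fun c f => by
        apply Lp.ext
        filter_upwards [(hmem _ (Lp.memLp (c • f))).coeFn_toLp, (hmem _ (Lp.memLp f)).coeFn_toLp,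
          hq.ae (Lp.coeFn_smul c f), Lp.coeFn_smul c ((hmem _ (Lp.memLp f)).toLp _)]
          with x h1 h2 h3 h4
        rw [h1, RingHom.id_apply, h4, Pi.smul_apply, h2, h3, Pi.smul_apply, smul_eq_mul,
          smul_eq_mul, mul_left_comm]
      norm_map' := fun f => by
        change ‖(hmem _ (Lp.memLp f)).toLp _‖ = ‖f‖
        rw [Lp.norm_toLp, Lp.norm_def]
        congr 1
        rw [eLpNorm_eq_lintegral_rpow_enorm_toReal (by simp) (by simp),
          eLpNorm_eq_lintegral_rpow_enorm_toReal (by simp) (by simp)]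
        simpa using congrArg (fun z => z ^ (2 : ℝ)⁻¹) (hL f (Lp.aestronglyMeasurable f)) }
  have hM₀ : ∀ (f : Y → ℂ) (hf : MemLp f 2 ν),
      M₀ (hf.toLp f) =ᵐ[μ] fun x => (ρ x : ℂ) * f (n x) := by
    intro f hf
    filter_upwards [(hmem _ (Lp.memLp (hf.toLp f))).coeFn_toLp, hq.ae hf.coeFn_toLp] with x h1 h2
    rw [← h2]; exact h1
  -- Since `r ∘ n = id`, the map `r` carries `ν` back to `ρ² μ`. A left inverse suffices: `ν` is an
  -- image measure under `n`, so values of `r` outside the range of `n` play no role.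
  have hqr : Measure.QuasiMeasurePreserving r ν μ := by
    refine ⟨hr, ?_⟩
    have hid : r ∘ n = id := funext hrn
    rw [← hmap, Measure.map_map hr hn, hid, Measure.map_id]
    exact withDensity_absolutelyContinuous _ _
  have hval : ∀ (f : X → ℂ) x, (ρ x : ℂ) * (f (r (n x)) / (ρ (r (n x)) : ℂ)) = f x := by
    intro f x
    rw [hrn]
    exact mul_div_cancel₀ _ (Complex.ofReal_ne_zero.2 (hpos x).ne')
  have hh : ∀ f : X → ℂ, MemLp f 2 μ → MemLp (fun y => f (r y) / (ρ (r y) : ℂ)) 2 ν := by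
    intro f hf
    have hm : AEStronglyMeasurable (fun y => f (r y) / (ρ (r y) : ℂ)) ν :=
      (hf.1.comp_quasiMeasurePreserving hqr).div₀
        (Complex.measurable_ofReal.comp (hρ.comp hr)).aestronglyMeasurable
    refine memLp_two_iff_lintegral.2 ⟨hm, ?_⟩
    rw [← hL _ hm]
    simp_rw [hval]
    exact (memLp_two_iff_lintegral.1 hf).2
  have hinv : ∀ (f : X → ℂ) (hf : MemLp f 2 μ), M₀ ((hh f hf).toLp _) = hf.toLp f := by
    intro f hf
    apply Lp.ext
    filter_upwards [hM₀ _ (hh f hf), hf.coeFn_toLp] with x hx h2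
    rw [hx, hval, h2]
  have hs : Function.Surjective M₀ := fun f =>
    ⟨_, (hinv f (Lp.memLp f)).trans (Lp.toLp_coeFn f (Lp.memLp f))⟩
  refine ⟨LinearIsometryEquiv.ofSurjective M₀ hs, hM₀, fun f hf => ?_⟩
  have h1 : (LinearIsometryEquiv.ofSurjective M₀ hs).symm (hf.toLp f) = (hh f hf).toLp _ := by
    rw [LinearIsometryEquiv.symm_apply_eq]
    exact (hinv f hf).symm
  rw [h1]
  exact (hh f hf).coeFn_toLp

end Pullback

/-! ### The $L^2$ Fourier transform as an integral -/

section Fourier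

open scoped FourierTransform ContDiff

variable {V : Type*} [NormedAddCommGroup V] [InnerProductSpace ℝ V] [FiniteDimensional ℝ V]
  [MeasurableSpace V] [BorelSpace V]

/-- The `L²` Fourier transform is given by the Fourier integral on integrable functions. -/
theorem fourier_toLp_ae_eq {f : V → ℂ} (hf : MemLp f 2 volume) (hf1 : Integrable f) :
    Lp.fourierTransformₗᵢ V ℂ (hf.toLp f) =ᵐ[volume] 𝓕 f := by
  have hc : Continuous (𝓕 f) := VectorFourier.fourierIntegral_continuous
    Real.continuous_fourierChar (L := innerₗ V) continuous_inner hf1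
  -- Two locally integrable functions agree a.e. if they agree against compactly supported smooth
  -- functions. The $L^2$ transform is also the distributional one, which moves it onto the test
  -- function; the multiplication formula for integrable functions then moves it back onto `f`.
  refine ae_eq_of_integral_contDiff_smul_eq
    ((Lp.memLp _).locallyIntegrable (by norm_num)) hc.locallyIntegrable fun g hg hgs => ?_
  have hg1 : HasCompactSupport (Complex.ofRealCLM ∘ g) := hgs.comp_left rfl
  have hg2 : ContDiff ℝ ∞ (Complex.ofRealCLM ∘ g) := by fun_prop
  let φ : SchwartzMap V ℂ := hg1.toSchwartzMap hg2
  have hφ : ∀ x, φ x = (g x : ℂ) := fun x => by simp [φ]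
  have h1 := congrArg (fun T => T φ) (Lp.fourier_toTemperedDistribution_eq (hf.toLp f))
  simp only [TemperedDistribution.fourier_apply, Lp.toTemperedDistribution_apply] at h1
  have h2 : ∫ ξ, 𝓕 (φ : V → ℂ) ξ • f ξ = ∫ x, φ x • 𝓕 f x :=
    VectorFourier.integral_fourierIntegral_smul_eq_flip (L := innerₗ V)
      Real.continuous_fourierChar continuous_inner φ.integrable hf1 |>.trans (by
        rw [flip_innerₗ]; rfl)
  have h3 : ∫ x, (𝓕 φ) x • (hf.toLp f) x = ∫ ξ, 𝓕 (φ : V → ℂ) ξ • f ξ := by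
    refine integral_congr_ae ?_
    filter_upwards [hf.coeFn_toLp] with x hx
    rw [hx, SchwartzMap.fourier_coe]
  have h4 := h1.symm.trans (h3.trans h2)
  simp only [hφ, smul_eq_mul] at h4
  simp only [Complex.real_smul]
  exact h4

/-- The Fourier transform in the coordinate `n`, as a unitary operator. -/
theorem exists_fourier_unitary {X : Type*} [MeasurableSpace X] {μ : Measure X} {n : X → V}
    (hn : Measurable n) {r : V → X} (hr : Measurable r) (hrn : ∀ x, r (n x) = x) {ρ : X → ℝ}
    (hρ : Measurable ρ) (hpos : ∀ x, 0 < ρ x)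
    (hmap : (μ.withDensity fun x => ENNReal.ofReal (ρ x ^ 2)).map n = volume) :
    ∃ U : Lp ℂ 2 μ ≃ₗᵢ[ℂ] Lp ℂ 2 (volume : Measure V), ∀ (f : X → ℂ) (hf : MemLp f 2 μ),
      Integrable (fun x => (ρ x : ℂ) * f x) μ →
      U (hf.toLp f) =ᵐ[volume] fun v => ∫ x, phase (-inner ℝ (n x) v) * ρ x * f x ∂μ := by
  obtain ⟨M, -, hM⟩ := exists_weighted_pullback hn hr hrn hρ hpos hmap
  refine ⟨M.symm.trans (Lp.fourierTransformₗᵢ V ℂ), fun f hf hi => ?_⟩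
  set g : V → ℂ := fun y => f (r y) / (ρ (r y) : ℂ)
  have hg : MemLp g 2 volume := (memLp_congr_ae (hM f hf)).1 (Lp.memLp _)
  have hgeq : M.symm (hf.toLp f) = hg.toLp g := Lp.ext ((hM f hf).trans hg.coeFn_toLp.symm)
  -- Transport to `V` divides `f` by `ρ`, while the change of variables contributes `ρ ^ 2`; one
  -- factor `ρ` survives in the kernel and in the integrability condition.
  have hval : ∀ x, ((ρ x ^ 2 : ℝ) : ℂ) * g (n x) = ρ x * f x := by
    intro x
    have := Complex.ofReal_ne_zero.2 (hpos x).ne'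
    simp only [g, hrn]
    push_cast
    field_simp
  have hg1 : Integrable g volume := integrable_weighted_map hn hρ hmap hg.1 (by
    simp_rw [hval]; exact hi)
  rw [LinearIsometryEquiv.trans_apply, hgeq]
  refine (fourier_toLp_ae_eq hg hg1).trans (Filter.Eventually.of_forall fun v => ?_)
  simp only
  have hphase : Continuous fun y : V => phase (-inner ℝ y v) :=
    continuous_phase.comp (by fun_prop)
  have h1 : 𝓕 g v = ∫ y, phase (-inner ℝ y v) * g y := by
    rw [Real.fourier_eq']
    refine integral_congr_ae (Filter.Eventually.of_forall fun y => ?_)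
    simp only [phase, smul_eq_mul]
    congr 2
    push_cast
    ring
  rw [h1, integral_weighted_map hn hρ hmap (h := fun y => phase (-inner ℝ y v) * g y)
    (hphase.aestronglyMeasurable.mul hg.1)]
  refine integral_congr_ae (Filter.Eventually.of_forall fun x => ?_)
  simp only
  rw [mul_left_comm, hval, mul_assoc]

end Fourier

/-! ### Fourier transforms on the orbits in dimensions one and two -/

section Orbits

theorem map_val_lebO1 : lebO1.map Units.val = volume := by
  have hemb := (Units.isOpenEmbedding_val (R := ℝ)).measurableEmbedding
  rw [lebO1, hemb.map_comap]
  have h : Set.range (Units.val : ℝˣ → ℝ) = {0}ᶜ := by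
    ext x
    simp only [Set.mem_range, Set.mem_compl_iff, Set.mem_singleton_iff]
    exact isUnit_iff_ne_zero
  rw [h]
  exact Measure.restrict_eq_self_of_ae_mem (by simp [ae_iff])

theorem map_val_lebO : lebO.map Subtype.val = volume := by
  have h : Set.range (Subtype.val : Orbit → Fin 2 → ℝ) = {0}ᶜ := Subtype.range_coe
  rw [lebO, measurableEmbedding_orbit.map_comap, h]
  exact Measure.restrict_eq_self_of_ae_mem (by simp [ae_iff])

theorem measurable_units_val : Measurable (Units.val : ℝˣ → ℝ) := comap_measurable _

theorem lintegral_lebO1 {h : ℝ → ℝ≥0∞} (hh : Measurable h) :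
    ∫⁻ t : ℝˣ, h t ∂lebO1 = ∫⁻ s, h s := by
  rw [← map_val_lebO1, lintegral_map hh measurable_units_val]

/-- A measurable map `ℝ → ℝˣ` that is the identity off zero. -/
def toUnit (s : ℝ) : ℝˣ := if h : s ≠ 0 then Units.mk0 s h else 1

theorem toUnit_val (t : ℝˣ) : toUnit t = t := by
  simp [toUnit]

theorem toUnit_of_ne {s : ℝ} (hs : s ≠ 0) : (toUnit s : ℝ) = s := by
  simp [toUnit, hs]

theorem measurable_toUnit : Measurable toUnit := by
  rw [measurable_comap_iff]
  have h : Units.val ∘ toUnit = fun s : ℝ => if s = 0 then 1 else s := by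
    funext s
    by_cases hs : s = 0 <;> simp [toUnit, hs]
  rw [h]
  exact Measurable.ite (measurableSet_singleton 0) measurable_const measurable_id

/-- The derivative of $s\mapsto s^{-1}$ has absolute value $s^{-2}$, and the point $0$ is null. -/
theorem map_inv_lebO1 : (lebO1.withDensity fun t => ENNReal.ofReal (|(t : ℝ)|⁻¹ ^ 2)).map
    (fun t : ℝˣ => (t : ℝ)⁻¹) = volume := by
  have hn : Measurable fun t : ℝˣ => (t : ℝ)⁻¹ := measurable_units_val.inv
  have hρ : Measurable fun s : ℝ => ENNReal.ofReal (|s|⁻¹ ^ 2) := by fun_prop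
  refine Measure.ext_of_lintegral _ fun f hf => ?_
  have hf2 : Measurable fun s : ℝ => ENNReal.ofReal (|s|⁻¹ ^ 2) * f s⁻¹ :=
    hρ.mul (hf.comp measurable_inv)
  have hw := lintegral_withDensity_eq_lintegral_mul lebO1
    (f := fun t : ℝˣ => ENNReal.ofReal (|(t : ℝ)|⁻¹ ^ 2)) (hρ.comp measurable_units_val)
    (g := fun t : ℝˣ => f (t : ℝ)⁻¹) (hf.comp hn)
  rw [lintegral_map hf hn, hw]
  refine (lintegral_lebO1 hf2).trans ?_
  have hc : (volume : Measure ℝ).restrict {0}ᶜ = volume :=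
    Measure.restrict_eq_self_of_ae_mem (by simp [ae_iff])
  have himg : (fun s : ℝ => s⁻¹) '' {0}ᶜ = {0}ᶜ := by
    ext x
    constructor
    · rintro ⟨y, hy, rfl⟩; simpa using hy
    · intro hx; exact ⟨x⁻¹, by simpa using hx, inv_inv x⟩
  have h := lintegral_image_eq_lintegral_abs_deriv_mul (s := {0}ᶜ) (f := fun s : ℝ => s⁻¹)
    (f' := fun s => -(s ^ 2)⁻¹) (measurableSet_singleton 0).compl
    (fun x hx => (hasDerivAt_inv hx).hasDerivWithinAt) inv_injective.injOn f
  rw [himg, hc] at h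
  rw [h]
  refine lintegral_congr fun s => ?_
  rw [abs_neg, abs_inv, abs_pow, inv_pow]

/-- The frequency variable is $1/t$ because `piOne` modulates by $e^{2\pi i u/t}$. The square root
$|t|^{-1}$ of the Jacobian density of inversion turns $dt$ in the kernel into the Haar measure
$dt/|t|$. -/
theorem exists_lineFourier : ∃ U : Lp ℂ 2 lebO1 ≃ₗᵢ[ℂ] Lp ℂ 2 (volume : Measure ℝ),
    ∀ (f : ℝˣ → ℂ) (hf : MemLp f 2 lebO1), 
      Integrable (fun t : ℝˣ => ((|(t : ℝ)|⁻¹ : ℝ) : ℂ) * f t) lebO1 →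
      U (hf.toLp f) =ᵐ[volume] fun u =>
        ∫ t : ℝˣ, phase (-(u * (t : ℝ)⁻¹)) * (|(t : ℝ)|⁻¹ : ℝ) * f t ∂lebO1 := by
  refine exists_fourier_unitary (V := ℝ) (n := fun t : ℝˣ => (t : ℝ)⁻¹) measurable_units_val.inv
    (r := fun s => (toUnit s)⁻¹) ?_ (fun t => ?_) ?_ (fun t => ?_) map_inv_lebO1
  · have h : (fun s => (toUnit s)⁻¹) = fun s : ℝ => toUnit (s⁻¹) := by
      funext s
      by_cases hs : s = 0
      · simp [toUnit, hs]
      · apply Units.ext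
        rw [Units.val_inv_eq_inv_val, toUnit_of_ne hs, toUnit_of_ne (inv_ne_zero hs)]
    rw [h]
    exact measurable_toUnit.comp measurable_inv
  · apply Units.ext
    rw [Units.val_inv_eq_inv_val, toUnit_of_ne (inv_ne_zero t.ne_zero), inv_inv]
  · exact measurable_units_val.abs.inv
  · exact inv_pos.2 (abs_pos.2 t.ne_zero)

/-- A measurable map from the plane to the orbit that is the identity off zero. -/
def toOrbit (v : Fin 2 → ℝ) : Orbit := if h : v ≠ 0 then ⟨v, h⟩ else baseRow

theorem toOrbit_val (ω : Orbit) : toOrbit ω.1 = ω := by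
  simp [toOrbit, ω.2]

theorem measurable_toOrbit : Measurable toOrbit := by
  rw [measurable_comap_iff]
  have h : Subtype.val ∘ toOrbit = fun v : Fin 2 → ℝ => if v = 0 then baseRow.1 else v := by
    funext v
    by_cases hv : v = 0 <;> simp [toOrbit, hv]
  rw [h]
  exact Measurable.ite (measurableSet_singleton 0) measurable_const measurable_id

/-- The Fourier transform needs an inner product space, whereas `Fin 2 → ℝ` carries the sup norm.
The transform is therefore taken on `EuclideanSpace ℝ (Fin 2)` and its output is brought back by the
measure-preserving identification. -/
theorem exists_planeFourier :
    ∃ U : Lp ℂ 2 lebO ≃ₗᵢ[ℂ] Lp ℂ 2 (volume : Measure (Fin 2 → ℝ)),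
      ∀ (f : Orbit → ℂ) (hf : MemLp f 2 lebO), Integrable f lebO →
        U (hf.toLp f) =ᵐ[volume] fun x => ∫ ω, phase (-(ω.1 ⬝ᵥ x)) * f ω ∂lebO := by
  have he := PiLp.volume_preserving_toLp (Fin 2)
  have hmap1 : ((volume : Measure (Fin 2 → ℝ)).withDensity
      fun _ => ENNReal.ofReal ((1 : ℝ) ^ 2)).map (WithLp.toLp 2) = volume := by
    simp only [one_pow, ENNReal.ofReal_one]
    rw [← Pi.one_def, withDensity_one, he.map_eq]
  have hmap : (lebO.withDensity fun _ => ENNReal.ofReal ((1 : ℝ) ^ 2)).map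
      (fun ω => (WithLp.toLp 2 ω.1 : EuclideanSpace ℝ (Fin 2))) = volume := by
    simp only [one_pow, ENNReal.ofReal_one]
    rw [← Pi.one_def, withDensity_one]
    change lebO.map (WithLp.toLp 2 ∘ Subtype.val) = _
    rw [← Measure.map_map he.measurable measurable_subtype_coe, map_val_lebO, he.map_eq]
  obtain ⟨U, hU⟩ := exists_fourier_unitary (V := EuclideanSpace ℝ (Fin 2))
    (n := fun ω : Orbit => WithLp.toLp 2 ω.1) (he.measurable.comp measurable_subtype_coe)
    (r := fun v => toOrbit (WithLp.ofLp v))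
    (measurable_toOrbit.comp (PiLp.volume_preserving_ofLp (Fin 2)).measurable)
    (fun ω => toOrbit_val ω) measurable_const (fun _ => one_pos) hmap
  obtain ⟨M, hM, -⟩ := exists_weighted_pullback (μ := (volume : Measure (Fin 2 → ℝ)))
    (ν := (volume : Measure (EuclideanSpace ℝ (Fin 2)))) (n := WithLp.toLp 2)
    (r := WithLp.ofLp) he.measurable (PiLp.volume_preserving_ofLp (Fin 2)).measurable
    (fun _ => rfl) (ρ := fun _ => 1) measurable_const (fun _ => one_pos) hmap1
  refine ⟨U.trans M, fun f hf hi => ?_⟩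
  have h1 := hU f hf (by simpa using hi)
  have h2 := hM _ (Lp.memLp (U (hf.toLp f)))
  rw [Lp.toLp_coeFn] at h2
  filter_upwards [h2, he.quasiMeasurePreserving.ae h1] with x h3 h4
  rw [LinearIsometryEquiv.trans_apply, h3, h4, Complex.ofReal_one, one_mul]
  refine integral_congr_ae (Filter.Eventually.of_forall fun ω => ?_)
  simp only [PiLp.inner_apply, RCLike.inner_apply, conj_trivial, dotProduct, mul_comm,
    one_mul]

end Orbits

/-! ### Joint measurability of the orbit action and the cocycle -/

section Measurability

variable {Z : Type*} [MeasurableSpace Z]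

theorem measurable_GL2_of_entries {f : Z → GL (Fin 2) ℝ}
    (h : ∀ i j, Measurable fun z => (f z).val i j) : Measurable f := by
  rw [measurable_comap_iff]
  have h2 : Measurable fun z => fun i j : Fin 2 => (f z).val i j :=
    measurable_pi_iff.2 fun i => measurable_pi_iff.2 fun j => h i j
  exact h2

theorem measurable_GL2_entry {f : Z → GL (Fin 2) ℝ} (hf : Measurable f) (i j : Fin 2) :
    Measurable fun z => (f z).val i j := (measurable_matrix_entry i j).comp hf

theorem measurable_GL2_mul {f g : Z → GL (Fin 2) ℝ} (hf : Measurable f) (hg : Measurable g) :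
    Measurable fun z => f z * g z := by
  refine measurable_GL2_of_entries fun i j => ?_
  simp only [Units.val_mul, Matrix.mul_apply, Fin.sum_univ_two]
  exact ((measurable_GL2_entry hf _ _).mul (measurable_GL2_entry hg _ _)).add
    ((measurable_GL2_entry hf _ _).mul (measurable_GL2_entry hg _ _))

theorem measurable_coord_fst (i : Fin 2) :
    Measurable fun p : Orbit × GL (Fin 2) ℝ => p.1.1 i := (measurable_coord i).comp measurable_fst

theorem measurable_entry_snd (i j : Fin 2) :
    Measurable fun p : Orbit × GL (Fin 2) ℝ => p.2.val i j :=
  (measurable_matrix_entry i j).comp measurable_snd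

theorem measurable_orbAct_prod : Measurable fun p : Orbit × GL (Fin 2) ℝ => orbAct p.1 p.2 := by
  refine Measurable.subtype_mk (measurable_pi_iff.2 fun j => ?_)
  have h0 := measurable_coord_fst 0
  have h1 := measurable_coord_fst 1
  have hA := fun i => measurable_entry_snd i j
  simp only [Matrix.vecMul, dotProduct, Fin.sum_univ_two]
  exact (h0.mul (hA 0)).add (h1.mul (hA 1))

theorem measurable_quotients {a b c d x y : Z → ℝ} (ha : Measurable a) (hb : Measurable b)
    (hc : Measurable c) (hd : Measurable d) (hx : Measurable x) (hy : Measurable y) :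
    (Measurable fun z => ((a z * c z + b z * d z) * (x z ^ 2 - y z ^ 2)
        - (a z ^ 2 + b z ^ 2 - c z ^ 2 - d z ^ 2) * x z * y z)
      / ((a z * x z + c z * y z) ^ 2 + (b z * x z + d z * y z) ^ 2)) ∧
    Measurable fun z => ((a z * d z - b z * c z) * (x z ^ 2 + y z ^ 2))
      / ((a z * x z + c z * y z) ^ 2 + (b z * x z + d z * y z) ^ 2) := by
  constructor <;> fun_prop

theorem measurable_uCoef : Measurable fun p : Orbit × GL (Fin 2) ℝ => uCoef p.1 p.2 :=
  (measurable_quotients (measurable_entry_snd 0 0) (measurable_entry_snd 0 1)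
    (measurable_entry_snd 1 0) (measurable_entry_snd 1 1) (measurable_coord_fst 0)
    (measurable_coord_fst 1)).1

theorem measurable_vCoef : Measurable fun p : Orbit × GL (Fin 2) ℝ => vCoef p.1 p.2 := by
  rw [measurable_comap_iff]
  exact (measurable_quotients (measurable_entry_snd 0 0) (measurable_entry_snd 0 1)
    (measurable_entry_snd 1 0) (measurable_entry_snd 1 1) (measurable_coord_fst 0)
    (measurable_coord_fst 1)).2

theorem measurable_rowNorm : Measurable fun ω : Orbit => rowNorm ω.1 := by
  have h0 := measurable_coord 0
  have h1 := measurable_coord 1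
  exact ((h0.pow_const 2).add (h1.pow_const 2)).sqrt

end Measurability

/-! ### Auxiliary measures and the change of variables on the line -/

theorem lintegral_withDensity_mul {Z : Type*} [MeasurableSpace Z] {μ : Measure Z} {d g : Z → ℝ≥0∞}
    (hd : Measurable d) (hg : Measurable g) :
    ∫⁻ z, g z ∂(μ.withDensity d) = ∫⁻ z, d z * g z ∂μ :=
  lintegral_withDensity_eq_lintegral_mul μ hd hg

instance : SigmaFinite lebO1 := by
  have h : SigmaFinite (lebO1.map Units.val) := by rw [map_val_lebO1]; infer_instance
  exact SigmaFinite.of_map _ measurable_units_val.aemeasurable h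

instance : SigmaFinite lebO := by
  have h : SigmaFinite (lebO.map Subtype.val) := by rw [map_val_lebO]; infer_instance
  exact SigmaFinite.of_map _ measurable_subtype_coe.aemeasurable h

instance : SigmaFinite haarRStar := SigmaFinite.withDensity_ofReal _

instance : SigmaFinite haarK := by
  have : SigmaFinite (lebO.withDensity fun ω => ENNReal.ofReal (rowNorm ω.1 ^ 2)⁻¹) :=
    SigmaFinite.withDensity_ofReal _
  exact kEquiv.sigmaFinite_map

/-- The measure `dv / |v|²` on the nonzero reals. -/
def quadRStar : Measure ℝˣ := lebO1.withDensity fun v => ENNReal.ofReal (|(v : ℝ)|⁻¹ ^ 2)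

instance : SigmaFinite quadRStar := SigmaFinite.withDensity_ofReal _

/-- The measure `dA / |det A|³` on `GL₂(ℝ)`. -/
def cubeGL2 : Measure (GL (Fin 2) ℝ) :=
  haarGL2.withDensity fun A => ENNReal.ofReal (|(A : Matrix (Fin 2) (Fin 2) ℝ).det|)⁻¹

instance : SigmaFinite cubeGL2 := SigmaFinite.withDensity_ofReal _

theorem map_inv_quadRStar : quadRStar.map (fun v => v⁻¹) = lebO1 := by
  have hemb := (Units.isOpenEmbedding_val (R := ℝ)).measurableEmbedding
  rw [← hemb.comap_map (quadRStar.map fun v => v⁻¹), ← hemb.comap_map lebO1, map_val_lebO1,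
    Measure.map_map measurable_units_val measurable_inv, ← map_inv_lebO1]
  congr 2
  funext v
  simp

theorem map_div_quadRStar (t : ℝˣ) :
    quadRStar.map (fun v => t / v) = ENNReal.ofReal |(t : ℝ)|⁻¹ • lebO1 := by
  rw [← map_mul_left_lebO1, ← map_inv_quadRStar,
    Measure.map_map (measurable_const_mul t) measurable_inv]
  simp only [Function.comp_def, div_eq_mul_inv]

/-- For fixed $t$, putting $w=t/v$ gives $dv/v^2=dw/|t|$, and the factor $1/|t|$ turns $dt$ into
Haar measure. This is why $\varphi$ is taken in $L^2(dt/|t|)$, $g$ in $L^2$ of Lebesgue measure, and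
$v$ carries $dv/v^2$. -/
theorem map_divSnd : (lebO1.prod quadRStar).map (fun p : ℝˣ × ℝˣ => (p.1, p.1 / p.2)) =
    haarRStar.prod lebO1 := by
  have hn : Measurable fun p : ℝˣ × ℝˣ => (p.1, p.1 / p.2) :=
    measurable_fst.prodMk (measurable_fst.div measurable_snd)
  have hd : Measurable fun t : ℝˣ => ENNReal.ofReal |(t : ℝ)|⁻¹ :=
    measurable_units_val.abs.inv.ennreal_ofReal
  refine Measure.ext_of_lintegral _ fun f hf => ?_
  rw [lintegral_map hf hn, lintegral_prod (fun p : ℝˣ × ℝˣ => f (p.1, p.1 / p.2))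
      (hf.comp hn).aemeasurable, lintegral_prod _ hf.aemeasurable, haarRStar,
    lintegral_withDensity_eq_lintegral_mul _ hd hf.lintegral_prod_right']
  refine lintegral_congr fun t => ?_
  have hft : Measurable fun w : ℝˣ => f (t, w) := hf.comp (measurable_const.prodMk measurable_id)
  have h := lintegral_map (μ := quadRStar) (g := fun v => t / v) hft (measurable_const.div measurable_id)
  rw [map_div_quadRStar, lintegral_smul_measure] at h
  exact h.symm

/-! ### The change of variables on $\mathcal O\times\mathrm{GL}_2(\mathbb R)$ -/

/-- The action of `GL₂(ℝ)` in the coordinates `(ω A, (u_{ω,A}, v_{ω,A}))`. -/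
def orbitCoords (ω : Orbit) (A : GL (Fin 2) ℝ) : Orbit × (ℝ × ℝˣ) :=
  (orbAct ω A, (uCoef ω A, vCoef ω A))

theorem measurable_orbitCoords_prod :
    Measurable fun p : Orbit × GL (Fin 2) ℝ => orbitCoords p.1 p.2 :=
  measurable_orbAct_prod.prodMk (measurable_uCoef.prodMk measurable_vCoef)

theorem measurable_orbitCoords (ω : Orbit) : Measurable (orbitCoords ω) :=
  measurable_orbitCoords_prod.comp (measurable_const.prodMk measurable_id)

/-- The matrix $\gamma(\omega)$ moves $\omega$ to $(1,0)$ with trivial cocycle value $(0,1)$, so the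
cocycle rule reduces every $\omega$ to the base point. -/
theorem orbitCoords_gamma_mul (ω : Orbit) (A : GL (Fin 2) ℝ) :
    orbitCoords ω (gamma ω * A) = orbitCoords baseRow A := by
  have h0 : orbAct ω (gamma ω) = baseRow := by
    have h := congrArg (fun τ => orbAct τ (gamma ω)) (orbAct_gamma_inv ω)
    simp only [← orbAct_mul, inv_mul_cancel, orbAct_one] at h
    exact h.symm
  have h1 := gamma_cocycle ω (gamma ω)
  have hb : gamma baseRow = 1 := by
    have := gamma_orbAct_inv K₀.one_mem
    rwa [inv_one, orbAct_one] at this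
  rw [h0, inv_mul_cancel, one_mul, hb] at h1
  have hu : uCoef ω (gamma ω) = 0 := by
    have := congrFun (congrFun h1 1) 0
    simpa using this.symm
  have hv : vCoef ω (gamma ω) = 1 := by
    have := congrFun (congrFun h1 1) 1
    exact Units.ext (by simpa using this.symm)
  simp only [orbitCoords, orbAct_mul, (coef_mul _ _ _).1, (coef_mul _ _ _).2, h0, hu, hv]
  simp

/-- An integrand that vanishes on singular matrices is supported in the range of `Units.val`, so the
measure of the singular set never enters. -/
theorem lintegral_comap_units {h : Matrix (Fin 2) (Fin 2) ℝ → ℝ≥0∞}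
    (hz : ∀ M : Matrix (Fin 2) (Fin 2) ℝ, M.det = 0 → h M = 0) :
    ∫⁻ A, h A.val ∂((volume : Measure (Matrix (Fin 2) (Fin 2) ℝ)).comap
      (Units.val : GL (Fin 2) ℝ → _)) = ∫⁻ M, h M := by
  rw [← measurableEmbedding_units.lintegral_map, measurableEmbedding_units.map_comap,
    ← lintegral_indicator]
  · refine lintegral_congr fun M => ?_
    by_cases hM : M.det = 0
    · simp [Set.indicator, hz M hM]
    · rw [Set.indicator_of_mem]
      exact ⟨Matrix.GeneralLinearGroup.mkOfDetNeZero M hM, rfl⟩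
  · exact measurableEmbedding_units.measurableSet_range

/-- The coordinates of a row vector in the basis `τ, τ^⊥`. -/
def rowCoords (τ σ : Fin 2 → ℝ) : ℝ × ℝ :=
  ((τ 0 * σ 0 + τ 1 * σ 1) / rowNorm τ ^ 2, (τ 0 * σ 1 - τ 1 * σ 0) / rowNorm τ ^ 2)

/-- The coordinate map is linear with determinant $\|\tau\|^{-2}$: it is $\|\tau\|^{-2}$ times a
matrix of determinant $\|\tau\|^2$. -/
theorem map_rowCoords (τ : Orbit) : (volume : Measure (Fin 2 → ℝ)).map (rowCoords τ.1) =
    ENNReal.ofReal (rowNorm τ.1 ^ 2) • volume := by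
  have hN := pow_pos (rowNorm_pos τ) 2
  let M : Matrix (Fin 2) (Fin 2) ℝ := (rowNorm τ.1 ^ 2)⁻¹ • !![τ.1 0, τ.1 1; -τ.1 1, τ.1 0]
  have hdet : M.det = (rowNorm τ.1 ^ 2)⁻¹ := by
    simp only [M, Matrix.det_smul, Matrix.det_fin_two_of, Fintype.card_fin]
    rw [show τ.1 0 * τ.1 0 - τ.1 1 * -τ.1 1 = rowNorm τ.1 ^ 2 by rw [rowNorm_sq]; ring]
    field_simp
  have h1 := Real.map_matrix_volume_pi_eq_smul_volume_pi (M := M) (by rw [hdet]; positivity)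
  have hm : Measurable (Matrix.toLin' M) :=
    (LinearMap.continuous_of_finiteDimensional _).measurable
  have hcomp : rowCoords τ.1 = MeasurableEquiv.finTwoArrow ∘ Matrix.toLin' M := by
    funext σ
    simp only [rowCoords, Function.comp, M, MeasurableEquiv.finTwoArrow, Matrix.toLin'_apply]
    ext <;> simp [dotProduct, Fin.sum_univ_two] <;> ring
  have h2 := volume_preserving_finTwoArrow ℝ
  rw [hcomp, ← Measure.map_map h2.measurable hm, h1, Measure.map_smul, h2.map_eq, hdet, inv_inv,
    abs_of_pos hN]

theorem measurable_rowCoords : Measurable fun p : (Fin 2 → ℝ) × (Fin 2 → ℝ) =>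
    rowCoords p.1 p.2 := by
  unfold rowCoords
  simp only [rowNorm_sq]
  fun_prop

theorem lintegral_quadRStar {f : ℝˣ → ℝ≥0∞} (hf : Measurable f) :
    ∫⁻ v, f v ∂quadRStar = ∫⁻ s : ℝ, ENNReal.ofReal (|s|⁻¹ ^ 2) * f (toUnit s) := by
  have hρ : Measurable fun s : ℝ => ENNReal.ofReal (|s|⁻¹ ^ 2) := by fun_prop
  have hρu : Measurable fun v : ℝˣ => ENNReal.ofReal (|(v : ℝ)|⁻¹ ^ 2) :=
    hρ.comp measurable_units_val
  have hg : Measurable fun s : ℝ => ENNReal.ofReal (|s|⁻¹ ^ 2) * f (toUnit s) :=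
    hρ.mul (hf.comp measurable_toUnit)
  rw [quadRStar, lintegral_withDensity_mul hρu hf]
  refine Eq.trans (lintegral_congr fun v => ?_) (lintegral_lebO1 hg)
  rw [toUnit_val]

theorem lintegral_prod_quadRStar {f : ℝ × ℝˣ → ℝ≥0∞} (hf : Measurable f) :
    ∫⁻ p, f p ∂((volume : Measure ℝ).prod quadRStar) =
      ∫⁻ p : ℝ × ℝ, ENNReal.ofReal (|p.2|⁻¹ ^ 2) * f (p.1, toUnit p.2) ∂(volume.prod volume) := by
  have hρ : Measurable fun s : ℝ => ENNReal.ofReal (|s|⁻¹ ^ 2) := by fun_prop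
  have hg : Measurable fun p : ℝ × ℝ => ENNReal.ofReal (|p.2|⁻¹ ^ 2) * f (p.1, toUnit p.2) :=
    (hρ.comp measurable_snd).mul
      (hf.comp (measurable_fst.prodMk (measurable_toUnit.comp measurable_snd)))
  rw [lintegral_prod _ hf.aemeasurable, lintegral_prod _ hg.aemeasurable]
  exact lintegral_congr fun u =>
    lintegral_quadRStar (hf.comp (measurable_const.prodMk measurable_id))

theorem lintegral_orbit {h : (Fin 2 → ℝ) → ℝ≥0∞} (hh : Measurable h) :
    ∫⁻ ω : Orbit, h ω.1 ∂lebO = ∫⁻ τ, h τ := by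
  rw [← map_val_lebO, lintegral_map hh measurable_subtype_coe]

/-- The image of Haar measure of `GL₂(ℝ)` in the coordinates `(ω A, (u_{ω,A}, v_{ω,A}))`. -/
theorem map_orbitCoords_baseRow : haarGL2.map (orbitCoords baseRow) =
    (lebO.withDensity fun τ => ENNReal.ofReal (rowNorm τ.1 ^ 2)⁻¹).prod
      ((volume : Measure ℝ).prod quadRStar) := by
  refine Measure.ext_of_lintegral _ fun f hf => ?_
  -- At the base point, $\omega A$ is the first row $\tau$ of $A$, and $(u,v)$ are the coordinates
  -- of the second row in the basis $\tau,\tau^\perp$. This writes the integrand as a function of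
  -- the two rows, to which Tonelli applies.
  let h : (Fin 2 → Fin 2 → ℝ) → ℝ≥0∞ := fun M =>
    ENNReal.ofReal (|M 0 0 * M 1 1 - M 0 1 * M 1 0| ^ 2)⁻¹ *
      f (toOrbit (M 0), ((rowCoords (M 0) (M 1)).1, toUnit (rowCoords (M 0) (M 1)).2))
  have hhm : Measurable h := by
    have h0 : Measurable fun M : Fin 2 → Fin 2 → ℝ => M 0 := measurable_pi_apply 0
    have h1 : Measurable fun M : Fin 2 → Fin 2 → ℝ => M 1 := measurable_pi_apply 1
    have hr : Measurable fun M : Fin 2 → Fin 2 → ℝ => rowCoords (M 0) (M 1) :=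
      measurable_rowCoords.comp (h0.prodMk h1)
    refine Measurable.mul (by fun_prop) (hf.comp ?_)
    exact (measurable_toOrbit.comp h0).prodMk
      (hr.fst.prodMk (measurable_toUnit.comp hr.snd))
  have hL : ∫⁻ p, f p ∂(haarGL2.map (orbitCoords baseRow)) = ∫⁻ M, h M := by
    have hd : Measurable fun A : GL (Fin 2) ℝ => ENNReal.ofReal (|A.val.det| ^ 2)⁻¹ :=
      ((measurable_det_GL2.abs).pow_const 2).inv.ennreal_ofReal
    have hfo : Measurable fun A => f (orbitCoords baseRow A) := hf.comp (measurable_orbitCoords _)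
    rw [lintegral_map hf (measurable_orbitCoords _), haarGL2, lintegral_withDensity_mul hd hfo]
    refine Eq.trans ?_ (lintegral_comap_units (h := h) fun M hM => ?_)
    · refine lintegral_congr fun A => ?_
      have hτ : (orbAct baseRow A).1 = A.val 0 := by
        ext j
        simp [orbAct, baseRow, Matrix.vecMul, dotProduct, Fin.sum_univ_two]
      simp only [h, Matrix.det_fin_two, orbitCoords]
      congr 2
      refine Prod.ext ?_ (Prod.ext ?_ (Units.ext ?_))
      · rw [← hτ, toOrbit_val]
      · simp [uCoef, rowCoords, rowNorm_sq, baseRow]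
      · have hne : (rowCoords (A.val 0) (A.val 1)).2 ≠ 0 := by
          have h1 := (vCoef baseRow A).ne_zero
          have h2 : (vCoef baseRow A : ℝ) = (rowCoords (A.val 0) (A.val 1)).2 := by
            simp [vCoef, rowCoords, rowNorm_sq, baseRow]
          rwa [← h2]
        rw [toUnit_of_ne hne]
        simp [vCoef, rowCoords, rowNorm_sq, baseRow]
    -- On singular matrices the density is the inverse of zero, which is zero in `ℝ`.
    · simp only [h]
      rw [Matrix.det_fin_two] at hM
      simp [hM]
  -- Here $\det A=\|\tau\|^2v$, so the Haar density is $\|\tau\|^{-4}v^{-2}$; the change of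
  -- variables in the second row contributes $\|\tau\|^2$.
  have hR : ∀ τ : Orbit, ∫⁻ σ, h ![τ.1, σ] = ENNReal.ofReal (rowNorm τ.1 ^ 2)⁻¹ *
      ∫⁻ p, f (τ, p) ∂((volume : Measure ℝ).prod quadRStar) := by
    intro τ
    have hN := pow_pos (rowNorm_pos τ) 2
    have hfτ : Measurable fun p => f (τ, p) := hf.comp (measurable_const.prodMk measurable_id)
    let G : ℝ × ℝ → ℝ≥0∞ := fun p => ENNReal.ofReal (|p.2|⁻¹ ^ 2) * f (τ, (p.1, toUnit p.2))
    have hG : Measurable G := by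
      refine Measurable.mul (by fun_prop) (hfτ.comp ?_)
      exact measurable_fst.prodMk (measurable_toUnit.comp measurable_snd)
    have hm : Measurable (rowCoords τ.1) :=
      measurable_rowCoords.comp (measurable_const.prodMk measurable_id)
    have h1 : ∀ σ, h ![τ.1, σ] =
        ENNReal.ofReal ((rowNorm τ.1 ^ 2) ^ 2)⁻¹ * G (rowCoords τ.1 σ) := by
      intro σ
      simp only [h, G, Matrix.cons_val_zero, Matrix.cons_val_one, toOrbit_val]
      rw [← mul_assoc, ← ENNReal.ofReal_mul (by positivity)]
      congr 2
      simp only [rowCoords, abs_div, abs_of_pos hN, inv_div, div_pow]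
      have := (rowNorm_pos τ).ne'
      field_simp
    simp_rw [h1]
    have hGm : Measurable fun σ => G (rowCoords τ.1 σ) := hG.comp hm
    rw [lintegral_const_mul _ hGm, ← lintegral_map hG hm, map_rowCoords,
      lintegral_smul_measure, lintegral_prod_quadRStar hfτ, ← Measure.volume_eq_prod, smul_eq_mul, ← mul_assoc,
      ← ENNReal.ofReal_mul (by positivity)]
    congr 2
    field_simp
  have e := (volume_preserving_finTwoArrow (Fin 2 → ℝ)).symm
  have hhe : Measurable fun p : (Fin 2 → ℝ) × (Fin 2 → ℝ) =>
      h (MeasurableEquiv.finTwoArrow.symm p) := hhm.comp (MeasurableEquiv.measurable _)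
  rw [hL, ← e.lintegral_comp hhm, Measure.volume_eq_prod, lintegral_prod _ hhe.aemeasurable,
    ← lintegral_orbit hhe.lintegral_prod_right', lintegral_prod _ hf.aemeasurable,
    lintegral_withDensity_mul measurable_density hf.lintegral_prod_right']
  exact lintegral_congr hR

/-- Left invariance of Haar measure under $\gamma(\omega)$ reduces to the base point; in particular
the image measure does not depend on $\omega$. -/
theorem map_orbitCoords (ω : Orbit) : haarGL2.map (orbitCoords ω) =
    (lebO.withDensity fun τ => ENNReal.ofReal (rowNorm τ.1 ^ 2)⁻¹).prod
      ((volume : Measure ℝ).prod quadRStar) := by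
  rw [← map_orbitCoords_baseRow]
  conv_lhs => rw [← (measurePreserving_mul_left_GL2 (gamma ω)).map_eq]
  rw [Measure.map_map (measurable_orbitCoords ω) (measurable_mul_left_GL2 _)]
  congr 1
  funext A
  exact orbitCoords_gamma_mul ω A

/-- The coordinates `([0, γ(ω)], (ω A, (u_{ω,A}, v_{ω,A})))` on pairs `(ω, A)`. -/
def fullCoords (p : Orbit × GL (Fin 2) ℝ) : K × (Orbit × (ℝ × ℝˣ)) :=
  (kEquiv p.1, orbitCoords p.1 p.2)

theorem measurable_fullCoords : Measurable fullCoords :=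
  (kEquiv.measurable.comp measurable_fst).prodMk measurable_orbitCoords_prod

/-- The invertible matrix with rows `(1, 0)` and `(u, v)`. -/
def lowerTri (u : ℝ) (v : ℝˣ) : GL (Fin 2) ℝ :=
  Matrix.GeneralLinearGroup.mkOfDetNeZero !![1, 0; u, (v : ℝ)] (by simp)

theorem lowerTri_val (u : ℝ) (v : ℝˣ) : (lowerTri u v).val = !![1, 0; u, (v : ℝ)] := rfl

/-- The inverse of `fullCoords`. -/
def fullCoordsInv (q : K × (Orbit × (ℝ × ℝˣ))) : Orbit × GL (Fin 2) ℝ :=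
  (kEquiv.symm q.1,
    gamma (kEquiv.symm q.1) * lowerTri q.2.2.1 q.2.2.2 * (gamma q.2.1)⁻¹)

/-- This is the cocycle identity solved for $A$. -/
theorem fullCoordsInv_fullCoords (p : Orbit × GL (Fin 2) ℝ) :
    fullCoordsInv (fullCoords p) = p := by
  have h : lowerTri (uCoef p.1 p.2) (vCoef p.1 p.2) =
      (gamma p.1)⁻¹ * p.2 * gamma (orbAct p.1 p.2) :=
    Units.ext (gamma_cocycle p.1 p.2).symm
  simp only [fullCoordsInv, fullCoords, orbitCoords, MeasurableEquiv.symm_apply_apply, h]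
  refine Prod.ext rfl ?_
  simp only
  group

theorem measurable_fullCoordsInv : Measurable fullCoordsInv := by
  have h1 : Measurable fun q : K × (Orbit × (ℝ × ℝˣ)) => kEquiv.symm q.1 :=
    kEquiv.symm.measurable.comp measurable_fst
  refine h1.prodMk (measurable_GL2_mul (measurable_GL2_mul (measurable_gamma.comp h1) ?_)
    (measurable_inv_GL2.comp (measurable_gamma.comp measurable_snd.fst)))
  refine measurable_GL2_of_entries fun i j => ?_
  simp only [lowerTri_val]
  fin_cases i <;> fin_cases j
  · exact measurable_const
  · exact measurable_const
  · exact measurable_snd.snd.fst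
  · exact measurable_units_val.comp measurable_snd.snd.snd

/-- The weight `|det A|^{1/2} ‖ω A‖ / ‖ω‖`. -/
def coordWeight (p : Orbit × GL (Fin 2) ℝ) : ℝ :=
  √|p.2.val.det| * rowNorm (orbAct p.1 p.2).1 / rowNorm p.1.1

theorem coordWeight_pos (p : Orbit × GL (Fin 2) ℝ) : 0 < coordWeight p :=
  div_pos (mul_pos (Real.sqrt_pos.2 (abs_pos.2 (det_ne_zero_GL2 _))) (rowNorm_pos _))
    (rowNorm_pos _)

theorem measurable_coordWeight : Measurable coordWeight := by
  have h1 := (measurable_det_GL2.comp (measurable_snd (α := Orbit))).abs.sqrt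
  exact (h1.mul (measurable_rowNorm.comp measurable_orbAct_prod)).div
    (measurable_rowNorm.comp measurable_fst)

/-- In the squared weight $|\det A|\,\|\omega A\|^2/\|\omega\|^2$, the determinant reduces $dA/|\det
A|^3$ to Haar measure, $\|\omega\|^{-2}$ supplies the Haar density of $K$, and $\|\omega A\|^2$
cancels the density $\|\tau\|^{-2}$ of `map_orbitCoords`. -/
theorem map_fullCoords : ((lebO.prod cubeGL2).withDensity fun p =>
    ENNReal.ofReal (coordWeight p ^ 2)).map fullCoords =
      haarK.prod (lebO.prod ((volume : Measure ℝ).prod quadRStar)) := by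
  have hw : Measurable fun p => ENNReal.ofReal (coordWeight p ^ 2) :=
    (measurable_coordWeight.pow_const 2).ennreal_ofReal
  refine Measure.ext_of_lintegral _ fun f hf => ?_
  have hfc : Measurable fun p => f (fullCoords p) := hf.comp measurable_fullCoords
  have hwf : Measurable fun p => ENNReal.ofReal (coordWeight p ^ 2) * f (fullCoords p) :=
    hw.mul hfc
  rw [lintegral_map hf measurable_fullCoords, lintegral_withDensity_mul hw hfc,
    lintegral_prod _ hwf.aemeasurable, lintegral_prod _ hf.aemeasurable, lintegral_haarK]
  refine lintegral_congr fun ω => ?_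
  have hfω : Measurable fun q => f (kEquiv ω, q) := hf.comp (measurable_const.prodMk measurable_id)
  have hd : Measurable fun A : GL (Fin 2) ℝ => ENNReal.ofReal (|A.val.det|)⁻¹ :=
    (measurable_det_GL2.abs).inv.ennreal_ofReal
  have hn : Measurable fun q : Orbit × (ℝ × ℝˣ) => ENNReal.ofReal (rowNorm q.1.1 ^ 2) :=
    ((measurable_rowNorm.comp measurable_fst).pow_const 2).ennreal_ofReal
  have hin : Measurable fun A : GL (Fin 2) ℝ =>
      ENNReal.ofReal (coordWeight (ω, A) ^ 2) * f (fullCoords (ω, A)) :=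
    (hw.mul hfc).comp (measurable_const.prodMk measurable_id)
  have hprod : (lebO.withDensity fun τ : Orbit => ENNReal.ofReal (rowNorm τ.1 ^ 2)⁻¹).prod
      ((volume : Measure ℝ).prod quadRStar) =
      (lebO.prod ((volume : Measure ℝ).prod quadRStar)).withDensity
        fun q => ENNReal.ofReal (rowNorm q.1.1 ^ 2)⁻¹ := by
    rw [prod_withDensity_left measurable_density]
  rw [cubeGL2, lintegral_withDensity_mul hd hin]
  have h1 : ∀ A : GL (Fin 2) ℝ, ENNReal.ofReal (|A.val.det|)⁻¹ *
      (ENNReal.ofReal (coordWeight (ω, A) ^ 2) * f (fullCoords (ω, A))) =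
      ENNReal.ofReal (rowNorm ω.1 ^ 2)⁻¹ * ((fun q : Orbit × (ℝ × ℝˣ) =>
        ENNReal.ofReal (rowNorm q.1.1 ^ 2) * f (kEquiv ω, q)) (orbitCoords ω A)) := by
    intro A
    have hA := abs_pos.2 (det_ne_zero_GL2 A)
    have h2 := rowNorm_pos ω
    simp only
    rw [← mul_assoc, ← mul_assoc, ← ENNReal.ofReal_mul (by positivity),
      ← ENNReal.ofReal_mul (by positivity)]
    congr 2
    simp only [coordWeight, orbitCoords, div_pow, mul_pow, Real.sq_sqrt hA.le]
    field_simp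
  have hnf : Measurable fun q : Orbit × (ℝ × ℝˣ) =>
      ENNReal.ofReal (rowNorm q.1.1 ^ 2) * f (kEquiv ω, q) := hn.mul hfω
  have hd2 : Measurable fun q : Orbit × (ℝ × ℝˣ) => ENNReal.ofReal (rowNorm q.1.1 ^ 2)⁻¹ :=
    measurable_density.comp measurable_fst
  have hnfo : Measurable fun A => (fun q : Orbit × (ℝ × ℝˣ) =>
      ENNReal.ofReal (rowNorm q.1.1 ^ 2) * f (kEquiv ω, q)) (orbitCoords ω A) :=
    hnf.comp (measurable_orbitCoords ω)
  rw [lintegral_congr h1, lintegral_const_mul _ hnfo,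
    ← lintegral_map hnf (measurable_orbitCoords ω), map_orbitCoords, hprod,
    lintegral_withDensity_mul hd2 hnf]
  congr 1
  refine lintegral_congr fun q => ?_
  have h2 := rowNorm_pos q.1
  rw [← mul_assoc, ← ENNReal.ofReal_mul (by positivity), inv_mul_cancel₀ (by positivity),
    ENNReal.ofReal_one, one_mul]

/-! ### Complex conjugation on $L^2$ -/

section Star

variable {X : Type*} [MeasurableSpace X] {μ : Measure X}

/-- Conjugation is antiunitary. It enters because the matrix coefficients depend on $g$
conjugate-linearly, so $\bar g$ is the tensor factor. -/
theorem inner_star_star (a b : Lp ℂ 2 μ) : inner ℂ (star a) (star b) = inner ℂ b a := by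
  rw [L2.inner_def, L2.inner_def]
  refine integral_congr_ae ?_
  filter_upwards [Lp.coeFn_star a, Lp.coeFn_star b] with x h1 h2
  rw [h1, h2, Pi.star_apply, Pi.star_apply, RCLike.inner_apply, RCLike.inner_apply]
  simp [mul_comm]

theorem total_star {ι : Type*} {e : ι → Lp ℂ 2 μ} (he : TotalFamily e) :
    TotalFamily fun i => star (e i) := by
  rw [total_iff]
  intro x hx
  have h : star x = 0 := he.eq_zero fun i => by
    have := hx i
    rw [← star_star x, inner_star_star] at this
    rw [← inner_conj_symm, this, map_zero]
  have h2 := congrArg (fun z : Lp ℂ 2 μ => inner ℂ (star z) (star z)) h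
  simp only [inner_star_star, star_star] at h2
  rw [inner_zero_left] at h2
  exact inner_self_eq_zero.1 h2

end Star

/-! ### Matrix coefficients of the affine group of the line -/

theorem conj_phase (s : ℝ) : conj (phase s) = phase (-s) := by
  rw [phase, phase, ← Complex.exp_conj]
  congr 1
  simp [map_ofNat]

theorem integral_haarRStar (f : ℝˣ → ℂ) :
    ∫ t, f t ∂haarRStar = ∫ t : ℝˣ, ((|(t : ℝ)|⁻¹ : ℝ) : ℂ) * f t ∂lebO1 := by
  have hd : Measurable fun t : ℝˣ => ENNReal.ofReal |(t : ℝ)|⁻¹ :=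
    measurable_units_val.abs.inv.ennreal_ofReal
  rw [haarRStar, integral_withDensity_eq_integral_toReal_smul hd
      (Filter.Eventually.of_forall fun _ => ENNReal.ofReal_lt_top)]
  refine integral_congr_ae (Filter.Eventually.of_forall fun x => ?_)
  simp only
  rw [ENNReal.toReal_ofReal (by positivity), Complex.real_smul]

theorem integrable_haarRStar_iff {f : ℝˣ → ℂ} : Integrable f haarRStar ↔
    Integrable (fun t : ℝˣ => ((|(t : ℝ)|⁻¹ : ℝ) : ℂ) * f t) lebO1 := by
  have hd : Measurable fun t : ℝˣ => ENNReal.ofReal |(t : ℝ)|⁻¹ :=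
    measurable_units_val.abs.inv.ennreal_ofReal
  rw [haarRStar, integrable_withDensity_iff_integrable_smul' hd
      (Filter.Eventually.of_forall fun _ => ENNReal.ofReal_lt_top)]
  refine integrable_congr (Filter.Eventually.of_forall fun x => ?_)
  simp only
  rw [ENNReal.toReal_ofReal (by positivity), Complex.real_smul]

theorem integral_haarK (f : K → ℂ) :
    ∫ k, f k ∂haarK = ∫ ω : Orbit, (((rowNorm ω.1 ^ 2)⁻¹ : ℝ) : ℂ) * f (kEquiv ω) ∂lebO := by
  rw [haarK, integral_map_equiv, integral_withDensity_eq_integral_toReal_smul measurable_density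
      (Filter.Eventually.of_forall fun _ => ENNReal.ofReal_lt_top)]
  refine integral_congr_ae (Filter.Eventually.of_forall fun x => ?_)
  simp only
  rw [ENNReal.toReal_ofReal (by positivity), Complex.real_smul]

/-- The matrix coefficient `⟨φ, piOne u v g⟩`. -/
def lineCoeff (φ : L2RStar) {g : L2O1} (hg : MemLp g 2 haarRStar) (p : ℝ × ℝˣ) : ℂ :=
  inner ℂ (piOne p.1 p.2 (hg.toLp g)) φ

theorem continuous_lineCoeff (φ : L2RStar) {g : L2O1} (hg : MemLp g 2 haarRStar) :
    Continuous (lineCoeff φ hg) := by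
  have h : Continuous fun p : ℝ × ℝˣ => piOne p.1 p.2 (hg.toLp g) :=
    (continuous_piOne.comp (continuous_id.prodMk continuous_const) :)
  exact h.inner continuous_const

theorem norm_lineCoeff_le (φ : L2RStar) {g : L2O1} (hg : MemLp g 2 haarRStar) (p : ℝ × ℝˣ) :
    ‖lineCoeff φ hg p‖ ≤ ‖hg.toLp g‖ * ‖φ‖ :=
  (norm_inner_le_norm _ _).trans (by rw [LinearIsometry.norm_map])

theorem lineCoeff_eq (φ : L2RStar) {g : L2O1} (hg : MemLp g 2 haarRStar) (p : ℝ × ℝˣ) :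
    lineCoeff φ hg p =
      ∫ t : ℝˣ, phase (-(p.1 * (t : ℝ)⁻¹)) * (φ t * conj (g (t / p.2))) ∂haarRStar := by
  rw [lineCoeff, L2.inner_def]
  refine integral_congr_ae ?_
  filter_upwards [piOne_apply p.1 p.2 (hg.toLp g),
    (measurePreserving_mul_left_RStar p.2⁻¹).quasiMeasurePreserving.ae hg.coeFn_toLp] with t h1 h2
  rw [h1, h2, RCLike.inner_apply, map_mul, conj_phase, div_eq_inv_mul, mul_comm p.1]
  ring

/-- With $g\in L^2(\mathbb R^*)$ both factors are square integrable for Haar measure, by invariance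
under multiplication. So every slice in $t$ lies in the class where the Fourier transform is an
absolutely convergent integral. -/
theorem integrable_mul_conj (φ : L2RStar) {g : L2O1} (hg : MemLp g 2 haarRStar) (v : ℝˣ) :
    Integrable (fun t => φ t * conj (g (t / v))) haarRStar := by
  have h1 : MemLp (fun t => g (t / v)) 2 haarRStar := by
    have := hg.comp_measurePreserving (measurePreserving_mul_left_RStar v⁻¹)
    simpa only [Function.comp_def, ← div_eq_inv_mul] using this
  exact (Lp.memLp φ).integrable_mul h1.star

/-- The matrix coefficients of the affine group of the line give a unitary operator. -/
theorem exists_line_unitary :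
    ∃ Q : Lp ℂ 2 (haarRStar.prod lebO1) ≃ₗᵢ[ℂ] Lp ℂ 2 ((volume : Measure ℝ).prod quadRStar),
      ∀ (φ : L2RStar) (g : L2O1) (hg : MemLp g 2 haarRStar),
        Q (tensor φ (star g)) =ᵐ[(volume : Measure ℝ).prod quadRStar] lineCoeff φ hg := by
  have hn : Measurable fun p : ℝˣ × ℝˣ => (p.1, p.1 / p.2) :=
    measurable_fst.prodMk (measurable_fst.div measurable_snd)
  -- The map $(t,v)\mapsto(t,t/v)$ is an involution, so it serves as its own inverse.
  obtain ⟨M, hM, -⟩ := exists_weighted_pullback (μ := lebO1.prod quadRStar)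
    (ν := haarRStar.prod lebO1) hn hn (fun p => by simp) (ρ := fun _ => 1)
    measurable_const (fun _ => one_pos) (by
      simp only [one_pow, ENNReal.ofReal_one]
      rw [← Pi.one_def, withDensity_one, map_divSnd])
  obtain ⟨U, hU⟩ := exists_lineFourier
  obtain ⟨P, hP⟩ := exists_tensor_unitary U quadRStar
  refine ⟨M.trans P, fun φ g hg => ?_⟩
  have hφ := (Lp.stronglyMeasurable φ).measurable
  have hgm := (Lp.stronglyMeasurable g).measurable
  let f : ℝˣ × ℝˣ → ℂ := fun p => φ p.1 * conj (g p.2)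
  let k : ℝˣ × ℝˣ → ℂ := fun p => φ p.1 * conj (g (p.1 / p.2))
  have hft : tensor φ (star g) =ᵐ[haarRStar.prod lebO1] f := by
    filter_upwards [tensor_apply φ (star g),
      Measure.quasiMeasurePreserving_snd.ae (Lp.coeFn_star g)] with p h1 h2
    rw [h1, h2]; rfl
  have hf : MemLp f 2 (haarRStar.prod lebO1) := (memLp_congr_ae hft).1 (Lp.memLp _)
  have hft2 : tensor φ (star g) = hf.toLp f := Lp.ext (hft.trans hf.coeFn_toLp.symm)
  have hkf : M (hf.toLp f) =ᵐ[lebO1.prod quadRStar] k := by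
    filter_upwards [hM f hf] with p hp
    rw [hp, Complex.ofReal_one, one_mul]
  have hk : MemLp k 2 (lebO1.prod quadRStar) := (memLp_congr_ae hkf).1 (Lp.memLp _)
  have hkf2 : M (hf.toLp f) = hk.toLp k := Lp.ext (hkf.trans hk.coeFn_toLp.symm)
  have hkm : Measurable k := (hφ.comp measurable_fst).mul
    (Complex.continuous_conj.measurable.comp
      (hgm.comp (measurable_fst.div measurable_snd)))
  have hκ : Measurable fun p : ℝ × ℝˣ =>
      phase (-(p.1 * (p.2 : ℝ)⁻¹)) * ((|(p.2 : ℝ)|⁻¹ : ℝ) : ℂ) :=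
    (continuous_phase.measurable.comp
      (measurable_fst.mul (measurable_units_val.comp measurable_snd).inv).neg).mul
      (Complex.measurable_ofReal.comp (measurable_units_val.comp measurable_snd).abs.inv)
  have hmain := partial_unitary_apply hP
    (κ := fun (u : ℝ) (t : ℝˣ) => phase (-(u * (t : ℝ)⁻¹)) * ((|(t : ℝ)|⁻¹ : ℝ) : ℂ)) hκ
    hU hkm hk (Filter.Eventually.of_forall fun v =>
      integrable_haarRStar_iff.1 (integrable_mul_conj φ hg v))
  rw [LinearIsometryEquiv.trans_apply, hft2, hkf2]
  filter_upwards [hmain] with p hp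
  rw [hp, lineCoeff_eq, integral_haarRStar]
  refine integral_congr_ae (Filter.Eventually.of_forall fun t => ?_)
  simp only [k]
  ring

/-! ### The partial Fourier transform onto $L^2(G_2)$ -/

theorem map_equivProd_haarG2 :
    haarG2.map G2.equivProd = (volume : Measure (Fin 2 → ℝ)).prod cubeGL2 := by
  rw [haarG2, Measure.map_map G2.measurable_equivProd G2.measurable_equivProd_symm]
  simp only [Equiv.self_comp_symm, Measure.map_id]
  rfl

theorem memLp_orbAct {f : Orbit → ℂ} (hf : MemLp f 2 lebO) (A : GL (Fin 2) ℝ) :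
    MemLp (fun ω => f (orbAct ω A)) 2 lebO := by
  refine memLp_two_iff_lintegral.2 ⟨hf.1.comp_quasiMeasurePreserving (qmp_orbAct A), ?_⟩
  rw [lintegral_orbAct A fun ω => ‖f ω‖ₑ ^ 2]
  exact ENNReal.mul_lt_top ENNReal.ofReal_lt_top (memLp_two_iff_lintegral.1 hf).2

theorem memLp_kEquiv (α : Lp ℂ 2 haarK) :
    MemLp (fun ω : Orbit => (((rowNorm ω.1)⁻¹ : ℝ) : ℂ) * α (kEquiv ω)) 2 lebO := by
  refine memLp_two_iff_lintegral.2 ⟨?_, ?_⟩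
  · exact (Complex.measurable_ofReal.comp measurable_rowNorm.inv).aestronglyMeasurable.mul
      ((Lp.aestronglyMeasurable α).comp_quasiMeasurePreserving qmp_kEquiv)
  · have h := (memLp_two_iff_lintegral.1 (Lp.memLp α)).2
    rw [lintegral_haarK] at h
    refine (lintegral_congr fun ω => ?_).trans_lt h
    rw [enorm_ofReal_mul_sq, inv_pow]

/-- For fixed $A$ the weight splits as $|\det A|^{1/2}\cdot\|\omega\|^{-1}\cdot\|\omega A\|$. The
second factor makes $\alpha$ square integrable for Lebesgue measure, the third is absorbed by the
moment condition on $\eta$, and $w$ is bounded; Cauchy–Schwarz does the rest. -/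
theorem integrable_coord (α : Lp ℂ 2 haarK) (η : L2O)
    (hη : MemLp (fun ω : Orbit => (rowNorm ω.1 : ℂ) * η ω) 2 lebO) {w : ℝ × ℝˣ → ℂ}
    (hw : Measurable w) {C : ℝ} (hC : ∀ p, ‖w p‖ ≤ C) (A : GL (Fin 2) ℝ) :
    Integrable (fun ω => (coordWeight (ω, A) : ℂ) *
      (α (kEquiv ω) * (η (orbAct ω A) * w (uCoef ω A, vCoef ω A)))) lebO := by
  have h1 := (memLp_kEquiv α).integrable_mul (memLp_orbAct hη A)
  have hwm : Measurable fun ω : Orbit => w (uCoef ω A, vCoef ω A) :=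
    hw.comp ((measurable_orbitCoords_prod.snd).comp (measurable_id.prodMk measurable_const))
  have h2 := (h1.bdd_mul (c := C) hwm.aestronglyMeasurable
    (Filter.Eventually.of_forall fun ω => hC _)).const_mul ((√|A.val.det| : ℝ) : ℂ)
  refine h2.congr (Filter.Eventually.of_forall fun ω => ?_)
  simp only [coordWeight, Pi.mul_apply]
  push_cast
  ring

/-- The partial Fourier transform in the coordinates of `fullCoords`, as a unitary operator
onto `L²(G2)`. -/
theorem exists_plane_unitary :
    ∃ Z : Lp ℂ 2 (haarK.prod (lebO.prod ((volume : Measure ℝ).prod quadRStar))) ≃ₗᵢ[ℂ] L2G2,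
      ∀ (α : Lp ℂ 2 haarK) (η : L2O)
        (_ : MemLp (fun ω : Orbit => (rowNorm ω.1 : ℂ) * η ω) 2 lebO)
        (b : Lp ℂ 2 ((volume : Measure ℝ).prod quadRStar)) (w : ℝ × ℝˣ → ℂ) (_ : Measurable w)
        (C : ℝ) (_ : ∀ p, ‖w p‖ ≤ C) (_ : b =ᵐ[(volume : Measure ℝ).prod quadRStar] w),
        Z (tensor α (tensor η b)) =ᵐ[haarG2] fun g => ∫ ω, phase (-(ω.1 ⬝ᵥ g.trans)) *
          ((coordWeight (ω, g.lin) : ℂ) * (α (kEquiv ω) *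
            (η (orbAct ω g.lin) * w (uCoef ω g.lin, vCoef ω g.lin)))) ∂lebO := by
  obtain ⟨M, hM, -⟩ := exists_weighted_pullback measurable_fullCoords measurable_fullCoordsInv
    fullCoordsInv_fullCoords measurable_coordWeight coordWeight_pos map_fullCoords
  obtain ⟨U, hU⟩ := exists_planeFourier
  obtain ⟨P, hP⟩ := exists_tensor_unitary U cubeGL2
  obtain ⟨T, hT, -⟩ := exists_weighted_pullback (μ := haarG2)
    (ν := (volume : Measure (Fin 2 → ℝ)).prod cubeGL2) G2.measurable_equivProd
    G2.measurable_equivProd_symm (fun _ => rfl) (ρ := fun _ => 1)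
    measurable_const (fun _ => one_pos) (by
      simp only [one_pow, ENNReal.ofReal_one]
      rw [← Pi.one_def, withDensity_one, map_equivProd_haarG2])
  have hqE : Measure.QuasiMeasurePreserving G2.equivProd haarG2
      ((volume : Measure (Fin 2 → ℝ)).prod cubeGL2) :=
    ⟨G2.measurable_equivProd, by rw [map_equivProd_haarG2]⟩
  refine ⟨(M.trans P).trans T, fun α η hη b w hw C hC hbw => ?_⟩
  -- The class `b` is replaced by its representative `w`, measurable and bounded everywhere, so that
  -- the slices of `k` are integrable for every $A$ and the resulting formula involves `w` itself.
  let f : K × (Orbit × (ℝ × ℝˣ)) → ℂ := fun q => α q.1 * (η q.2.1 * w q.2.2)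
  let k : Orbit × GL (Fin 2) ℝ → ℂ := fun p => (coordWeight p : ℂ) *
    (α (kEquiv p.1) * (η (orbAct p.1 p.2) * w (uCoef p.1 p.2, vCoef p.1 p.2)))
  have hft : tensor α (tensor η b) =ᵐ[haarK.prod (lebO.prod ((volume : Measure ℝ).prod quadRStar))]
      f := by
    filter_upwards [tensor_apply α (tensor η b),
      Measure.quasiMeasurePreserving_snd.ae (tensor_apply η b),
      Measure.quasiMeasurePreserving_snd.ae (Measure.quasiMeasurePreserving_snd.ae hbw)]
      with q h1 h2 h3
    rw [h1, h2, h3]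
  have hf := (memLp_congr_ae hft).1 (Lp.memLp _)
  have hft2 : tensor α (tensor η b) = hf.toLp f := Lp.ext (hft.trans hf.coeFn_toLp.symm)
  have hk : MemLp k 2 (lebO.prod cubeGL2) := (memLp_congr_ae (hM f hf)).1 (Lp.memLp _)
  have hkf : M (hf.toLp f) = hk.toLp k := Lp.ext ((hM f hf).trans hk.coeFn_toLp.symm)
  have hkm : Measurable k := by
    have h1 : Measurable fun p : Orbit × GL (Fin 2) ℝ => α (kEquiv p.1) :=
      (Lp.stronglyMeasurable α).measurable.comp (kEquiv.measurable.comp measurable_fst)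
    have h2 : Measurable fun p : Orbit × GL (Fin 2) ℝ => η (orbAct p.1 p.2) :=
      (Lp.stronglyMeasurable η).measurable.comp measurable_orbAct_prod
    have h3 : Measurable fun p : Orbit × GL (Fin 2) ℝ => w (uCoef p.1 p.2, vCoef p.1 p.2) :=
      hw.comp (measurable_uCoef.prodMk measurable_vCoef)
    exact (Complex.measurable_ofReal.comp measurable_coordWeight).mul (h1.mul (h2.mul h3))
  have hκ : Measurable fun p : (Fin 2 → ℝ) × Orbit => phase (-(p.2.1 ⬝ᵥ p.1)) := by
    refine continuous_phase.measurable.comp (Measurable.neg ?_)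
    simp only [dotProduct, Fin.sum_univ_two]
    have hx : ∀ i, Measurable fun p : (Fin 2 → ℝ) × Orbit => p.1 i := fun i =>
      (measurable_pi_apply i).comp measurable_fst
    have hω : ∀ i, Measurable fun p : (Fin 2 → ℝ) × Orbit => p.2.1 i := fun i =>
      (measurable_coord i).comp measurable_snd
    exact ((hω 0).mul (hx 0)).add ((hω 1).mul (hx 1))
  have hmain := partial_unitary_apply hP (κ := fun x (ω : Orbit) => phase (-(ω.1 ⬝ᵥ x))) hκ
    (good := fun f => Integrable f lebO) hU hkm hk
    (Filter.Eventually.of_forall fun A => integrable_coord α η hη hw hC A)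
  have h1 := hT _ (Lp.memLp (P (hk.toLp k)))
  rw [Lp.toLp_coeFn] at h1
  rw [LinearIsometryEquiv.trans_apply, LinearIsometryEquiv.trans_apply, hft2, hkf]
  filter_upwards [h1, hqE.ae hmain] with g h2 h3
  rw [h2, h3, Complex.ofReal_one, one_mul]
  rfl

/-! ### Elementary vectors in $L^2$ with Hilbert space values -/

section SmulVec

variable {X H : Type*} [MeasurableSpace X] {μ : Measure X} [NormedAddCommGroup H]
  [InnerProductSpace ℂ H]

/-- The function `x ↦ α x • φ` in `L²(μ, H)`. -/
def smulVec (α : Lp ℂ 2 μ) (φ : H) : Lp H 2 μ :=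
  (ContinuousLinearMap.toSpanSingleton ℂ φ).compLp α

theorem smulVec_apply (α : Lp ℂ 2 μ) (φ : H) : smulVec α φ =ᵐ[μ] fun x => α x • φ := by
  filter_upwards [(ContinuousLinearMap.toSpanSingleton ℂ φ).coeFn_compLp α] with x hx
  rw [smulVec, hx, ContinuousLinearMap.toSpanSingleton_apply]

theorem inner_smulVec (α α' : Lp ℂ 2 μ) (φ φ' : H) :
    inner ℂ (smulVec α φ) (smulVec α' φ') = inner ℂ α α' * inner ℂ φ φ' := by
  rw [L2.inner_def, L2.inner_def, ← integral_mul_const]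
  refine integral_congr_ae ?_
  filter_upwards [smulVec_apply α φ, smulVec_apply α' φ'] with x h1 h2
  rw [h1, h2, inner_smul_left, inner_smul_right, RCLike.inner_apply]
  ring

/-- Vector-valued simple functions are dense, and a constant on a set of finite measure is an
indicator times a vector. -/
theorem total_smulVec : TotalFamily fun p : Lp ℂ 2 μ × H => smulVec p.1 p.2 := by
  intro f
  rw [← Submodule.topologicalClosure_coe, SetLike.mem_coe]
  induction f using Lp.induction (by simp : (2 : ℝ≥0∞) ≠ ∞) with
  | @indicatorConst c s hs hμs =>
    refine Submodule.le_topologicalClosure _ (Submodule.subset_span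
      ⟨(indicatorConstLp 2 hs hμs.ne 1, c), Lp.ext ?_⟩)
    rw [Lp.simpleFunc.coe_indicatorConst]
    filter_upwards [smulVec_apply (indicatorConstLp 2 hs hμs.ne (1 : ℂ)) c,
      indicatorConstLp_coeFn (p := 2) (hs := hs) (hμs := hμs.ne) (c := (1 : ℂ)),
      indicatorConstLp_coeFn (p := 2) (hs := hs) (hμs := hμs.ne) (c := c)] with x h1 h2 h3
    rw [h1, h2, h3]
    by_cases hx : x ∈ s <;> simp [Set.indicator, hx]
  | add hf hg _ h1 h2 => exact Submodule.add_mem _ h1 h2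
  | isClosed => exact Submodule.isClosed_topologicalClosure _

end SmulVec

/-! ### Coefficient functions of $\sigma$ -/

theorem det_gamma (ω : Orbit) : (gamma ω).val.det = (rowNorm ω.1 ^ 2)⁻¹ := by
  have h := (rowNorm_pos ω).ne'
  rw [gamma_val, Matrix.det_smul, Matrix.det_fin_two_of, Fintype.card_fin]
  have : ω.1 0 * ω.1 0 - -ω.1 1 * ω.1 1 = rowNorm ω.1 ^ 2 := by rw [rowNorm_sq]; ring
  rw [this]
  field_simp

theorem eFun_kEquiv (η : L2O) {g : L2O1} (hg : MemLp g 2 haarRStar) (ω : Orbit) :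
    eFun η hg (kEquiv ω) = (conj (η ω) * ((rowNorm ω.1 ^ 2 : ℝ) : ℂ)) • hg.toLp g := by
  have h1 : orbAct baseRow ((kEquiv ω).1.lin)⁻¹ = ω := kEquiv.symm_apply_apply ω
  have h2 : (kEquiv ω).1.lin.val.det = (rowNorm ω.1 ^ 2)⁻¹ := det_gamma ω
  have := rowNorm_pos ω
  rw [eFun, h1, h2, abs_of_pos (by positivity)]
  congr 1
  push_cast
  rw [div_inv_eq_mul]

/-- On elementary vectors the fibre inner product is a scalar times a matrix coefficient on the
line, which leaves a single integral over the orbit of the form produced by `exists_plane_unitary`.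
-/
theorem coeffFun_smulVec (η : L2O)
    (hη : MemLp (fun ω : Orbit => (rowNorm ω.1 : ℂ) * η ω) 2 lebO) {g : L2O1}
    (hg : MemLp g 2 haarRStar) (α : Lp ℂ 2 haarK) (φ : L2RStar) (x : G2) :
    coeffFun (eVec η hη hg) (smulVec α φ) x = ∫ ω, phase (-(ω.1 ⬝ᵥ x.trans)) *
      ((coordWeight (ω, x.lin) : ℂ) * (α (kEquiv ω) *
        (η (orbAct ω x.lin) * lineCoeff φ hg (uCoef ω x.lin, vCoef ω x.lin)))) ∂lebO := by
  have h1 : coeffFun (eVec η hη hg) (smulVec α φ) x =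
      ∫ k, inner ℂ (sigmaFun x (eFun η hg) k) (α k • φ) ∂haarK := by
    rw [coeffFun, L2.inner_def]
    refine integral_congr_ae ?_
    filter_upwards [sigma_apply x (eVec η hη hg), sigmaFun_congr x (memLp_eFun η hη hg).coeFn_toLp,
      smulVec_apply α φ] with k h1 h2 h3
    rw [h1, h3]
    congr 1
  rw [h1, integral_haarK]
  refine integral_congr_ae (Filter.Eventually.of_forall fun ω => ?_)
  have hω := (rowNorm_pos ω).ne'
  have hωA := (rowNorm_pos (orbAct ω x.lin)).ne'
  -- The three factors come from the Haar density of $K$, from $\sigma$, and from $1/|\det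
  -- L|=\|\omega A\|^2$ at $L=\gamma(\omega A)$; together they are the Jacobian weight.
  have hr : (rowNorm ω.1 ^ 2)⁻¹ * sigmaFactor ω x.lin * rowNorm (orbAct ω x.lin).1 ^ 2 =
      coordWeight (ω, x.lin) := by
    simp only [sigmaFactor, coordWeight]
    field_simp
  simp only [sigmaFun, MeasurableEquiv.symm_apply_apply, eFun_kEquiv, map_smul, inner_smul_left,
    inner_smul_right, map_mul, conj_phase, Complex.conj_conj, Complex.conj_ofReal, lineCoeff, ← hr]
  push_cast
  ring

/-- For approximants $u_n\to F$ in the span, $Vu_n\to VF$ in $L^2$, hence a.e. along a subsequence,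
while the coefficient functions converge at every point by continuity of the inner product. The two
limits coincide. -/
theorem ae_eq_coeffFun_of_total {ι : Type*} {e : ι → HSigma} (he : TotalFamily e) (E : HSigma)
    (V : HSigma →L[ℂ] L2G2) (h : ∀ i, V (e i) =ᵐ[haarG2] coeffFun E (e i)) (F : HSigma) :
    V F =ᵐ[haarG2] coeffFun E F := by
  obtain ⟨u, hu, hlim⟩ := mem_closure_iff_seq_limit.1 (he F)
  have hspan : ∀ F' ∈ Submodule.span ℂ (Set.range e), V F' =ᵐ[haarG2] coeffFun E F' := by
    intro F' hF'
    induction hF' using Submodule.span_induction with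
    | mem v hv => obtain ⟨i, rfl⟩ := hv; exact h i
    | zero =>
      rw [map_zero]
      filter_upwards [Lp.coeFn_zero ℂ 2 haarG2] with x hx
      rw [hx]; simp [coeffFun]
    | add v w _ _ hv hw =>
      rw [map_add]
      filter_upwards [Lp.coeFn_add (V v) (V w), hv, hw] with x h1 h2 h3
      rw [h1, Pi.add_apply, h2, h3]
      simp [coeffFun, inner_add_right]
    | smul c v _ hv =>
      rw [map_smul]
      filter_upwards [Lp.coeFn_smul c (V v), hv] with x h1 h2
      rw [h1, Pi.smul_apply, h2]
      simp [coeffFun, inner_smul_right]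
  have hV : Filter.Tendsto (fun n => V (u n)) Filter.atTop (nhds (V F)) :=
    (V.continuous.tendsto F).comp hlim
  obtain ⟨ns, hns, hae⟩ := (tendstoInMeasure_of_tendsto_Lp hV).exists_seq_tendsto_ae
  have hall : ∀ᵐ x ∂haarG2, ∀ n, V (u n) x = coeffFun E (u n) x :=
    ae_all_iff.2 fun n => hspan _ (hu n)
  filter_upwards [hae, hall] with x h1 h2
  have h3 : Filter.Tendsto (fun n => coeffFun E (u (ns n)) x) Filter.atTop
      (nhds (coeffFun E F x)) := by
    have hc : Continuous fun F' : HSigma => coeffFun E F' x := by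
      unfold coeffFun
      fun_prop
    exact (hc.tendsto F).comp (hlim.comp hns.tendsto_atTop)
  simp only [h2] at h1
  exact tendsto_nhds_unique h1 h3

/-- Unitarity moves $\sigma(x)$ to the other side of the inner product as $\sigma(x^{-1})$; this
holds for every vector $E$ and yields both invariance and intertwining. -/
theorem coeffFun_sigma (E F : HSigma) (x h : G2) :
    coeffFun E (sigma x F) h = coeffFun E F (x⁻¹ * h) := by
  rw [coeffFun, coeffFun, map_mul, map_inv, ← (sigma x).inner_map_map (((sigma x)⁻¹ * sigma h) E)]
  congr 1
  exact ((sigma x).apply_symm_apply (sigma h E)).symm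

theorem leftReg_of_coeffFun {E F : HSigma} {f : L2G2} (hf : f =ᵐ[haarG2] coeffFun E F) (x : G2) :
    leftReg x f =ᵐ[haarG2] coeffFun E (sigma x F) := by
  filter_upwards [leftReg_apply x f,
    (measurePreserving_mul_left_G2 x⁻¹).quasiMeasurePreserving.ae hf] with h h1 h2
  rw [h1, h2, coeffFun_sigma]

/-- The coefficient maps in tensor coordinates: all of them are parts of one unitary operator. -/
theorem exists_coeff_unitary :
    ∃ Z : Lp ℂ 2 (haarK.prod (lebO.prod ((volume : Measure ℝ).prod quadRStar))) ≃ₗᵢ[ℂ] L2G2,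
    ∃ Q : Lp ℂ 2 (haarRStar.prod lebO1) ≃ₗᵢ[ℂ] Lp ℂ 2 ((volume : Measure ℝ).prod quadRStar),
      ∀ (η : L2O) (hη : MemLp (fun ω : Orbit => (rowNorm ω.1 : ℂ) * η ω) 2 lebO) (g : L2O1)
        (hg : MemLp g 2 haarRStar) (α : Lp ℂ 2 haarK) (φ : L2RStar),
        Z (tensor α (tensor η (Q (tensor φ (star g))))) =ᵐ[haarG2]
          coeffFun (eVec η hη hg) (smulVec α φ) := by
  obtain ⟨Z, hZ⟩ := exists_plane_unitary
  obtain ⟨Q, hQ⟩ := exists_line_unitary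
  refine ⟨Z, Q, fun η hη g hg α φ => ?_⟩
  refine (hZ α η hη _ _ (continuous_lineCoeff φ hg).measurable _ (norm_lineCoeff_le φ hg)
    (hQ φ g hg)).trans (Filter.Eventually.of_forall fun x => ?_)
  exact (coeffFun_smulVec η hη hg α φ x).symm

/-- For unit vectors `η` and `g` the coefficient map is an isometry. -/
theorem exists_coeff_isometry
    {Z : Lp ℂ 2 (haarK.prod (lebO.prod ((volume : Measure ℝ).prod quadRStar))) ≃ₗᵢ[ℂ] L2G2}
    {Q : Lp ℂ 2 (haarRStar.prod lebO1) ≃ₗᵢ[ℂ] Lp ℂ 2 ((volume : Measure ℝ).prod quadRStar)}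
    {η : L2O} {g : L2O1} {E : HSigma}
    (hZ : ∀ α φ, Z (tensor α (tensor η (Q (tensor φ (star g))))) =ᵐ[haarG2]
      coeffFun E (smulVec α φ)) (hη1 : inner ℂ η η = (1 : ℂ)) (hg1 : inner ℂ g g = (1 : ℂ)) :
    ∃ V : HSigma →ₗᵢ[ℂ] L2G2, (∀ F, V F =ᵐ[haarG2] coeffFun E F) ∧
      ∀ α φ, V (smulVec α φ) = Z (tensor α (tensor η (Q (tensor φ (star g))))) := by
  -- Both Gram matrices equal $\langle\alpha,\alpha'\rangle\langle\varphi,\varphi'\rangle$: the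
  -- extra factors $\langle\eta,\eta\rangle$ and $\langle g,g\rangle$ on the tensor side are $1$.
  obtain ⟨V, hV⟩ := exists_linearIsometry_of_inner_eq
    (total_smulVec (μ := haarK) (H := L2RStar))
    (e' := fun p => Z (tensor p.1 (tensor η (Q (tensor p.2 (star g)))))) fun p q => by
      simp only [Z.inner_map_map, Q.inner_map_map, inner_tensor, inner_star_star, inner_smulVec,
        hη1, hg1, one_mul, mul_one]
  have hV' : ∀ α φ, V (smulVec α φ) = Z (tensor α (tensor η (Q (tensor φ (star g))))) :=
    fun α φ => hV (α, φ)
  refine ⟨V, ?_, hV'⟩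
  refine ae_eq_coeffFun_of_total total_smulVec E V.toContinuousLinearMap fun p => ?_
  have := hZ p.1 p.2
  rw [← hV'] at this
  exact this

theorem coeffSpace_eq_range {E : HSigma} {V : HSigma →ₗᵢ[ℂ] L2G2}
    (hV : ∀ F, V F =ᵐ[haarG2] coeffFun E F) : LinearMap.range V.toLinearMap = coeffSpace E := by
  ext f
  constructor
  · rintro ⟨F, rfl⟩
    exact ⟨F, hV F⟩
  · rintro ⟨F, hF⟩
    exact ⟨F, Lp.ext ((hV F).trans hF.symm)⟩

/-- Tensor products of total families are total, and conjugation and unitary operators preserve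
totality. This is the source of completeness of the decomposition. -/
theorem totalFamily_coeff {I J : Type*}
    (Z : Lp ℂ 2 (haarK.prod (lebO.prod ((volume : Measure ℝ).prod quadRStar))) ≃ₗᵢ[ℂ] L2G2)
    (Q : Lp ℂ 2 (haarRStar.prod lebO1) ≃ₗᵢ[ℂ] Lp ℂ 2 ((volume : Measure ℝ).prod quadRStar))
    {a : I → L2O} {b : J → L2O1} (ha : TotalFamily a) (hb : TotalFamily b) :
    TotalFamily fun p : Lp ℂ 2 haarK × I × L2RStar × J =>
      Z (tensor p.1 (tensor (a p.2.1) (Q (tensor p.2.2.1 (star (b p.2.2.2)))))) := by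
  have h1 : TotalFamily fun p : L2RStar × J => tensor p.1 (star (b p.2)) :=
    TotalFamily.tensor (a := fun x => x) (b := fun j => star (b j)) total_id (total_star hb)
  have h2 : TotalFamily fun p : L2RStar × J => Q (tensor p.1 (star (b p.2))) := h1.map Q
  have h3 : TotalFamily fun p : I × L2RStar × J =>
      tensor (a p.1) (Q (tensor p.2.1 (star (b p.2.2)))) :=
    TotalFamily.tensor (a := a)
      (b := fun p : L2RStar × J => Q (tensor p.1 (star (b p.2)))) ha h2
  have h4 : TotalFamily fun p : Lp ℂ 2 haarK × I × L2RStar × J =>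
      tensor p.1 (tensor (a p.2.1) (Q (tensor p.2.2.1 (star (b p.2.2.2))))) :=
    TotalFamily.tensor (a := fun x => x) (b := fun p : I × L2RStar × J =>
      tensor (a p.1) (Q (tensor p.2.1 (star (b p.2.2))))) total_id h3
  exact h4.map Z

/-- Orthogonality of ranges need only be checked on total families, by continuity in one argument at
a time. -/
theorem inner_eq_zero_of_total {ι ι' H H' L : Type*} [NormedAddCommGroup H] [InnerProductSpace ℂ H]
    [NormedAddCommGroup H'] [InnerProductSpace ℂ H'] [NormedAddCommGroup L]
    [InnerProductSpace ℂ L] {e : ι → H} {e' : ι' → H'} (he : TotalFamily e) (he' : TotalFamily e')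
    {V : H →ₗᵢ[ℂ] L} {V' : H' →ₗᵢ[ℂ] L} (h : ∀ i i', inner ℂ (V (e i)) (V' (e' i')) = 0)
    (x : H) (y : H') : inner ℂ (V x) (V' y) = 0 := by
  have h1 : ∀ i, ∀ y, inner ℂ (V (e i)) (V' y) = 0 := by
    intro i y
    have h2 : (innerSL ℂ (V (e i))).comp V'.toContinuousLinearMap = 0 := he'.ext fun i' => by
      simpa using h i i'
    simpa using congrArg (fun T => T y) h2
  have h2 : (innerSL ℂ (V' y)).comp V.toContinuousLinearMap = 0 := he.ext fun i => by
    have := h1 i y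
    rw [← inner_conj_symm, map_eq_zero] at this
    simpa using this
  have h3 := congrArg (fun T => T x) h2
  rw [← inner_conj_symm, map_eq_zero]
  simpa using h3

end AffineTwo

end

/-! ### The orthogonal decomposition of $L^2(G_2)$ -/

open AffineTwo
theorem mainTheorem3 {I J : Type*} (η : HilbertBasis I ℂ L2O) (g : HilbertBasis J ℂ L2O1)
    (hη : ∀ i, MemLp (fun ω : Orbit => (rowNorm ω.1 : ℂ) * η i ω) 2 lebO)
    (hg : ∀ j, MemLp (g j) 2 haarRStar) :
    (∀ i j,
      IsClosed (coeffSpace (eVec (η i) (hη i) (hg j)) : Set L2G2) ∧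
      ∀ x : G2, ∀ f ∈ coeffSpace (eVec (η i) (hη i) (hg j)),
        leftReg x f ∈ coeffSpace (eVec (η i) (hη i) (hg j))) ∧
    (∀ i j, ∃ V : HSigma →ₗᵢ[ℂ] L2G2,
      (∀ F : HSigma, V F =ᵐ[haarG2] coeffFun (eVec (η i) (hη i) (hg j)) F) ∧
      LinearMap.range V.toLinearMap = coeffSpace (eVec (η i) (hη i) (hg j)) ∧
      ∀ (x : G2) (F : HSigma), V (sigma x F) = leftReg x (V F)) ∧
    IsHilbertSum ℂ (fun p : I × J => coeffSpace (eVec (η p.1) (hη p.1) (hg p.2)))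
      (fun p : I × J => (coeffSpace (eVec (η p.1) (hη p.1) (hg p.2))).subtypeₗᵢ) := by
  classical
  obtain ⟨Z, Q, hZ⟩ := exists_coeff_unitary
  have hη1 : ∀ i i', inner ℂ (η i) (η i') = if i = i' then (1 : ℂ) else 0 :=
    orthonormal_iff_ite.1 η.orthonormal
  have hg1 : ∀ j j', inner ℂ (g j) (g j') = if j = j' then (1 : ℂ) else 0 :=
    orthonormal_iff_ite.1 g.orthonormal
  choose V hV hVs using fun i j => exists_coeff_isometry (hZ (η i) (hη i) (g j) (hg j))
    (by simpa using hη1 i i) (by simpa using hg1 j j)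
  have hrange := fun i j => coeffSpace_eq_range (hV i j)
  have hclosed : ∀ i j, IsClosed (coeffSpace (eVec (η i) (hη i) (hg j)) : Set L2G2) := by
    intro i j
    rw [← hrange]
    exact (V i j).isometry.isClosedEmbedding.isClosed_range
  refine ⟨fun i j => ⟨hclosed i j, ?_⟩, fun i j => ⟨V i j, hV i j, hrange i j, ?_⟩, ?_⟩
  · rintro x f ⟨F, hF⟩
    exact ⟨sigma x F, leftReg_of_coeffFun hF x⟩
  · intro x F
    exact Lp.ext ((hV i j _).trans (leftReg_of_coeffFun (hV i j F) x).symm)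
  · have hcomplete : ∀ p : I × J, CompleteSpace (coeffSpace (eVec (η p.1) (hη p.1) (hg p.2))) :=
      fun p => (hclosed p.1 p.2).completeSpace_coe
    refine IsHilbertSum.mkInternal _ ?_ ?_
    · rintro ⟨i, j⟩ ⟨i', j'⟩ hne ⟨f, hf⟩ ⟨f', hf'⟩
      rw [← hrange] at hf hf'
      obtain ⟨F, rfl⟩ := hf
      obtain ⟨F', rfl⟩ := hf'
      refine inner_eq_zero_of_total total_smulVec total_smulVec (V := V i j) (V' := V i' j')
        (fun p p' => ?_) F F'
      -- The inner product factors, with $\langle\eta_i,\eta_{i'}\rangle$ and $\langle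
      -- g_{j'},g_j\rangle$ among the factors; conjugation reverses the order in the latter, so the
      -- inequality used below is `j' ≠ j`.
      simp only [hVs, Z.inner_map_map, Q.inner_map_map, inner_tensor, inner_star_star, hη1, hg1]
      by_cases hi : i = i'
      · have hj : j' ≠ j := fun h => hne (by rw [hi, h])
        simp [hj]
      · simp [hi]
    · rw [top_le_iff, Submodule.topologicalClosure_eq_top_iff, Submodule.eq_bot_iff]
      intro x hx
      have hηt : TotalFamily (fun i => η i) := by
        rw [TotalFamily, Submodule.dense_iff_topologicalClosure_eq_top]; exact η.dense_span
      have hgt : TotalFamily (fun j => g j) := by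
        rw [TotalFamily, Submodule.dense_iff_topologicalClosure_eq_top]; exact g.dense_span
      have htot := totalFamily_coeff Z Q hηt hgt
      -- Each member of the total family is $V_{i,j}(\alpha\otimes\varphi)$ for some $(i,j)$, so it
      -- lies in a summand to which `x` is orthogonal.
      refine htot.eq_zero fun p => ?_
      rw [← hVs]
      refine (Submodule.mem_orthogonal _ _).1 hx _ ?_
      refine Submodule.mem_iSup_of_mem (p.2.1, p.2.2.2) ?_
      rw [← hrange]
      exact ⟨_, rfl⟩
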